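/- Let $K$ be a global function field with constant field $\mathbb F_q$ (so $\mathbb F_q$ is algebraically closed in $K$). For a place $v$ of $K$ let $N(v)$ be the cardinality of its residue field, $\deg v$ the degree of the residue field over $\mathbb F_q$, and $K_v$ the completion. Fix a place $\infty$ of $K$; the other places are called finite. Let $D$ be a central simple $K$-algebra of dimension $n^2$ such that $D\otimes_K K_\infty$ is a division algebra. For every place $v$ write $D\otimes_K K_v\cong \mathrm{Mat}_{m_v}(\Delta_v)$ with $\Delta_v$ a central division algebra of dimension $d_v^2$ over $K_v$; $m_v$ is the local capacity and $d_v$ the local index of $D$ at $v$. Let $s_0=[\mathbb F_D:\mathbb F_q]$ be the largest divisor of $n$ such that $\gcd(s_0,\deg v)$ divides $m_v$ for all places $v$ of $K$. Let $s$ be a positive divisor of $s_0$, $L_s=K\cdot\mathbb F_{q^s}$ the constant field extension of degree $s$, $\iota:L_s\to D$ an embedding of $K$-algebras, and $D'_s$ the centralizer of $\iota(L_s)$ in $D$, regarded as an $L_s$-algebra through $\iota$. Let $v$ be a finite place of $K$ and $\vec f_v=(f_{v,1},\dots,f_{v,r_v})$ a vector of positive integers with $\sum_i f_{v,i}=m_v$.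 Put $$\ell_{s,v}=\gcd(s,\deg v),\quad t_{s,v}=\gcd(s/\ell_{s,v},d_v),\quad d'_v=\frac{d_v}{t_{s,v}},\quad m_v^{(s)}=\frac{m_v t_{s,v}}{s},\quad f^{(s)}_{v,i}=\Big(\frac{s}{\ell_{s,v}t_{s,v}}\Big)^{-1}f_{v,i}.$$ Let $\Omega_v=\Omega_v(D/K,s,\vec f_v)$ be the set of families $(f_{w,(i,j)})$ of non-negative integers, indexed by the places $w$ of $L_s$ above $v$, by $1\le i\le r_v$ and by $1\le j\le t_{s,v}$, such that $f_{w,i}:=\frac{s}{\ell_{s,v}t_{s,v}}\sum_j f_{w,(i,j)}$ satisfies $\sum_i f_{w,i}=m_v/\ell_{s,v}$ for every $w\mid v$ and $\sum_{w\mid v}f_{w,i}=f_{v,i}$ for every $i$. Assume that $\Omega_v$ is non-empty (then all $f_{v,i}^{(s)}$ are integers). Put $$\Theta_v(D/K,s,\vec f_v)=\sum_{(f_{w,(i,j)})\in\Omega_v}\ \prod_{w\mid v}\frac{\prod_{k=1}^{m_w}\big(N(w)^{d_wk}-1\big)}{\prod_{i=1}^{r_v}\prod_{j=1}^{t_{s,v}}\prod_{k=1}^{f_{w,(i,j)}}\big(N(w)^{d_wk}-1\big)},$$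 where $m_w$ and $d_w$ are the local capacity and the local index of $D'_s$ at $w$, and $N(w)$ is the cardinality of the residue field of $L_s$ at $w$. Let $F(T)=\sum_{\nu\ge0}a_\nu T^\nu\in\mathbb Q[[T]]$ with $a_\nu=\prod_{k=1}^{\nu}\big(N(v)^{(d'_vs/\ell_{s,v})k}-1\big)^{-1}$, and $$G(X,Y,Z)=\prod_{w=1}^{\ell_{s,v}}\prod_{i=1}^{r_v}\prod_{j=1}^{t_{s,v}}F(X_wY_iZ_j).$$ Then the coefficient of $X_1^{m_v^{(s)}}\cdots X_{\ell_{s,v}}^{m_v^{(s)}}\,Y_1^{f^{(s)}_{v,1}}\cdots Y_{r_v}^{f^{(s)}_{v,r_v}}$ in $G(X,Y,1,\dots,1)\in\mathbb Q[[X,Y]]$ equals $$\Big[\prod_{k=1}^{m_v^{(s)}}\big(N(v)^{(d'_vs/\ell_{s,v})k}-1\big)\Big]^{-\ell_{s,v}}\cdot\Theta_v(D/K,s,\vec f_v).$$ -/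

import Mathlib

open scoped TensorProduct

noncomputable section

namespace ClassNumber

universe u

/-! ### Capacity and index of a central simple algebra -/

section Wedderburn

variable (F : Type*) (B : Type u) [Field F] [Ring B] [Algebra F B]

/-- `B ≅ Mat_m(Δ)` as `F`-algebras, for some central division algebra `Δ` over `F` of
dimension `d ^ 2`. -/
def IsMatrixOver (m d : ℕ) : Prop :=
  ∃ (Δ : Type u) (_ : DivisionRing Δ) (_ : Algebra F Δ), Algebra.IsCentral F Δ ∧
    Module.finrank F Δ = d ^ 2 ∧ Nonempty (B ≃ₐ[F] Matrix (Fin m) (Fin m) Δ)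

/-- The capacity of a finite-dimensional central simple `F`-algebra `B`: the unique `m` with
`B ≅ Mat_m(Δ)`, `Δ` a central division algebra. -/
def capacity : ℕ := sInf {m | ∃ d, IsMatrixOver F B m d}

/-- The index of a finite-dimensional central simple `F`-algebra `B`: the unique `d` with
`B ≅ Mat_m(Δ)`, `Δ` a central division algebra of dimension `d ^ 2`. -/
def index : ℕ := sInf {d | ∃ m, IsMatrixOver F B m d}

/-- The degree `n` of a central simple algebra `B` of dimension `n ^ 2`. -/
def csaDegree : ℕ := Nat.sqrt (Module.finrank F B)

end Wedderburn

/-! ### Places of function fields -/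

/-- A place of the field extension `F / k`, given by its valuation ring: a valuation ring
`k ⊆ O ⊊ F` with fraction field `F`. -/
structure Place (k F : Type*) [Field k] [Field F] [Algebra k F] where
  /-- The valuation ring of the place. -/
  ring : ValuationSubring F
  algebraMap_mem : ∀ a : k, algebraMap k F a ∈ ring
  ne_top : ring ≠ ⊤

namespace Place

variable {k F : Type*} [Field k] [Field F] [Algebra k F] (v : Place k F)

/-- The residue field of a place. -/
abbrev residueField : Type _ := IsLocalRing.ResidueField v.ring

/-- The residue field is an extension of the base field `k`. -/
instance : Algebra k v.ring :=
  ((algebraMap k F).codRestrict v.ring.toSubring v.algebraMap_mem).toAlgebra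

/-- The degree `[𝔽_v : k]` of a place. -/
def degree : ℕ := Module.finrank k v.residueField

/-- `N(v)`, the cardinality of the residue field. -/
def norm : ℕ := Nat.card v.residueField

/-- The completion `F_v`. -/
abbrev completion : Type _ := v.ring.valuation.Completion

/-- The completion is an extension of `F` through the canonical embedding `F → F_v`. -/
instance : Algebra F v.completion :=
  ((algebraMap (WithVal v.ring.valuation) v.completion).comp
    (WithVal.equiv v.ring.valuation).symm.toRingHom).toAlgebra

/-- The completed algebra `B_v = F_v ⊗_F B`, as an algebra over `F_v`. -/
abbrev localAlgebra (B : Type*) [Ring B] [Algebra F B] : Type _ := v.completion ⊗[F] B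

/-- The local capacity of a central simple `F`-algebra `B` at the place `v`. -/
def localCapacity (B : Type*) [Ring B] [Algebra F B] : ℕ :=
  capacity v.completion (v.localAlgebra B)

/-- The local index of a central simple `F`-algebra `B` at the place `v`. -/
def localIndex (B : Type*) [Ring B] [Algebra F B] : ℕ :=
  index v.completion (v.localAlgebra B)

/-- `B` is definite with respect to the place `v`: the completion `B_v` is a division algebra. -/
def IsDefinite (B : Type*) [Ring B] [Algebra F B] : Prop :=
  ∀ x : v.localAlgebra B, x ≠ 0 → IsUnit x

/-- The places `w` of an extension field `L` of `F` that lie above `v`. -/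
def Above (L : Type*) [Field L] [Algebra F L] [Algebra k L] : Type _ :=
  {w : Place k L // w.ring.comap (algebraMap F L) = v.ring}

end Place

/-! ### The constant field extension and its centralizer -/

/-- The constant field extension `L_s = K · 𝔽_{q^s}` of `K` (with constant field `k` of `q`
elements), inside an algebraic closure of `K`. -/
abbrev constExt (k K : Type*) [Field k] [Field K] [Algebra k K] (s : ℕ) :
    IntermediateField K (AlgebraicClosure K) :=
  IntermediateField.adjoin K {x : AlgebraicClosure K | x ^ (Nat.card k ^ s) = x}

section Centralizer

variable {K L D : Type*} [Field K] [Field L] [Algebra K L] [Ring D] [Algebra K D]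

/-- The centralizer in `D` of the image of `ι : L → D`. -/
def Cent (ι : L →ₐ[K] D) : Type _ := Subalgebra.centralizer K (Set.range ι)

instance (ι : L →ₐ[K] D) : Ring (Cent ι) :=
  inferInstanceAs (Ring (Subalgebra.centralizer K (Set.range ι)))

/-- The centralizer of `ι(L)` is an `L`-algebra through `ι`. -/
instance (ι : L →ₐ[K] D) : Algebra L (Cent ι) :=
  RingHom.toAlgebra'
    ((ι : L →+* D).codRestrict (Subalgebra.centralizer K (Set.range ι)) (by
      intro x
      rw [Subalgebra.mem_centralizer_iff]
      rintro _ ⟨y, rfl⟩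
      change ι y * ι x = ι x * ι y
      rw [← map_mul, ← map_mul, mul_comm]))
    (by
      rintro c ⟨x, hx⟩
      apply Subtype.ext
      exact (Subalgebra.mem_centralizer_iff K).1 hx _ ⟨c, rfl⟩)

end Centralizer

/-! ### The numerical data at a place -/

section Numbers

variable {k K : Type*} [Field k] [Field K] [Algebra k K]

variable (k K) in
/-- The degree `s₀ = [𝔽_D : 𝔽_K]` of the constant field of `D`: the largest divisor `s₀` of the
degree `n` of `D` such that `gcd(s₀, deg v)` divides the local capacity `m_v` at every place
`v` of `K`. -/
def constDegree (D : Type*) [Ring D] [Algebra K D] : ℕ :=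
  sSup {s | s ∣ csaDegree K D ∧ ∀ v : Place k K, Nat.gcd s v.degree ∣ v.localCapacity D}

/-- `ℓ_{s,v} = gcd(s, deg v)`. -/
def ell (v : Place k K) (s : ℕ) : ℕ := Nat.gcd s v.degree

variable (D : Type*) [Ring D] [Algebra K D] (v : Place k K) (s : ℕ)

/-- `t_{s,v} = gcd(s / ℓ_{s,v}, d_v)`. -/
def tee : ℕ := Nat.gcd (s / ell v s) (v.localIndex D)

/-- The integer `s / (ℓ_{s,v} t_{s,v})`. -/
def ratio : ℕ := s / (ell v s * tee D v s)

/-- `d'_v = d_v / t_{s,v}`. -/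
def dPrime : ℕ := v.localIndex D / tee D v s

/-- `m_v^{(s)} = m_v t_{s,v} / s`. -/
def mS : ℕ := v.localCapacity D * tee D v s / s

/-- `f_{v,i}^{(s)} = (s / (ℓ_{s,v} t_{s,v}))⁻¹ f_{v,i}`. -/
def fS {r : ℕ} (f : Fin r → ℕ) (i : Fin r) : ℕ := f i / ratio D v s

end Numbers

/-! ### The index set and the local term -/

section Theta

variable {k K : Type*} [Field k] [Field K] [Algebra k K]

/-- The set `Ω_v(D/K, s, f_v)` of families `(f_{w,(i,j)})`, `w` above `v`, such that
`f_{w,i} := s / (ℓ t) * ∑_j f_{w,(i,j)}` satisfies `∑_i f_{w,i} = m_v / ℓ` for all `w` and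
`∑_w f_{w,i} = f_{v,i}` for all `i`. -/
def Omega (L : Type*) [Field L] [Algebra K L] [Algebra k L] (D : Type*) [Ring D] [Algebra K D]
    (v : Place k K) (s : ℕ) {r : ℕ} (f : Fin r → ℕ) :
    Set (v.Above L → Fin r → Fin (tee D v s) → ℕ) :=
  {g | (∀ w, ell v s * ∑ i, ratio D v s * ∑ j, g w i j = v.localCapacity D) ∧
    ∀ i, ∑ᶠ w, ratio D v s * ∑ j, g w i j = f i}

/-- `𝒯'_w(B, h)` for a central simple algebra `B`, a place `w` and a vector `h`. -/
def localFactor {F : Type*} [Field F] [Algebra k F] (w : Place k F) (B : Type*) [Ring B]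
    [Algebra F B] {J : Type*} [Fintype J] (h : J → ℕ) : ℚ :=
  (∏ i ∈ Finset.Icc 1 (w.localCapacity B), ((w.norm : ℚ) ^ (w.localIndex B * i) - 1)) /
    ∏ a, ∏ i ∈ Finset.Icc 1 (h a), ((w.norm : ℚ) ^ (w.localIndex B * i) - 1)

/-- `Θ_v(D/K, s, f_v)`, the sum over `Ω_v` of the products over `w ∣ v` of the local factors of
the centralizer of `ι(L_s)` in `D`. -/
def Theta {L : Type*} [Field L] [Algebra K L] [Algebra k L] {D : Type*} [Ring D] [Algebra K D]
    (ι : L →ₐ[K] D) (v : Place k K) (s : ℕ) {r : ℕ} (f : Fin r → ℕ) : ℚ :=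
  ∑ᶠ g ∈ Omega L D v s f, ∏ᶠ w : v.Above L,
    localFactor w.1 (Cent ι) (fun ij : Fin r × Fin (tee D v s) => g w ij.1 ij.2)

end Theta

/-! ### The generating function -/

/-- The coefficient `a_ν = ∏_{k = 1}^ν (Q ^ k - 1)⁻¹`. -/
def coeffA (Q : ℚ) (ν : ℕ) : ℚ := ∏ k ∈ Finset.Icc 1 ν, (Q ^ k - 1)⁻¹

/-- The power series `F(T) = ∑ a_ν T ^ ν`. -/
def seriesF (Q : ℚ) : PowerSeries ℚ := PowerSeries.mk (coeffA Q)

/-- `G(x, y, z) = ∏_{w,i,j} F(x_w y_i z_j)`, where the arguments are power series (such that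
each `x_w y_i z_j` has constant term zero). -/
def genG {σ : Type*} (Q : ℚ) {l r t : ℕ} (x : Fin l → MvPowerSeries σ ℚ)
    (y : Fin r → MvPowerSeries σ ℚ) (z : Fin t → MvPowerSeries σ ℚ) : MvPowerSeries σ ℚ :=
  ∏ w, ∏ i, ∏ j, (seriesF Q).subst (x w * y i * z j)

end ClassNumber

end

/-!
The right-hand side is made explicit by computing the local data of the centralizer `D'_s` of `L_s`,
and the identity then is the expansion of a product of power series.

*Local data.* Let `w` be a place of `L_s` above `v`. There are `ℓ = gcd(s, deg v)` such places and
`N(w) = N(v) ^ (s / ℓ)` (`Place.natCard_above`, `Place.norm_above`): the constants of degree `ℓ` have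
`ℓ` conjugates in the residue field of `v`, which separate at least `ℓ` primes, the residue field at
each of them contains the constants of degree `s`, and the fundamental identity `∑ e f = s` leaves no
room for more. The completion of `L_s` at `w` is thus the unramified extension of `K_v` of degree
`s / ℓ`. The centralizer `D'_s` is Brauer equivalent to `L_s ⊗ D` (`exists_morita`), so its local
index is the index of the base change of `D_v` to this unramified extension, which is
`d_v / gcd(s / ℓ, d_v) = d_v / t` (`index_baseChange_mul_gcd`). Comparison of dimensions shows that
its local capacity is `m_v t / s` (`Place.localCapacity_cent`). In particular `N(w) ^ d_w` is the
number `Q = N(v) ^ (d'_v s / ℓ)` for all `w` above `v`.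

*The index over an unramified extension.* That the index of `D_v` drops by the full factor
`gcd(e, d_v)` over the unramified extension of degree `e` rests on the fact that the division algebra
`Δ` underlying `D_v` contains the constants of degree `d_v` (`exists_constant_subfield`). The absolute
value `‖N(x)‖` of `Δ` has a compact valuation ring and a finite residue field, a generator of which
lifts to an element `ζ` with `ζ ^ Q = ζ` (`exists_pow_eq_self`); the centralizer of `ζ` is
generated by `ζ` and a uniformizer that commutes with it, so it is commutative and `ζ` generates
a maximal subfield (`commute_of_commute_generator`, `natDegree_minpoly_of_comm`). Then a subfield `Z`
of degree `t = gcd(e, d_v)` of the unramified extension `E` embeds in `Δ`, and `E ⊗_Z Δ` is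
a representation of `E ⊗ Δ` small enough to bound its index by `d_v / t`; the other divisibility
is general.

*Power series.* A coefficient of `∏ F(X_w Y_i)` is the sum of the products of the coefficients of `F`
over all families of exponents with the prescribed marginal sums (`coeff_genG_X_X_one`). The
conditions that define `Ω_v` are these marginal conditions, multiplied by `s / (ℓ t)`, and each local
factor of `Θ_v` is `∏ (Q ^ k - 1)`, over `k` up to the capacity, times a product of coefficients of `F`
(`Theta_eq`).
-/

open scoped NNReal Topology
open Filter

namespace ClassNumber

universe u v

/-! ### Base change of central simple algebras -/

section BaseChange
variable {F A : Type*} [Field F] [Ring A] [Algebra F A]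

attribute [local instance] TensorProduct.Algebra.module in
/-- Every `F`-linear endomorphism of a finite-dimensional central simple algebra is a sum of two-sided
multiplications. This is the density theorem for the simple bimodule `A`, whose endomorphisms are
the scalars. -/
theorem mulLeftRight_surjective [Algebra.IsCentral F A] [IsSimpleRing A] [FiniteDimensional F A] :
    Function.Surjective (AlgHom.mulLeftRight F A) := by
  have hact : ∀ (a : A) (b : Aᵐᵒᵖ) (x : A), (a ⊗ₜ[F] b) • x = a * x * b.unop := by
    intro a b x
    have := AlgHom.mulLeftRight_apply F A a b x
    exact this
  have hscal : ∀ (c : F) (x : A), ((algebraMap F (A ⊗[F] Aᵐᵒᵖ)) c) • x = c • x := by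
    intro c x
    rw [Algebra.TensorProduct.algebraMap_apply, hact]
    simp [Algebra.smul_def]
  have : IsScalarTower F (A ⊗[F] Aᵐᵒᵖ) A := by
    refine ⟨fun c r x => ?_⟩
    rw [Algebra.smul_def c r, mul_smul, hscal]
  have : SMulCommClass F (A ⊗[F] Aᵐᵒᵖ) A := by
    refine ⟨fun c r x => ?_⟩
    rw [← hscal, ← hscal, ← mul_smul, ← mul_smul, Algebra.commutes]
  -- the submodules of the bimodule `A` are the two-sided ideals
  have : IsSimpleModule (A ⊗[F] Aᵐᵒᵖ) A := by
    rw [isSimpleModule_iff_toSpanSingleton_surjective]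
    refine ⟨inferInstance, fun x hx => ?_⟩
    rw [← LinearMap.range_eq_top, eq_top_iff]
    let I : TwoSidedIdeal A := TwoSidedIdeal.mk'
      (LinearMap.range (LinearMap.toSpanSingleton (A ⊗[F] Aᵐᵒᵖ) A x) : Set A)
      (Submodule.zero_mem _) (fun h h' => Submodule.add_mem _ h h') (fun h => Submodule.neg_mem _ h)
      (fun {a y} h => by
        have := Submodule.smul_mem _ (a ⊗ₜ[F] (1 : Aᵐᵒᵖ)) h
        rw [hact] at this; simpa using this)
      (fun {y a} h => by
        have := Submodule.smul_mem _ ((1:A) ⊗ₜ[F] (MulOpposite.op a)) h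
        rw [hact] at this; simpa using this)
    have hI : (1 : A) ∈ I := by
      apply IsSimpleRing.one_mem_of_ne_zero_mem _ hx
      rw [TwoSidedIdeal.mem_mk']
      exact ⟨1, by simp⟩
    intro y _
    have : y * 1 ∈ I := I.mul_mem_left _ _ hI
    rw [mul_one, TwoSidedIdeal.mem_mk'] at this
    exact this
  have hend : ∀ g : Module.End (A ⊗[F] Aᵐᵒᵖ) A, ∃ c : F, ∀ x, g x = c • x := by
    intro g
    have h1 : ∀ x, g x = x * g 1 := fun x => by
      have := g.map_smul (x ⊗ₜ[F] (1 : Aᵐᵒᵖ)) 1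
      simpa [hact] using this
    have h2 : ∀ x, g x = g 1 * x := fun x => by
      have := g.map_smul ((1:A) ⊗ₜ[F] (MulOpposite.op x)) 1
      simpa [hact] using this
    have : g 1 ∈ Subalgebra.center F A := by
      rw [Subalgebra.mem_center_iff]
      intro b
      rw [← h1, h2]
    obtain ⟨c, hc⟩ := Algebra.IsCentral.mem_center_iff F |>.1 this
    exact ⟨c, fun x => by rw [h2, hc, Algebra.smul_def]⟩
  have : Module.Finite (Module.End (A ⊗[F] Aᵐᵒᵖ) A) A := by
    have : IsScalarTower F (Module.End (A ⊗[F] Aᵐᵒᵖ) A) A := ⟨fun c g x => by simp⟩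
    exact Module.Finite.of_restrictScalars_finite F _ _
  -- by the previous step, every `F`-linear map commutes with the bimodule endomorphisms
  intro f
  let f' : Module.End (Module.End (A ⊗[F] Aᵐᵒᵖ) A) A :=
    { toFun := f, map_add' := f.map_add, map_smul' := fun g x => by
        obtain ⟨c, hc⟩ := hend g
        simp [hc] }
  obtain ⟨r, hr⟩ := Module.Finite.toModuleEnd_moduleEnd_surjective (R := A ⊗[F] Aᵐᵒᵖ) f'
  refine ⟨r, ?_⟩
  ext x
  exact congrArg (fun h => h x) hr

/-- Two-sided multiplications by elements of `A` preserve the ideals of `E ⊗ A`. -/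
theorem lTensor_mulLeftRight_mem {E : Type*} [Field E] [Algebra F E] (I : TwoSidedIdeal (E ⊗[F] A))
    (r : A ⊗[F] Aᵐᵒᵖ) {z : E ⊗[F] A} (hz : z ∈ I) :
    (AlgHom.mulLeftRight F A r).lTensor E z ∈ I := by
  induction r with
  | zero => simp
  | add r₁ r₂ h₁ h₂ =>
    rw [map_add, LinearMap.lTensor_add]
    exact I.add_mem h₁ h₂
  | tmul x y =>
    have : (AlgHom.mulLeftRight F A (x ⊗ₜ[F] y)).lTensor E z =
        (1 ⊗ₜ x) * z * (1 ⊗ₜ y.unop) := by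
      clear hz
      induction z with
      | zero => simp
      | add z₁ z₂ h₁ h₂ => rw [map_add, h₁, h₂, mul_add, add_mul]
      | tmul e a => simp
    rw [this]
    exact I.mul_mem_right _ _ (I.mul_mem_left _ _ hz)

theorem lTensor_mulLeftRight_of_mem_center {E : Type*} [Field E] [Algebra F E]
    (r : A ⊗[F] Aᵐᵒᵖ) {z : E ⊗[F] A} (hz : ∀ y, y * z = z * y) :
    (AlgHom.mulLeftRight F A r).lTensor E z = z * (1 ⊗ₜ AlgHom.mulLeftRight F A r 1) := by
  induction r with
  | zero => simp
  | add r₁ r₂ h₁ h₂ =>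
    rw [map_add, LinearMap.lTensor_add, LinearMap.add_apply, h₁, h₂, LinearMap.add_apply,
      TensorProduct.tmul_add, mul_add]
  | tmul x y =>
    have : (AlgHom.mulLeftRight F A (x ⊗ₜ[F] y)).lTensor E z =
        (1 ⊗ₜ x) * z * (1 ⊗ₜ y.unop) := by
      clear hz
      induction z with
      | zero => simp
      | add z₁ z₂ h₁ h₂ => rw [map_add, h₁, h₂, mul_add, add_mul]
      | tmul e a => simp
    rw [this, hz, mul_assoc]
    simp

theorem lTensor_smulRight_one {E : Type*} [Field E] [Algebra F E] (φ : A →ₗ[F] F) (z : E ⊗[F] A) :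
    (φ.smulRight (1 : A)).lTensor E z =
      algebraMap E (E ⊗[F] A) (TensorProduct.rid F E (φ.lTensor E z)) := by
  induction z with
  | zero => simp
  | add z₁ z₂ h₁ h₂ => simp only [map_add, h₁, h₂]
  | tmul e a => simp [TensorProduct.smul_tmul']

variable (E : Type*) [Field E] [Algebra F E]

/-- A nonzero ideal of `E ⊗ A` contains an element with a nonzero coordinate; as coordinate functions
are sums of two-sided multiplications, the ideal contains a nonzero scalar. -/
theorem isSimpleRing_baseChange [Algebra.IsCentral F A] [IsSimpleRing A] [FiniteDimensional F A] :
    IsSimpleRing (E ⊗[F] A) := by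
  refine IsSimpleRing.of_eq_bot_or_eq_top fun I => ?_
  rw [or_iff_not_imp_left]
  intro hI
  obtain ⟨z, hzI, hz⟩ : ∃ z ∈ I, z ≠ 0 := by
    by_contra! h
    exact hI (eq_bot_iff.2 fun x hx => (TwoSidedIdeal.mem_bot _).2 (h x hx))
  let b := Module.finBasis F A
  obtain ⟨i, hi⟩ : ∃ i, TensorProduct.rid F E ((b.coord i).lTensor E z) ≠ 0 := by
    by_contra! h
    apply hz
    apply (Algebra.TensorProduct.basis E b).ext_elem
    intro i
    rw [map_zero, Finsupp.zero_apply, ← h i]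
    clear hz hzI h
    induction z with
    | zero => simp
    | add z₁ z₂ h₁ h₂ => simp only [map_add, Finsupp.add_apply, h₁, h₂]
    | tmul e a => simp [Algebra.TensorProduct.basis_repr_tmul, mul_comm, Algebra.smul_def]
  obtain ⟨r, hr⟩ := mulLeftRight_surjective (F := F) (A := A) ((b.coord i).smulRight (1 : A))
  have hmem := lTensor_mulLeftRight_mem I r hzI
  rw [hr, lTensor_smulRight_one] at hmem
  have h1 := I.mul_mem_left
    (algebraMap E _ (TensorProduct.rid F E ((b.coord i).lTensor E z))⁻¹) _ hmem
  rw [← map_mul, inv_mul_cancel₀ hi, map_one] at h1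
  exact (TwoSidedIdeal.one_mem_iff I).1 h1

/-- A central element `z` of `E ⊗ A` is unchanged by the projection `A → F`, as this is a sum of
two-sided multiplications. -/
theorem isCentral_baseChange [Algebra.IsCentral F A] [IsSimpleRing A] [FiniteDimensional F A] :
    Algebra.IsCentral E (E ⊗[F] A) := by
  constructor
  intro z hz
  rw [Subalgebra.mem_center_iff] at hz
  obtain ⟨φ, hφ⟩ : ∃ φ : A →ₗ[F] F, φ 1 = 1 := by
    obtain ⟨φ, hφ⟩ := LinearMap.exists_leftInverse_of_injective (Algebra.linearMap F A)
      (LinearMap.ker_eq_bot.2 (algebraMap F A).injective)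
    exact ⟨φ, by simpa using LinearMap.congr_fun hφ 1⟩
  obtain ⟨r, hr⟩ := mulLeftRight_surjective (F := F) (A := A) (φ.smulRight (1 : A))
  have h := lTensor_mulLeftRight_of_mem_center r hz
  rw [hr, lTensor_smulRight_one, LinearMap.smulRight_apply, hφ, one_smul,
    ← Algebra.TensorProduct.one_def, mul_one] at h
  rw [← h]
  exact Subalgebra.algebraMap_mem _ _

theorem exists_finrank_eq_sq [Algebra.IsCentral F A] [IsSimpleRing A] [FiniteDimensional F A] :
    ∃ d, Module.finrank F A = d ^ 2 := by
  have := isSimpleRing_baseChange (F := F) (A := A) (AlgebraicClosure F)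
  obtain ⟨n, hn, ⟨e⟩⟩ := IsSimpleRing.exists_algEquiv_matrix_of_isAlgClosed (AlgebraicClosure F)
    (AlgebraicClosure F ⊗[F] A)
  refine ⟨n, ?_⟩
  rw [← Module.finrank_baseChange (R := AlgebraicClosure F), e.toLinearEquiv.finrank_eq,
    Module.finrank_matrix]
  simp [sq]

end BaseChange

/-! ### Representations of matrix algebras over division rings -/

section Rep
variable {F B : Type*} [Field F] [Ring B] [Algebra F B]
  {Δ : Type*} [DivisionRing Δ] [Algebra F Δ] {m : ℕ}

/-- A module over `Mat_m(Δ)` is a sum of copies of `Δ ^ m`, whence its dimension is a multiple of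
`m [Δ : F]`. -/
theorem dvd_finrank_of_rep [FiniteDimensional F Δ] (hm : 0 < m)
    (e : B ≃ₐ[F] Matrix (Fin m) (Fin m) Δ)
    {M : Type*} [AddCommGroup M] [Module F M] [FiniteDimensional F M] (ρ : B →ₐ[F] Module.End F M) :
    m * Module.finrank F Δ ∣ Module.finrank F M := by
  obtain ⟨m, rfl⟩ : ∃ k, m = k + 1 := ⟨m - 1, by omega⟩
  let τ : Matrix (Fin (m + 1)) (Fin (m + 1)) Δ →ₐ[F] Module.End F M := ρ.comp e.symm.toAlgHom
  let E (i j : Fin (m + 1)) (c : Δ) : Module.End F M := τ (Matrix.single i j c)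
  have hE : ∀ i j k c d x, E i j c (E j k d x) = E i k (c * d) x := by
    intro i j k c d x
    rw [← Module.End.mul_apply, ← map_mul, Matrix.single_mul_single_same]
  have hE1 : ∀ x, ∑ i, E i i 1 x = x := by
    intro x
    rw [← LinearMap.sum_apply, ← map_sum]
    have : ∑ i, Matrix.single i i (1 : Δ) = (1 : Matrix (Fin (m + 1)) (Fin (m + 1)) Δ) := by
      exact Matrix.sum_single_one
    rw [this, map_one]; rfl
  let N : Submodule F M := LinearMap.range (E 0 0 1)
  have hN : ∀ y ∈ N, E 0 0 1 y = y := by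
    rintro _ ⟨x, rfl⟩
    rw [hE, mul_one]
  have hmemN : ∀ j c x, E 0 j c x ∈ N := fun j c x => ⟨E 0 j c x, by rw [hE, one_mul]⟩
  let _ : Module Δ N :=
    { smul := fun c y => ⟨E 0 0 c y, hmemN _ _ _⟩
      one_smul := fun y => Subtype.ext (hN _ y.2)
      mul_smul := fun c d y => Subtype.ext (hE _ _ _ _ _ _).symm
      smul_zero := fun c => Subtype.ext (map_zero _)
      smul_add := fun c x y => Subtype.ext (map_add _ _ _)
      add_smul := fun c d y => Subtype.ext (by
        change E 0 0 (c + d) (y : M) = E 0 0 c y + E 0 0 d y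
        rw [← LinearMap.add_apply, ← map_add, ← Matrix.single_add])
      zero_smul := fun y => Subtype.ext (by
        change E 0 0 0 (y : M) = 0
        simp [E]) }
  have : IsScalarTower F Δ N := by
    refine ⟨fun a c y => Subtype.ext ?_⟩
    change E 0 0 (a • c) (y : M) = a • E 0 0 c y
    rw [← LinearMap.smul_apply, ← map_smul, Matrix.smul_single]
  -- the matrix units `E i 0` identify `M` with `m + 1` copies of `N = e₀₀ M`
  have h1 : Module.finrank F M = (m + 1) * Module.finrank F N := by
    let Φ : M ≃ₗ[F] (Fin (m + 1) → N) :=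
      { toFun := fun x i => ⟨E 0 i 1 x, hmemN _ _ _⟩
        map_add' := fun x y => by ext i; simp
        map_smul' := fun a x => by ext i; simp
        invFun := fun y => ∑ i, E i 0 1 (y i)
        left_inv := fun x => by simp [hE, hE1]
        right_inv := fun y => by
          ext i
          simp only [map_sum]
          rw [Finset.sum_eq_single i]
          · rw [hE, one_mul, hN _ (y i).2]
          · intro j _ hj
            rw [← Module.End.mul_apply, ← map_mul, Matrix.single_mul_single_of_ne _ _ _ _ hj.symm]
            simp
          · simp }
    rw [Φ.finrank_eq, Module.finrank_pi_fintype]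
    simp
  rw [h1, ← Module.finrank_mul_finrank F Δ N, ← mul_assoc]
  exact Dvd.intro _ rfl

theorem exists_rep_of_matrix (e : B ≃ₐ[F] Matrix (Fin m) (Fin m) Δ) :
    Nonempty (B →ₐ[F] Module.End F (Fin m → Δ)) := by
  let τ : Matrix (Fin m) (Fin m) Δ →ₐ[F] Module.End F (Fin m → Δ) :=
    AlgHom.ofLinearMap
      { toFun := fun M => { toFun := fun v => M.mulVec v
                            map_add' := fun v w => Matrix.mulVec_add _ _ _
                            map_smul' := fun c v => Matrix.mulVec_smul _ _ _ }
        map_add' := fun M N => LinearMap.ext fun v => Matrix.add_mulVec M N v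
        map_smul' := fun c M => LinearMap.ext fun v => Matrix.smul_mulVec c M v }
      (LinearMap.ext fun v => Matrix.one_mulVec v)
      (fun M N => LinearMap.ext fun v => (Matrix.mulVec_mulVec v M N).symm)
  exact ⟨τ.comp e.toAlgHom⟩

theorem isCentral_of_matrix [NeZero m] [h : Algebra.IsCentral F (Matrix (Fin m) (Fin m) Δ)] :
    Algebra.IsCentral F Δ := by
  constructor
  intro x hx
  rw [Subalgebra.mem_center_iff] at hx
  have : Matrix.scalar (Fin m) x ∈ Subalgebra.center F (Matrix (Fin m) (Fin m) Δ) := by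
    rw [Subalgebra.mem_center_iff]
    intro M
    ext i j
    simp [Matrix.scalar_apply, hx]
  obtain ⟨c, hc⟩ := Algebra.IsCentral.mem_center_iff F |>.1 this
  rw [Algebra.mem_bot]
  refine ⟨c, ?_⟩
  have := congrFun (congrFun hc 0) 0
  simpa [Matrix.algebraMap_matrix_apply] using this.symm

end Rep

/-! ### Capacity and index -/

section CapInd
variable {F : Type*} {B : Type u} [Field F] [Ring B] [Algebra F B]

theorem finiteDimensional_of_matrix {Δ : Type*} [DivisionRing Δ] [Algebra F Δ] {m : ℕ} (hm : 0 < m)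
    [FiniteDimensional F B] (e : B ≃ₐ[F] Matrix (Fin m) (Fin m) Δ) : FiniteDimensional F Δ := by
  have := Module.Finite.equiv e.toLinearEquiv
  exact .of_surjective (Matrix.entryLinearMap F Δ (⟨0, hm⟩ : Fin m) (⟨0, hm⟩ : Fin m))
    fun f ↦ ⟨fun _ _ ↦ f, rfl⟩

theorem finrank_of_matrix {Δ : Type*} [DivisionRing Δ] [Algebra F Δ] {m : ℕ}
    (e : B ≃ₐ[F] Matrix (Fin m) (Fin m) Δ) : Module.finrank F B = m ^ 2 * Module.finrank F Δ := by
  rw [e.toLinearEquiv.finrank_eq, Module.finrank_matrix]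
  simp [sq]

/-- Uniqueness in Wedderburn's theorem: by comparison of dimensions, `Δ ^ m` being a module over
`Mat_{m'}(Δ')` and vice versa. -/
theorem matrix_size_unique [FiniteDimensional F B] [Nontrivial B]
    {Δ Δ' : Type*} [DivisionRing Δ] [Algebra F Δ] [DivisionRing Δ'] [Algebra F Δ'] {m m' d d' : ℕ}
    (e : B ≃ₐ[F] Matrix (Fin m) (Fin m) Δ) (hd : Module.finrank F Δ = d ^ 2)
    (e' : B ≃ₐ[F] Matrix (Fin m') (Fin m') Δ') (hd' : Module.finrank F Δ' = d' ^ 2) :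
    m = m' ∧ d = d' := by
  have hm : 0 < m := by
    rcases Nat.eq_zero_or_pos m with rfl | h
    · exact absurd (e.toEquiv.subsingleton) (not_subsingleton B)
    · exact h
  have hm' : 0 < m' := by
    rcases Nat.eq_zero_or_pos m' with rfl | h
    · exact absurd (e'.toEquiv.subsingleton) (not_subsingleton B)
    · exact h
  have := finiteDimensional_of_matrix hm e
  have := finiteDimensional_of_matrix hm' e'
  obtain ⟨ρ⟩ := exists_rep_of_matrix e
  obtain ⟨ρ'⟩ := exists_rep_of_matrix e'
  have h1 := dvd_finrank_of_rep hm e ρ'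
  have h2 := dvd_finrank_of_rep hm' e' ρ
  rw [Module.finrank_pi_fintype] at h1 h2
  simp only [Finset.sum_const, Finset.card_univ, Fintype.card_fin, smul_eq_mul, hd, hd'] at h1 h2
  have h3 := Nat.dvd_antisymm h1 h2
  have h4 : (m * d) ^ 2 = (m' * d') ^ 2 := by
    have := (finrank_of_matrix e).symm.trans (finrank_of_matrix e')
    rw [hd, hd'] at this
    linarith
  have h5 : m * d = m' * d' := by
    exact Nat.pow_left_injective (n := 2) (by norm_num) h4
  have hdpos : 0 < d := by
    rcases Nat.eq_zero_or_pos d with rfl | h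
    · exact absurd hd (by simpa using Module.finrank_pos.ne')
    · exact h
  have h6 : (m * d) * d = (m * d) * d' := by
    calc (m * d) * d = m * d ^ 2 := by ring
      _ = m' * d' ^ 2 := h3
      _ = (m' * d') * d' := by ring
      _ = _ := by rw [h5]
  have h7 : d = d' := Nat.eq_of_mul_eq_mul_left (by positivity) h6
  subst h7
  exact ⟨Nat.eq_of_mul_eq_mul_right hdpos h5, rfl⟩

variable (F B) in
theorem exists_isMatrixOver [Algebra.IsCentral F B] [IsSimpleRing B] [FiniteDimensional F B] :
    ∃ m d, IsMatrixOver F B m d ∧ 0 < m ∧ 0 < d := by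
  have : IsArtinianRing B := IsArtinianRing.of_finite F B
  obtain ⟨m, hm, Δ, _, _, _, ⟨e⟩⟩ := IsSimpleRing.exists_algEquiv_matrix_divisionRing_finite F B
  have := Algebra.IsCentral.of_algEquiv F _ _ e
  have := isCentral_of_matrix (F := F) (Δ := Δ) (m := m)
  obtain ⟨d, hd⟩ := exists_finrank_eq_sq (F := F) (A := Δ)
  refine ⟨m, d, ⟨Δ, _, _, this, hd, ⟨e⟩⟩, Nat.pos_of_ne_zero hm.1, ?_⟩
  rcases Nat.eq_zero_or_pos d with rfl | h
  · exact absurd hd (by simpa using Module.finrank_pos.ne')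
  · exact h

variable [Algebra.IsCentral F B] [IsSimpleRing B] [FiniteDimensional F B]

theorem capacity_index_of_algEquiv {Δ : Type*} [DivisionRing Δ] [Algebra F Δ] {m d : ℕ}
    (e : B ≃ₐ[F] Matrix (Fin m) (Fin m) Δ) (hd : Module.finrank F Δ = d ^ 2) :
    capacity F B = m ∧ index F B = d := by
  have key : ∀ m' d', IsMatrixOver F B m' d' → m = m' ∧ d = d' := by
    rintro m' d' ⟨Δ', _, _, _, h, ⟨e'⟩⟩
    exact matrix_size_unique e hd e' h
  obtain ⟨m₀, d₀, h₀, -, -⟩ := exists_isMatrixOver F B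
  obtain ⟨rfl, rfl⟩ := key _ _ h₀
  constructor
  · have : {m' | ∃ d, IsMatrixOver F B m' d} = {m} := by
      ext m'
      exact ⟨fun ⟨d', h⟩ => (key _ _ h).1.symm, fun h => ⟨d, by rw [h]; exact h₀⟩⟩
    rw [capacity, this, csInf_singleton]
  · have : {d' | ∃ m, IsMatrixOver F B m d'} = {d} := by
      ext d'
      exact ⟨fun ⟨m', h⟩ => (key _ _ h).2.symm, fun h => ⟨m, by rw [h]; exact h₀⟩⟩
    rw [index, this, csInf_singleton]

variable (F B) in
theorem isMatrixOver_capacity_index : IsMatrixOver F B (capacity F B) (index F B) := by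
  obtain ⟨m, d, h, -, -⟩ := exists_isMatrixOver F B
  have h' := h
  obtain ⟨Δ, _, _, _, hd, ⟨e⟩⟩ := h'
  obtain ⟨h1, h2⟩ := capacity_index_of_algEquiv e hd
  rwa [h1, h2]

variable (F B) in
theorem capacity_pos : 0 < capacity F B := by
  obtain ⟨m, d, ⟨Δ, _, _, _, hd, ⟨e⟩⟩, hm, -⟩ := exists_isMatrixOver F B
  rwa [(capacity_index_of_algEquiv e hd).1]

variable (F B) in
theorem index_pos : 0 < index F B := by
  obtain ⟨m, d, ⟨Δ, _, _, _, hd, ⟨e⟩⟩, -, hm⟩ := exists_isMatrixOver F B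
  rwa [(capacity_index_of_algEquiv e hd).2]

variable (F B) in
theorem sq_capacity_mul_index : (capacity F B * index F B) ^ 2 = Module.finrank F B := by
  obtain ⟨Δ, _, _, _, hd, ⟨e⟩⟩ := isMatrixOver_capacity_index F B
  rw [finrank_of_matrix e, hd, mul_pow]

theorem capacity_mul_index_of_sq {n : ℕ} (h : Module.finrank F B = n ^ 2) :
    capacity F B * index F B = n :=
  Nat.pow_left_injective (n := 2) (by norm_num) ((sq_capacity_mul_index F B).trans h)

/-- A representation of dimension `deg(B) * j` forces the index to divide `j`. -/
theorem index_dvd_of_rep {M : Type*} [AddCommGroup M] [Module F M] [FiniteDimensional F M]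
    (ρ : B →ₐ[F] Module.End F M) {j : ℕ}
    (h : Module.finrank F M = capacity F B * index F B * j) : index F B ∣ j := by
  obtain ⟨Δ, _, _, _, hd, ⟨e⟩⟩ := isMatrixOver_capacity_index F B
  have := finiteDimensional_of_matrix (capacity_pos F B) e
  have h1 := dvd_finrank_of_rep (capacity_pos F B) e ρ
  rw [hd, h, sq, ← mul_assoc] at h1
  exact Nat.dvd_of_mul_dvd_mul_left (Nat.mul_pos (capacity_pos F B) (index_pos F B)) h1

variable (F B) in
/-- The module `Δ ^ m` over `B = Mat_m(Δ)`, of dimension `m d ^ 2`. -/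
theorem exists_rep_finrank_eq : ∃ (M : Type u) (_ : AddCommGroup M) (_ : Module F M)
    (_ : FiniteDimensional F M) (_ : B →ₐ[F] Module.End F M),
    Module.finrank F M = capacity F B * index F B * index F B := by
  obtain ⟨Δ, _, _, _, hd, ⟨e⟩⟩ := isMatrixOver_capacity_index F B
  have := finiteDimensional_of_matrix (capacity_pos F B) e
  obtain ⟨ρ⟩ := exists_rep_of_matrix e
  refine ⟨Fin (capacity F B) → Δ, inferInstance, inferInstance, inferInstance, ρ, ?_⟩
  rw [Module.finrank_pi_fintype]
  simp [hd, sq, mul_assoc]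

/-- The index is invariant under passing to matrix algebras. -/
theorem index_eq_of_algEquiv_matrix {A : Type*} [Ring A] [Algebra F A] [Algebra.IsCentral F A]
    [IsSimpleRing A] [FiniteDimensional F A] {m : ℕ} (e : B ≃ₐ[F] Matrix (Fin m) (Fin m) A) :
    index F B = index F A := by
  obtain ⟨Δ, _, _, _, hd, ⟨e'⟩⟩ := isMatrixOver_capacity_index F A
  let e'' : B ≃ₐ[F] Matrix (Fin (m * capacity F A)) (Fin (m * capacity F A)) Δ :=
    e.trans <| e'.mapMatrix.trans <| (Matrix.compAlgEquiv (Fin m) (Fin (capacity F A)) Δ F).trans <|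
      Matrix.reindexAlgEquiv F Δ finProdFinEquiv
  exact (capacity_index_of_algEquiv e'' hd).2

theorem index_congr {A : Type*} [Ring A] [Algebra F A] [Algebra.IsCentral F A]
    [IsSimpleRing A] [FiniteDimensional F A] (e : B ≃ₐ[F] A) : index F B = index F A := by
  obtain ⟨Δ, _, _, _, hd, ⟨e'⟩⟩ := isMatrixOver_capacity_index F A
  exact (capacity_index_of_algEquiv (e.trans e') hd).2

end CapInd

section BaseChangeMatrix
variable {F : Type*} [Field F]

/-- Base change commutes with the formation of matrix algebras. -/
theorem exists_baseChange_matrix_algEquiv (E : Type*) [Field E] [Algebra F E] (A : Type*) [Ring A]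
    [Algebra F A] (m : ℕ) :
    Nonempty (E ⊗[F] Matrix (Fin m) (Fin m) A ≃ₐ[E] Matrix (Fin m) (Fin m) (E ⊗[F] A)) := by
  let e0 : E ≃ₐ[E] Matrix (Fin 1) (Fin 1) E :=
    AlgEquiv.ofBijective (Algebra.ofId E _) ⟨(algebraMap E (Matrix (Fin 1) (Fin 1) E)).injective,
      fun M => ⟨M 0 0, by
        ext i j
        rw [Subsingleton.elim i 0, Subsingleton.elim j 0]
        simp [Algebra.ofId_apply, Matrix.algebraMap_matrix_apply]⟩⟩
  exact ⟨(Algebra.TensorProduct.congr e0 AlgEquiv.refl).trans <|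
    (Matrix.kroneckerTMulAlgEquiv (Fin 1) (Fin m) F E E A).trans <|
    Matrix.reindexAlgEquiv E _ (Equiv.uniqueProd (Fin m) (Fin 1))⟩
end BaseChangeMatrix

/-! ### The centralizer of a subfield -/

/-- The analogue of `Algebra.IsCentral.of_algEquiv` for algebras in different universes. -/
theorem isCentral_of_algEquiv {F A B : Type*} [Field F] [Ring A] [Ring B] [Algebra F A]
    [Algebra F B] [Algebra.IsCentral F A] (e : A ≃ₐ[F] B) : Algebra.IsCentral F B := by
  constructor
  intro b hb
  have h : e.symm b ∈ Subalgebra.center F A := by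
    rw [Subalgebra.mem_center_iff] at hb ⊢
    intro a
    apply e.injective
    rw [map_mul, map_mul, e.apply_symm_apply, hb]
  obtain ⟨c, hc⟩ := (Algebra.IsCentral.mem_center_iff F).1 h
  exact Algebra.mem_bot.2 ⟨c, by rw [← e.commutes, ← hc, e.apply_symm_apply]⟩

section Morita

variable {K : Type u} {L : Type v} {D : Type w} [Field K] [Field L] [Algebra K L] [Ring D]
  [Algebra K D]

/-- `D` regarded as a vector space over `L` through right multiplication by `ι`. -/
def RightModule (_ : L →ₐ[K] D) : Type _ := D

variable (ι : L →ₐ[K] D)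

instance : AddCommGroup (RightModule ι) := inferInstanceAs (AddCommGroup D)

instance : Module K (RightModule ι) := inferInstanceAs (Module K D)

/-- The identity map, from `D` to its copy `RightModule ι`. -/
def toRight : D ≃ₗ[K] RightModule ι := LinearEquiv.refl K D

instance : Module L (RightModule ι) where
  smul x y := toRight ι ((toRight ι).symm y * ι x)
  one_smul y := by change toRight ι (_ * _) = _; simp
  mul_smul a b y := by
    change toRight ι (_ * _) = toRight ι ((toRight ι).symm (toRight ι (_ * _)) * _)
    rw [mul_comm a b, map_mul ι, LinearEquiv.symm_apply_apply, mul_assoc]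
  smul_zero a := by change toRight ι (_ * _) = _; simp
  smul_add a x y := by
    change toRight ι (_ * _) = toRight ι (_ * _) + toRight ι (_ * _)
    simp [add_mul]
  add_smul a b y := by
    change toRight ι (_ * _) = toRight ι (_ * _) + toRight ι (_ * _)
    simp [mul_add]
  zero_smul y := by change toRight ι (_ * _) = _; simp

theorem smul_toRight (x : L) (y : D) : x • toRight ι y = toRight ι (y * ι x) := rfl

instance : IsScalarTower K L (RightModule ι) where
  smul_assoc a x y := by
    obtain ⟨y, rfl⟩ := (toRight ι).surjective y
    rw [smul_toRight, smul_toRight, map_smul, mul_smul_comm, map_smul]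

/-- Left multiplication by `d`, as an `L`-linear map. -/
noncomputable def leftMul (d : D) : Module.End L (RightModule ι) where
  toFun y := toRight ι (d * (toRight ι).symm y)
  map_add' x y := by simp [mul_add]
  map_smul' a y := by
    obtain ⟨y, rfl⟩ := (toRight ι).surjective y
    simp [smul_toRight, mul_assoc]

theorem leftMul_toRight (d y : D) : leftMul ι d (toRight ι y) = toRight ι (d * y) := by
  simp [leftMul]

/-- Left multiplication on `D`, as a linear map. -/
noncomputable def leftMulLinear : D →ₗ[K] Module.End L (RightModule ι) where
  toFun := leftMul ι
  map_add' d d' := LinearMap.ext fun y => by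
    obtain ⟨y, rfl⟩ := (toRight ι).surjective y
    rw [LinearMap.add_apply, leftMul_toRight, leftMul_toRight, leftMul_toRight, add_mul, map_add]
  map_smul' a d := LinearMap.ext fun y => by
    obtain ⟨y, rfl⟩ := (toRight ι).surjective y
    rw [LinearMap.smul_apply, leftMul_toRight, leftMul_toRight, smul_mul_assoc, map_smul]; rfl

/-- The action of `D` on itself by left multiplication. -/
noncomputable def leftMulHom : D →ₐ[K] Module.End L (RightModule ι) :=
  AlgHom.ofLinearMap (leftMulLinear ι)
    (LinearMap.ext fun y => by
      obtain ⟨y, rfl⟩ := (toRight ι).surjective y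
      change leftMul ι 1 _ = _
      rw [leftMul_toRight, one_mul, Module.End.one_apply])
    (fun d d' => LinearMap.ext fun y => by
      obtain ⟨y, rfl⟩ := (toRight ι).surjective y
      change leftMul ι _ _ = leftMul ι _ (leftMul ι _ _)
      rw [leftMul_toRight, leftMul_toRight, leftMul_toRight, mul_assoc])

/-- The action of `L ⊗ D` on `D`, where `L` acts from the right and `D` from the left. -/
noncomputable def biAction : L ⊗[K] D →ₐ[L] Module.End L (RightModule ι) :=
  Algebra.TensorProduct.lift (Algebra.ofId L _) (leftMulHom ι)
    (fun a d => by
      rw [Commute, SemiconjBy, Algebra.ofId_apply, Algebra.commutes])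

theorem biAction_tmul (x : L) (d y : D) :
    biAction ι (x ⊗ₜ d) (toRight ι y) = toRight ι (d * y * ι x) := by
  rw [biAction, Algebra.TensorProduct.lift_tmul, Module.End.mul_apply, Algebra.ofId_apply,
    Module.algebraMap_end_apply]
  change x • leftMul ι d _ = _
  rw [leftMul_toRight, smul_toRight]

noncomputable instance : Module (L ⊗[K] D) (RightModule ι) :=
  Module.compHom _ (biAction ι).toRingHom

theorem tensor_smul_def (r : L ⊗[K] D) (y : RightModule ι) : r • y = biAction ι r y := rfl

theorem tmul_smul_toRight (x : L) (d y : D) :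
    (x ⊗ₜ[K] d) • toRight ι y = toRight ι (d * y * ι x) := biAction_tmul ι x d y

instance : IsScalarTower L (L ⊗[K] D) (RightModule ι) where
  smul_assoc a r y := by
    rw [tensor_smul_def, map_smul]; rfl

instance : SMulCommClass (L ⊗[K] D) L (RightModule ι) where
  smul_comm r a y := by
    rw [tensor_smul_def, tensor_smul_def, map_smul]

/-- The element of `D` underlying an element of the centralizer. -/
def Cent.val (c : Cent ι) : D := c.1

theorem Cent.comm (c : Cent ι) (x : L) : ι x * c.val ι = c.val ι * ι x :=
  (Subalgebra.mem_centralizer_iff K).1 c.2 _ ⟨x, rfl⟩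

/-- Right multiplication by an element of the centralizer of `ι(L)`. -/
noncomputable def rightMul (c : Cent ι) : Module.End (L ⊗[K] D) (RightModule ι) where
  toFun y := toRight ι ((toRight ι).symm y * Cent.val ι c)
  map_add' x y := by simp [add_mul]
  map_smul' r y := by
    obtain ⟨y, rfl⟩ := (toRight ι).surjective y
    induction r with
    | zero => simp
    | add r₁ r₂ h₁ h₂ => simp only [add_smul, map_add, add_mul, h₁, h₂]
    | tmul x d =>
      simp only [tmul_smul_toRight, LinearEquiv.symm_apply_apply, RingHom.id_apply]
      rw [mul_assoc, Cent.comm]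
      simp only [mul_assoc]

theorem rightMul_toRight (c : Cent ι) (y : D) :
    rightMul ι c (toRight ι y) = toRight ι (y * Cent.val ι c) := by
  change toRight ι ((toRight ι).symm (toRight ι y) * Cent.val ι c) = _
  rw [LinearEquiv.symm_apply_apply]

/-- Right multiplication by the centralizer of `ι(L)`, as a linear map. -/
noncomputable def rightMulLinear : (Cent ι)ᵐᵒᵖ →ₗ[L] Module.End (L ⊗[K] D) (RightModule ι) where
  toFun c := rightMul ι c.unop
  map_add' c c' := LinearMap.ext fun y => by
    obtain ⟨y, rfl⟩ := (toRight ι).surjective y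
    rw [LinearMap.add_apply, rightMul_toRight, rightMul_toRight, rightMul_toRight, ← map_add,
      ← mul_add]
    rfl
  map_smul' x c := LinearMap.ext fun y => by
    obtain ⟨y, rfl⟩ := (toRight ι).surjective y
    rw [RingHom.id_apply, LinearMap.smul_apply, rightMul_toRight, rightMul_toRight, smul_toRight,
      mul_assoc, ← Cent.comm]
    rfl

/-- The action of the opposite of the centralizer of `ι(L)` by right multiplication. -/
noncomputable def rightMulHom : (Cent ι)ᵐᵒᵖ →ₐ[L] Module.End (L ⊗[K] D) (RightModule ι) :=
  AlgHom.ofLinearMap (rightMulLinear ι)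
    (LinearMap.ext fun y => by
      obtain ⟨y, rfl⟩ := (toRight ι).surjective y
      change rightMul ι 1 _ = _
      rw [rightMul_toRight, Module.End.one_apply]
      change toRight ι (y * 1) = _
      rw [mul_one])
    (fun c c' => LinearMap.ext fun y => by
      obtain ⟨y, rfl⟩ := (toRight ι).surjective y
      change rightMul ι (c'.unop * c.unop) _ = rightMul ι _ (rightMul ι _ _)
      rw [rightMul_toRight, rightMul_toRight, rightMul_toRight, mul_assoc]
      rfl)

/-- An endomorphism of the bimodule `D` is right multiplication by the image of `1`. -/
theorem rightMulHom_bijective : Function.Bijective (rightMulHom ι) := by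
  constructor
  · intro c c' h
    have := LinearMap.congr_fun h (toRight ι 1)
    change rightMul ι c.unop _ = rightMul ι c'.unop _ at this
    rw [rightMul_toRight, rightMul_toRight, one_mul, one_mul] at this
    exact MulOpposite.unop_injective (Subtype.ext ((toRight ι).injective this))
  · intro f
    obtain ⟨g, hg⟩ : ∃ g : D → D, ∀ y, f (toRight ι y) = toRight ι (g y) :=
      ⟨fun y => (toRight ι).symm (f (toRight ι y)), fun y => by simp⟩
    have hf : ∀ (x : L) (d y : D), g (d * y * ι x) = d * g y * ι x := by
      intro x d y
      apply (toRight ι).injective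
      rw [← hg, ← tmul_smul_toRight, map_smul, hg, tmul_smul_toRight]
    have h1 : ∀ y : D, g y = y * g 1 := fun y => by simpa using hf 1 y 1
    have h2 : ∀ x : L, g (ι x) = g 1 * ι x := fun x => by simpa using hf x 1 1
    have h3 : g 1 ∈ Subalgebra.centralizer K (Set.range ι) := by
      rw [Subalgebra.mem_centralizer_iff]
      rintro _ ⟨x, rfl⟩
      rw [← h2]; exact (h1 _).symm
    refine ⟨MulOpposite.op ⟨g 1, h3⟩, LinearMap.ext fun y => ?_⟩
    obtain ⟨y, rfl⟩ := (toRight ι).surjective y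
    change rightMul ι _ _ = _
    rw [rightMul_toRight, hg, h1 y]
    rfl

/-- The centralizer of `ι(L)` is opposite to the endomorphism algebra of the bimodule `D`. -/
noncomputable def centEquiv : (Cent ι)ᵐᵒᵖ ≃ₐ[L] Module.End (L ⊗[K] D) (RightModule ι) :=
  AlgEquiv.ofBijective (rightMulHom ι) (rightMulHom_bijective ι)

/-- The algebra `L ⊗ D` and the centralizer of `L` in `D` are matrix algebras over the same
division algebra. -/
theorem exists_morita [Algebra.IsCentral K D] [IsSimpleRing D] [FiniteDimensional K D]
    [FiniteDimensional K L] :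
    ∃ (Δ : Type (max v w)) (_ : DivisionRing Δ) (_ : Algebra L Δ) (a b : ℕ), 0 < a ∧ 0 < b ∧
      Algebra.IsCentral L Δ ∧ FiniteDimensional L Δ ∧
      Nonempty (L ⊗[K] D ≃ₐ[L] Matrix (Fin a) (Fin a) Δ) ∧
      Nonempty (Cent ι ≃ₐ[L] Matrix (Fin b) (Fin b) Δ) ∧
      Module.finrank L (RightModule ι) = b * a * Module.finrank L Δ := by
  have := isSimpleRing_baseChange (F := K) (A := D) L
  have hcen := isCentral_baseChange (F := K) (A := D) L
  have : IsArtinianRing (L ⊗[K] D) := IsArtinianRing.of_finite L _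
  have : FiniteDimensional K (RightModule ι) := Module.Finite.equiv (toRight ι)
  have : FiniteDimensional L (RightModule ι) := Module.Finite.of_restrictScalars_finite K _ _
  have : Module.Finite (L ⊗[K] D) (RightModule ι) := Module.Finite.of_restrictScalars_finite L _ _
  have : Nontrivial D := IsSimpleRing.instNontrivial
  have : Nontrivial (RightModule ι) := (toRight ι).symm.toEquiv.nontrivial
  obtain ⟨a, ha, S, hS, ⟨e⟩⟩ := (IsSimpleRing.isIsotypic (L ⊗[K] D) (L ⊗[K] D)).linearEquiv_fun
  obtain ⟨b, hb, S', hS', ⟨e'⟩⟩ :=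
    (IsSimpleRing.isIsotypic (L ⊗[K] D) (RightModule ι)).linearEquiv_fun
  have : IsSimpleModule (L ⊗[K] D) S := hS
  obtain ⟨f⟩ : Nonempty (S' ≃ₗ[L ⊗[K] D] S) := by
    obtain ⟨T, ⟨g⟩⟩ := IsSemisimpleRing.exists_linearEquiv_ideal_of_isSimpleModule (L ⊗[K] D) S'
    have : IsSimpleModule (L ⊗[K] D) T := IsSimpleModule.congr g.symm
    obtain ⟨h⟩ := IsSimpleRing.isIsotypic (L ⊗[K] D) (L ⊗[K] D) S T
    exact ⟨g.trans h⟩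
  let e'' : RightModule ι ≃ₗ[L ⊗[K] D] (Fin b → S) := e'.trans (LinearEquiv.piCongrRight fun _ => f)
  classical
  -- `L ⊗ D` and `Cent ι` are opposite to the endomorphism rings of `S ^ a` and `S ^ b`
  let E1 : L ⊗[K] D ≃ₐ[L] Matrix (Fin a) (Fin a) (Module.End (L ⊗[K] D) S)ᵐᵒᵖ :=
    .trans (.opOp L (L ⊗[K] D)) <| .trans (.op (.trans (.moduleEndSelf L) <|
      .trans (e.conjAlgEquiv L) (endVecAlgEquivMatrixEnd ..))) (.symm .mopMatrix)
  let E2 : Cent ι ≃ₐ[L] Matrix (Fin b) (Fin b) (Module.End (L ⊗[K] D) S)ᵐᵒᵖ :=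
    .trans (.opOp L (Cent ι)) <| .trans (.op (.trans (centEquiv ι) <|
      .trans (e''.conjAlgEquiv L) (endVecAlgEquivMatrixEnd ..))) (.symm .mopMatrix)
  have hfd := finiteDimensional_of_matrix (Nat.pos_of_ne_zero ha.1) E1
  have hc : Algebra.IsCentral L (Module.End (L ⊗[K] D) S)ᵐᵒᵖ := by
    have := Algebra.IsCentral.of_algEquiv L _ _ E1
    exact isCentral_of_matrix (m := a)
  refine ⟨(Module.End (L ⊗[K] D) S)ᵐᵒᵖ, inferInstance, inferInstance, a, b, Nat.pos_of_ne_zero ha.1,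
    Nat.pos_of_ne_zero hb.1, hc, hfd, ⟨E1⟩, ⟨E2⟩, ?_⟩
  have h1 := finrank_of_matrix E1
  have h2 : Module.finrank L (L ⊗[K] D) = a * Module.finrank L S := by
    rw [(e.restrictScalars L).finrank_eq, Module.finrank_pi_fintype]
    simp
  have h3 : Module.finrank L (RightModule ι) = b * Module.finrank L S := by
    rw [(e''.restrictScalars L).finrank_eq, Module.finrank_pi_fintype]
    simp
  have h4 : Module.finrank L S = a * Module.finrank L (Module.End (L ⊗[K] D) S)ᵐᵒᵖ := by
    apply Nat.eq_of_mul_eq_mul_left (Nat.pos_of_ne_zero ha.1)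
    rw [← h2, h1, sq, mul_assoc]
  rw [h3, h4, mul_assoc]

theorem finrank_rightModule [FiniteDimensional K D] :
    Module.finrank K L * Module.finrank L (RightModule ι) = Module.finrank K D := by
  rw [Module.finrank_mul_finrank, ← (toRight ι).finrank_eq]

/-- The centralizer of `ι(L)` is a central simple `L`-algebra of degree `n / [L : K]`. -/
theorem centralizer_properties [Algebra.IsCentral K D] [IsSimpleRing D] [FiniteDimensional K D]
    [FiniteDimensional K L] :
    Algebra.IsCentral L (Cent ι) ∧ IsSimpleRing (Cent ι) ∧ FiniteDimensional L (Cent ι) ∧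
      Module.finrank K L ^ 2 * Module.finrank L (Cent ι) = Module.finrank K D := by
  obtain ⟨Δ, _, _, a, b, ha, hb, hc, hfd, ⟨E1⟩, ⟨E2⟩, h⟩ := exists_morita ι
  have : NeZero b := ⟨hb.ne'⟩
  have : FiniteDimensional L (Cent ι) := Module.Finite.equiv E2.symm.toLinearEquiv
  refine ⟨isCentral_of_algEquiv E2.symm,
    IsSimpleRing.of_ringEquiv E2.symm.toRingEquiv inferInstance, this, ?_⟩
  have h1 := finrank_of_matrix E1
  have h2 := finrank_of_matrix E2
  have h3 := finrank_rightModule ι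
  rw [Module.finrank_baseChange] at h1
  have hpos : 0 < a ^ 2 * Module.finrank L Δ := by
    have : 0 < Module.finrank L Δ := Module.finrank_pos
    positivity
  apply Nat.eq_of_mul_eq_mul_left hpos
  rw [h2]
  rw [← h1] at hpos ⊢
  calc _ = (Module.finrank K L * Module.finrank L (RightModule ι)) ^ 2 := by
        rw [h, h1]; ring
    _ = _ := by rw [h3, sq]

/-- The centralizer of `ι(L)` is Brauer equivalent to `L ⊗ D`, so that both have the same index over
every extension of `L`. -/
theorem index_baseChange_cent [Algebra.IsCentral K D] [IsSimpleRing D] [FiniteDimensional K D]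
    [FiniteDimensional K L] (E : Type*) [Field E] [Algebra L E] :
    index E (E ⊗[L] Cent ι) = index E (E ⊗[L] (L ⊗[K] D)) := by
  obtain ⟨Δ, _, _, a, b, ha, hb, hc, hfd, ⟨E1⟩, ⟨E2⟩, h⟩ := exists_morita ι
  obtain ⟨h1, h2, h3, -⟩ := centralizer_properties ι
  have := isSimpleRing_baseChange (F := K) (A := D) L
  have := isCentral_baseChange (F := K) (A := D) L
  have := isSimpleRing_baseChange (F := L) (A := Cent ι) E
  have := isCentral_baseChange (F := L) (A := Cent ι) E
  have := isSimpleRing_baseChange (F := L) (A := L ⊗[K] D) E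
  have := isCentral_baseChange (F := L) (A := L ⊗[K] D) E
  have := isSimpleRing_baseChange (F := L) (A := Δ) E
  have := isCentral_baseChange (F := L) (A := Δ) E
  obtain ⟨f⟩ := exists_baseChange_matrix_algEquiv (F := L) E Δ a
  obtain ⟨g⟩ := exists_baseChange_matrix_algEquiv (F := L) E Δ b
  rw [index_eq_of_algEquiv_matrix ((Algebra.TensorProduct.congr AlgEquiv.refl E2).trans g),
    index_eq_of_algEquiv_matrix ((Algebra.TensorProduct.congr AlgEquiv.refl E1).trans f)]

end Morita

/-! ### The index over an extension generated by constants -/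

section Constants
variable {κ F R : Type*} [Field κ] [Field F] [Algebra κ F] [Ring R] [Algebra F R]
  [Algebra κ R] [IsScalarTower κ F R]

/-- If `κ` is algebraically closed in `F`, then minimal polynomials over `κ` stay irreducible
over `F`. -/
theorem minpoly_map_of_algClosed (hκ : ∀ x : F, IsAlgebraic κ x → x ∈ Set.range (algebraMap κ F))
    {x : R} (hx : IsIntegral κ x) : minpoly F x = (minpoly κ x).map (algebraMap κ F) := by
  have hxF : IsIntegral F x := hx.tower_top
  have hdvd : minpoly F x ∣ (minpoly κ x).map (algebraMap κ F) :=
    minpoly.dvd_map_of_isScalarTower κ F x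
  -- the coefficients of a monic factor are integral over `κ`
  have hlift := integralClosure.mem_lifts_of_monic_of_dvd_map F (minpoly.monic hx)
    (minpoly.monic hxF) hdvd
  have hlift' : minpoly F x ∈ Polynomial.lifts (algebraMap κ F) := by
    rw [Polynomial.lifts_iff_coeff_lifts] at hlift ⊢
    intro n
    obtain ⟨c, hc⟩ := hlift n
    rw [← hc]
    exact hκ _ (IsIntegral.isAlgebraic c.2)
  obtain ⟨g, hg, hgdeg, hgm⟩ := Polynomial.lifts_and_degree_eq_and_monic hlift' (minpoly.monic hxF)
  have hg0 : Polynomial.aeval x g = 0 := by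
    rw [← Polynomial.aeval_map_algebraMap F, hg, minpoly.aeval]
  have hle : (minpoly κ x).degree ≤ g.degree := minpoly.min κ x hgm hg0
  refine (Polynomial.eq_of_monic_of_dvd_of_natDegree_le (minpoly.monic hxF)
    ((minpoly.monic hx).map _) hdvd ?_).symm
  rw [Polynomial.natDegree_map]
  apply Polynomial.natDegree_le_natDegree
  rwa [← hgdeg]

theorem isIntegral_of_pow_eq_self {R A : Type*} [CommRing R] [Ring A] [Algebra R A] {x : A} {Q : ℕ}
    (hQ : 1 < Q) (hx : x ^ Q = x) : IsIntegral R x := by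
  nontriviality R
  refine ⟨Polynomial.X ^ Q - Polynomial.X, Polynomial.monic_X_pow_sub (by
    rw [Polynomial.degree_X]; exact_mod_cast hQ), ?_⟩
  simp [hx]

end Constants

section LocalIndex
variable {κ F E : Type*} [Field κ] [Finite κ] [Field F] [Algebra κ F] [Field E] [Algebra F E]
  [Algebra κ E] [IsScalarTower κ F E]

theorem exists_extension_finrank_eq (κ : Type*) [Field κ] [Finite κ] {t : ℕ} (ht : 0 < t) :
    ∃ (k : Type) (_ : Field k) (_ : Finite k) (_ : Algebra κ k), Module.finrank κ k = t := by
  obtain ⟨p, hp⟩ := CharP.exists κ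
  have : Fact p.Prime := ⟨CharP.char_is_prime κ p⟩
  have : NeZero t := ⟨ht.ne'⟩
  exact ⟨FiniteField.Extension κ p t, inferInstance, inferInstance, inferInstance,
    FiniteField.finrank_extension κ p t⟩

/-- If both `E` and `Δ` contain the constants of degree `t = gcd([E : F], d)`, then `E ⊗ Δ` has a
representation of dimension `d ^ 2 / t`. -/
theorem index_baseChange_dvd [FiniteDimensional F E]
    {Δ : Type*} [DivisionRing Δ] [Algebra F Δ] [Algebra κ Δ]
    [IsScalarTower κ F Δ] [Algebra.IsCentral F Δ] [FiniteDimensional F Δ] {d : ℕ}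
    (hd : Module.finrank F Δ = d ^ 2)
    (hκ : ∀ x : F, IsAlgebraic κ x → x ∈ Set.range (algebraMap κ F))
    {k₁ k₂ : Type*} [Field k₁] [Finite k₁] [Algebra κ k₁] [Field k₂] [Finite k₂] [Algebra κ k₂]
    (φ₁ : k₁ →ₐ[κ] E) (φ₂ : k₂ →ₐ[κ] Δ) (h₁ : Module.finrank κ k₁ = Module.finrank F E)
    (h₂ : Module.finrank κ k₂ = d) :
    index E (E ⊗[F] Δ) ∣ d / Nat.gcd (Module.finrank F E) d := by
  have hdpos : 0 < d := by
    rcases Nat.eq_zero_or_pos d with rfl | h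
    · exact absurd hd (by simpa using Module.finrank_pos.ne')
    · exact h
  set t := Nat.gcd (Module.finrank F E) d with ht
  have htpos : 0 < t := Nat.gcd_pos_of_pos_right _ hdpos
  obtain ⟨k, _, _, _, hk⟩ := exists_extension_finrank_eq κ htpos
  have : Module.Finite κ k := Module.finite_of_finrank_pos (by omega)
  obtain ⟨ψ₁⟩ := FiniteField.nonempty_algHom_of_finrank_dvd (F := κ) (K := k) (L := k₁)
    (by rw [hk, h₁]; exact Nat.gcd_dvd_left _ _)
  obtain ⟨ψ₂⟩ := FiniteField.nonempty_algHom_of_finrank_dvd (F := κ) (K := k) (L := k₂)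
    (by rw [hk, h₂]; exact Nat.gcd_dvd_right _ _)
  obtain ⟨y, hy⟩ := Field.exists_primitive_element κ k
  have hyint : IsIntegral κ y := IsIntegral.of_finite κ y
  have hdeg : (minpoly κ y).natDegree = t := by
    rw [← IntermediateField.adjoin.finrank hyint, hy, IntermediateField.finrank_top', hk]
  set y₁ : E := φ₁ (ψ₁ y) with hy₁
  set y₂ : Δ := φ₂ (ψ₂ y) with hy₂
  have hm₁ : minpoly κ y₁ = minpoly κ y :=
    minpoly.algHom_eq (φ₁.comp ψ₁) (φ₁.comp ψ₁).toRingHom.injective y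
  have hm₂ : minpoly κ y₂ = minpoly κ y :=
    minpoly.algHom_eq (φ₂.comp ψ₂) (φ₂.comp ψ₂).toRingHom.injective y
  have hi₁ : IsIntegral κ y₁ := hyint.map (φ₁.comp ψ₁)
  have hi₂ : IsIntegral κ y₂ := hyint.map (φ₂.comp ψ₂)
  have hM₁ := minpoly_map_of_algClosed hκ hi₁
  have hM₂ := minpoly_map_of_algClosed hκ hi₂
  have hiF : IsIntegral F y₁ := hi₁.tower_top
  -- `Z` is the subfield of `E` generated by constants of degree `t`; it embeds in `Δ` as well
  let Z := IntermediateField.adjoin F {y₁}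
  have hZ : Module.finrank F Z = t := by
    rw [IntermediateField.adjoin.finrank hiF, hM₁, hm₁, Polynomial.natDegree_map, hdeg]
  let j : Z →ₐ[F] Δ := (IntermediateField.adjoin.powerBasis hiF).lift y₂ (by
    rw [IntermediateField.adjoin.powerBasis_gen, IntermediateField.minpoly_gen, hM₁, hm₁, ← hm₂,
      ← hM₂, minpoly.aeval])
  have hfr := finrank_rightModule j
  rw [hZ, hd] at hfr
  have : FiniteDimensional F (RightModule j) := Module.Finite.equiv (toRight j)
  have : FiniteDimensional Z (RightModule j) := Module.Finite.of_restrictScalars_finite F _ _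
  -- `Δ` is a vector space over `Z`, and `E ⊗ Δ` acts on its base change to `E`
  let ρ₀ : Δ →ₐ[F] Module.End E (E ⊗[Z] RightModule j) :=
    ((Module.End.baseChangeHom Z E (RightModule j)).restrictScalars F).comp (leftMulHom j)
  let ρ : E ⊗[F] Δ →ₐ[E] Module.End E (E ⊗[Z] RightModule j) :=
    Algebra.TensorProduct.lift (Algebra.ofId E _) ρ₀ (fun a d => by
      rw [Commute, SemiconjBy, Algebra.ofId_apply, Algebra.commutes])
  have := isSimpleRing_baseChange (F := F) (A := Δ) E
  have := isCentral_baseChange (F := F) (A := Δ) E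
  refine index_dvd_of_rep ρ ?_
  rw [capacity_mul_index_of_sq (n := d) (by rw [Module.finrank_baseChange, hd]),
    Module.finrank_baseChange]
  apply Nat.eq_of_mul_eq_mul_left htpos
  rw [hfr, mul_left_comm, Nat.mul_div_cancel' (Nat.gcd_dvd_right _ _), sq]

/-- A representation of `E ⊗ A` over `E` is a representation of `A` over `F`, of a dimension that is
`[E : F]` times larger. -/
theorem index_dvd_finrank_mul [FiniteDimensional F E] {A : Type*} [Ring A] [Algebra F A]
    [Algebra.IsCentral F A] [IsSimpleRing A] [FiniteDimensional F A] :
    index F A ∣ Module.finrank F E * index E (E ⊗[F] A) := by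
  have := isSimpleRing_baseChange (F := F) (A := A) E
  have := isCentral_baseChange (F := F) (A := A) E
  obtain ⟨M, _, _, _, ρ, hM⟩ := exists_rep_finrank_eq E (E ⊗[F] A)
  let _ : Module F M := Module.compHom M (algebraMap F E)
  have : IsScalarTower F E M := ⟨fun a b x => by
    rw [Algebra.smul_def, mul_smul]; rfl⟩
  have : FiniteDimensional F M := Module.Finite.trans E M
  let res : Module.End E M →ₐ[F] Module.End F M :=
    AlgHom.ofLinearMap
      { toFun := fun f => f.restrictScalars F
        map_add' := fun _ _ => rfl
        map_smul' := fun _ _ => rfl } rfl (fun _ _ => rfl)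
  let ρ' : A →ₐ[F] Module.End F M :=
    res.comp ((ρ.restrictScalars F).comp Algebra.TensorProduct.includeRight)
  refine index_dvd_of_rep ρ' ?_
  have h1 : capacity E (E ⊗[F] A) * index E (E ⊗[F] A) = capacity F A * index F A :=
    capacity_mul_index_of_sq (by rw [Module.finrank_baseChange, sq_capacity_mul_index])
  rw [← Module.finrank_mul_finrank F E M, hM, h1]
  ring

/-- The index of a central simple algebra `A` drops by the factor `gcd (e, ind A)` under the
unramified extension of degree `e`, as soon as the division algebra underlying `A` contains the
unramified extension of degree `ind A`. -/
theorem index_baseChange_mul_gcd [FiniteDimensional F E] {A : Type u} [Ring A] [Algebra F A]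
    [Algebra.IsCentral F A] [IsSimpleRing A] [FiniteDimensional F A]
    (hκ : ∀ x : F, IsAlgebraic κ x → x ∈ Set.range (algebraMap κ F))
    {k₁ : Type*} [Field k₁] [Finite k₁] [Algebra κ k₁] (φ₁ : k₁ →ₐ[κ] E)
    (h₁ : Module.finrank κ k₁ = Module.finrank F E)
    (hdiv : ∀ (Δ : Type u) [DivisionRing Δ] [Algebra F Δ] [Algebra κ Δ] [IsScalarTower κ F Δ]
      [Algebra.IsCentral F Δ] [FiniteDimensional F Δ] (d : ℕ), Module.finrank F Δ = d ^ 2 →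
      ∃ (k₂ : Type v) (_ : Field k₂) (_ : Finite k₂) (_ : Algebra κ k₂) (_ : k₂ →ₐ[κ] Δ),
        Module.finrank κ k₂ = d) :
    index E (E ⊗[F] A) * Nat.gcd (Module.finrank F E) (index F A) = index F A := by
  have := isSimpleRing_baseChange (F := F) (A := A) E
  have := isCentral_baseChange (F := F) (A := A) E
  obtain ⟨Δ, _, _, _, hd, ⟨e⟩⟩ := isMatrixOver_capacity_index F A
  have hfd := finiteDimensional_of_matrix (capacity_pos F A) e
  let _ : Algebra κ Δ := ((algebraMap F Δ).comp (algebraMap κ F)).toAlgebra'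
    (fun c x => Algebra.commutes _ _)
  have : IsScalarTower κ F Δ := IsScalarTower.of_algebraMap_eq fun _ => rfl
  obtain ⟨k₂, _, _, _, φ₂, hk₂d⟩ := hdiv Δ _ hd
  have h := index_baseChange_dvd hd hκ φ₁ φ₂ h₁ hk₂d
  have := isSimpleRing_baseChange (F := F) (A := Δ) E
  have := isCentral_baseChange (F := F) (A := Δ) E
  obtain ⟨f⟩ := exists_baseChange_matrix_algEquiv (F := F) E Δ (capacity F A)
  rw [← index_eq_of_algEquiv_matrix ((Algebra.TensorProduct.congr AlgEquiv.refl e).trans f)] at h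
  have h2 : index F A ∣ Module.finrank F E * index E (E ⊗[F] A) := index_dvd_finrank_mul
  set t := Nat.gcd (Module.finrank F E) (index F A) with ht
  have htpos : 0 < t := Nat.gcd_pos_of_pos_right _ (index_pos F A)
  obtain ⟨d', hd'⟩ : t ∣ index F A := Nat.gcd_dvd_right _ _
  obtain ⟨e', he'⟩ : t ∣ Module.finrank F E := Nat.gcd_dvd_left _ _
  have hcop : Nat.Coprime e' d' := by
    have := Nat.coprime_div_gcd_div_gcd (m := Module.finrank F E) (n := index F A) htpos
    rw [← ht, hd', he', Nat.mul_div_cancel_left _ htpos, Nat.mul_div_cancel_left _ htpos] at this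
    exact this
  rw [hd', Nat.mul_div_cancel_left _ htpos] at h
  rw [hd', he', mul_assoc] at h2
  have h3 := hcop.symm.dvd_of_dvd_mul_left (Nat.dvd_of_mul_dvd_mul_left htpos h2)
  rw [Nat.dvd_antisymm h h3, hd', mul_comm]

end LocalIndex

/-! ### The absolute value of a division algebra over a local field -/

section DivisionAlgebra
variable (F : Type*) [NontriviallyNormedField F] [ProperSpace F]
  {Δ : Type*} [DivisionRing Δ] [Algebra F Δ] [FiniteDimensional F Δ]
  [TopologicalSpace Δ] [IsTopologicalRing Δ] [ContinuousSMul F Δ] [T2Space Δ]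

omit [ProperSpace F] in
variable [CompleteSpace F] in
theorem continuous_algebraNorm : Continuous (Algebra.norm F : Δ → F) := by
  let b := Module.finBasis F Δ
  have h : (Algebra.norm F : Δ → F) = fun x => (Algebra.leftMulMatrix b x).det :=
    funext fun x => Algebra.norm_eq_matrix_det b x
  rw [h]
  exact ((Algebra.leftMulMatrix b).toLinearMap.continuous_of_finiteDimensional).matrix_det

omit [ProperSpace F] [TopologicalSpace Δ] [IsTopologicalRing Δ] [ContinuousSMul F Δ] [T2Space Δ] in
theorem norm_algebraNorm_smul (a : F) (x : Δ) :
    ‖Algebra.norm F (a • x)‖ = ‖a‖ ^ Module.finrank F Δ * ‖Algebra.norm F x‖ := by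
  rw [Algebra.smul_def, map_mul, norm_mul]
  congr 1
  rw [Algebra.norm_algebraMap_of_basis (Module.finBasis F Δ), norm_pow, Fintype.card_fin]

omit [ProperSpace F] [TopologicalSpace Δ] [IsTopologicalRing Δ] [ContinuousSMul F Δ] [T2Space Δ]
  [FiniteDimensional F Δ] in
theorem algebraNorm_ne_zero {x : Δ} (hx : x ≠ 0) : Algebra.norm F x ≠ 0 := by
  intro h
  have : Algebra.norm F (x * x⁻¹) = 0 := by rw [map_mul, h, zero_mul]
  rw [mul_inv_cancel₀ hx, map_one] at this
  exact one_ne_zero this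

/-- The balls of the absolute value `‖N(x)‖` of a division algebra are compact. -/
theorem isCompact_norm_algebraNorm_le (c : ℝ) : IsCompact {x : Δ | ‖Algebra.norm F x‖ ≤ c} := by
  let f : Δ ≃L[F] (Fin (Module.finrank F Δ) → F) := (Module.finBasis F Δ).equivFunL
  have hN : 0 < Module.finrank F Δ := Module.finrank_pos
  have hcont : Continuous fun w => ‖Algebra.norm F (f.symm w)‖ :=
    ((continuous_algebraNorm F).comp f.symm.continuous).norm
  have : Nonempty (Fin (Module.finrank F Δ)) := ⟨⟨0, hN⟩⟩
  obtain ⟨w₀, hw₀, hmin⟩ := (isCompact_sphere (0 : Fin (Module.finrank F Δ) → F) 1).exists_isMinOn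
    ⟨fun _ => 1, by rw [mem_sphere_zero_iff_norm, pi_norm_const, norm_one]⟩ hcont.continuousOn
  -- `δ` is the minimum of `‖N‖` on the unit sphere, whence `‖N(w)‖ ≥ δ ‖w‖ ^ [Δ : F]`
  set δ := ‖Algebra.norm F (f.symm w₀)‖ with hδ
  have hw₀0 : w₀ ≠ 0 := by
    rintro rfl
    simp at hw₀
  have hδpos : 0 < δ := norm_pos_iff.2 (algebraNorm_ne_zero F (by simpa using hw₀0))
  have hlow : ∀ w, ‖w‖ ^ Module.finrank F Δ * δ ≤ ‖Algebra.norm F (f.symm w)‖ := by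
    intro w
    rcases eq_or_ne w 0 with rfl | hw
    · simp [hN.ne']
    obtain ⟨i, hi⟩ : ∃ i, ‖w‖ = ‖w i‖ := by
      obtain ⟨i, -, hi⟩ := Finset.exists_mem_eq_sup Finset.univ Finset.univ_nonempty
        (fun i => ‖w i‖₊)
      exact ⟨i, by rw [Pi.norm_def, hi]; rfl⟩
    have hwi : w i ≠ 0 := by
      rw [← norm_ne_zero_iff, ← hi]
      exact norm_ne_zero_iff.2 hw
    have h1 : w = w i • ((w i)⁻¹ • w) := by rw [smul_smul, mul_inv_cancel₀ hwi, one_smul]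
    have h2 : ‖(w i)⁻¹ • w‖ = 1 := by
      rw [norm_smul, norm_inv, hi, inv_mul_cancel₀ (norm_ne_zero_iff.2 hwi)]
    have h3 : δ ≤ ‖Algebra.norm F (f.symm ((w i)⁻¹ • w))‖ :=
      hmin (by simpa using h2)
    conv_rhs => rw [h1, map_smul, norm_algebraNorm_smul]
    rw [hi]
    gcongr
  have himg : {x : Δ | ‖Algebra.norm F x‖ ≤ c} = f ⁻¹' {w | ‖Algebra.norm F (f.symm w)‖ ≤ c} := by
    ext x; simp
  rw [himg]
  apply f.toHomeomorph.isCompact_preimage.2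
  refine (isCompact_closedBall (0 : Fin (Module.finrank F Δ) → F) (max 1 (c / δ))).of_isClosed_subset
    (isClosed_le hcont continuous_const) ?_
  intro w hw
  rw [mem_closedBall_zero_iff]
  rcases le_total ‖w‖ 1 with h | h
  · exact h.trans (le_max_left _ _)
  · refine le_trans ?_ (le_max_right _ _)
    rw [le_div_iff₀ hδpos]
    refine le_trans ?_ ((hlow w).trans hw)
    gcongr
    exact le_self_pow₀ h hN.ne'

variable (p : ℕ) [Fact p.Prime] [CharP F p]

include p in
/-- The ultrametric inequality: the powers `N(1 + x) ^ (p ^ j) = N(1 + x ^ (p ^ j))` are bounded by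
compactness. -/
theorem norm_algebraNorm_one_add_le {x : Δ} (hx : ‖Algebra.norm F x‖ ≤ 1) :
    ‖Algebra.norm F (1 + x)‖ ≤ 1 := by
  have : CharP Δ p := charP_of_injective_algebraMap (algebraMap F Δ).injective p
  have hc : Continuous fun x : Δ => ‖Algebra.norm F (1 + x)‖ :=
    ((continuous_algebraNorm F).comp (continuous_const.add continuous_id)).norm
  obtain ⟨C, hC⟩ := ((isCompact_norm_algebraNorm_le F (Δ := Δ) 1).image hc).isBounded.bddAbove
  have hpow : ∀ j : ℕ, ‖Algebra.norm F (1 + x)‖ ^ j ≤ max 1 C := by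
    intro j
    rcases le_total ‖Algebra.norm F (1 + x)‖ 1 with h | h
    · exact (pow_le_one₀ (norm_nonneg _) h).trans (le_max_left _ _)
    · refine le_trans ?_ (le_max_right _ _)
      refine (pow_le_pow_right₀ h (Nat.lt_pow_self (Fact.out : p.Prime).one_lt).le).trans ?_
      rw [← norm_pow, ← map_pow, add_pow_char_pow_of_commute _ _ (Commute.one_left x), one_pow]
      apply hC
      refine ⟨x ^ p ^ j, ?_, rfl⟩
      change ‖Algebra.norm F (x ^ p ^ j)‖ ≤ 1
      rw [map_pow, norm_pow]
      exact pow_le_one₀ (norm_nonneg _) hx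
  by_contra! h
  obtain ⟨j, hj⟩ := pow_unbounded_of_one_lt (max 1 C) h
  exact absurd (hpow j) (not_le.2 hj)

/-- The absolute value `‖N(x)‖` of a division algebra `Δ` over a local field of positive
characteristic. The norm is that of the left multiplications on `Δ`, a power of the reduced norm. -/
noncomputable def algebraNormValuation : Valuation Δ ℝ≥0 where
  toFun x := ‖Algebra.norm F x‖₊
  map_zero' := by rw [Algebra.norm_zero, nnnorm_zero]
  map_one' := by rw [map_one, nnnorm_one]
  map_mul' x y := by rw [map_mul, nnnorm_mul]
  map_add_le_max' := by
    have key : ∀ x y : Δ, ‖Algebra.norm F y‖₊ ≤ ‖Algebra.norm F x‖₊ →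
        ‖Algebra.norm F (x + y)‖₊ ≤ ‖Algebra.norm F x‖₊ := by
      intro x y h
      rcases eq_or_ne x 0 with rfl | hx
      · simpa using h
      have h1 : x + y = x * (1 + x⁻¹ * y) := by rw [mul_add, mul_one, mul_inv_cancel_left₀ hx]
      have hx' : 0 < ‖Algebra.norm F x‖₊ := nnnorm_pos.2 (algebraNorm_ne_zero F hx)
      have h2 : ‖Algebra.norm F (x⁻¹ * y)‖₊ ≤ 1 := by
        rw [map_mul, nnnorm_mul]
        have h3 : ‖Algebra.norm F x⁻¹‖₊ * ‖Algebra.norm F x‖₊ = 1 := by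
          rw [← nnnorm_mul, ← map_mul, inv_mul_cancel₀ hx, map_one, nnnorm_one]
        calc _ ≤ ‖Algebra.norm F x⁻¹‖₊ * ‖Algebra.norm F x‖₊ := by gcongr
          _ = 1 := h3
      rw [h1, map_mul, nnnorm_mul]
      exact mul_le_of_le_one_right' (norm_algebraNorm_one_add_le F p h2)
    intro x y
    rcases le_total ‖Algebra.norm F x‖₊ ‖Algebra.norm F y‖₊ with h | h
    · rw [max_eq_right h, add_comm]
      exact key y x h
    · rw [max_eq_left h]
      exact key x y h

end DivisionAlgebra

/-! ### Constants in division algebras over local fields -/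

section Teichmuller
variable {Δ : Type*} [DivisionRing Δ] [TopologicalSpace Δ] [IsTopologicalRing Δ]
  (ν : Valuation Δ ℝ≥0) (hν : Continuous ν) (hcpt : IsCompact {x | ν x ≤ 1})
  (p : ℕ) [Fact p.Prime] [CharP Δ p]

include hν hcpt

/-- Teichmüller representatives: the powers `x ^ (Q ^ n)`, for `Q = p ^ j`, accumulate at a root of
`X ^ Q - X`. This holds also for noncommutative `Δ`, since `x` commutes with its powers. -/
theorem exists_pow_eq_self {j : ℕ} (hj : 0 < j) {x : Δ} (hx : ν x ≤ 1) (hxQ : ν (x ^ p ^ j - x) < 1) :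
    ∃ y, y ^ p ^ j = y ∧ ν (y - x) < 1 := by
  set Q := p ^ j with hQ
  have hQ1 : 1 < Q := Nat.one_lt_pow hj.ne' (Fact.out : p.Prime).one_lt
  set z := x ^ Q - x with hz
  let y : ℕ → Δ := fun n => x ^ Q ^ n
  have hstep : ∀ n, y (n + 1) - y n = z ^ Q ^ n := by
    intro n
    have hcomm : Commute (x ^ Q) x := (Commute.refl x).pow_left Q
    rw [hz, hQ, ← pow_mul, sub_pow_char_pow_of_commute _ _ (by rw [← hQ]; exact hcomm)]
    simp only [y, hQ, ← pow_mul]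
    congr 2
    ring
  have hdist : ∀ n, ν (y n - x) ≤ ν z := by
    intro n
    induction n with
    | zero => simp [y]
    | succ n ih =>
      have : y (n + 1) - x = (y (n + 1) - y n) + (y n - x) := by abel
      rw [this, hstep]
      refine (ν.map_add _ _).trans (max_le ?_ ih)
      rw [map_pow]
      exact pow_le_of_le_one zero_le hxQ.le (by positivity)
  have hB : ∀ n, y n ∈ {x | ν x ≤ 1} := fun n => by
    simp only [Set.mem_ofPred_eq, y, map_pow]
    exact pow_le_one₀ zero_le hx
  let 𝒰 : Ultrafilter ℕ := Filter.hyperfilter ℕ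
  obtain ⟨l, -, hl⟩ := hcpt.ultrafilter_le_nhds (𝒰.map y)
    (by rw [le_principal_iff]; exact Filter.Eventually.of_forall (f := (𝒰 : Filter ℕ)) hB)
  have hl' : Tendsto y 𝒰 (𝓝 l) := hl
  refine ⟨l, ?_, ?_⟩
  · have h1 : Tendsto (fun n => ν (y n ^ Q - y n)) 𝒰 (𝓝 (ν (l ^ Q - l))) :=
      (hν.tendsto _).comp ((hl'.pow Q).sub hl')
    have h2 : Tendsto (fun n => ν (y n ^ Q - y n)) 𝒰 (𝓝 0) := by
      have h3 : ∀ n, ν (y n ^ Q - y n) = ν z ^ Q ^ n := by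
        intro n
        rw [← map_pow, ← hstep]
        simp only [y, ← pow_mul, pow_succ]
      simp only [h3]
      have h4 : Tendsto (fun n => ν z ^ Q ^ n) atTop (𝓝 0) :=
        (NNReal.tendsto_pow_atTop_nhds_zero_of_lt_one hxQ).comp
          (tendsto_pow_atTop_atTop_of_one_lt hQ1)
      exact h4.mono_left Nat.hyperfilter_le_atTop
    have h5 := tendsto_nhds_unique h1 h2
    exact sub_eq_zero.1 (ν.zero_iff.1 h5)
  · refine lt_of_le_of_lt ?_ hxQ
    have h1 : Tendsto (fun n => ν (y n - x)) 𝒰 (𝓝 (ν (l - x))) :=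
      (hν.tendsto _).comp (hl'.sub_const x)
    exact le_of_tendsto h1 (Filter.Eventually.of_forall hdist)

end Teichmuller

section Residue
variable {Δ : Type*} [DivisionRing Δ] (ν : Valuation Δ ℝ≥0)

/-- The two-sided maximal ideal of the valuation ring of a division ring. -/
def residueIdeal : Ideal ν.integer where
  carrier := {x | ν (x : Δ) < 1}
  add_mem' {x y} hx hy := lt_of_le_of_lt (ν.map_add _ _) (max_lt hx hy)
  zero_mem' := by simp
  smul_mem' c x hx := by
    change ν ((c : Δ) * x) < 1
    rw [map_mul]
    exact (mul_le_of_le_one_left' c.2).trans_lt hx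

theorem mem_residueIdeal {x : ν.integer} : x ∈ residueIdeal ν ↔ ν (x : Δ) < 1 := Iff.rfl

instance : (residueIdeal ν).IsTwoSided where
  mul_mem_of_left {x} c hx := by
    rw [mem_residueIdeal] at hx ⊢
    change ν ((x : Δ) * c) < 1
    rw [map_mul]
    exact (mul_le_of_le_one_right' c.2).trans_lt hx

/-- The residue ring is a finite field by Wedderburn's little theorem. The lemma describes a generator
of its multiplicative group by a representative `x₀`: the powers of `x₀` represent all nonzero residue
classes, and `x₀ ^ Q` has the class of `x₀`, where `Q = p ^ j` is the order of the residue field. -/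
theorem exists_generator_residue [TopologicalSpace Δ] [IsTopologicalRing Δ] (hν : Continuous ν)
    (hcpt : IsCompact {x | ν x ≤ 1}) (p : ℕ) [Fact p.Prime] [CharP Δ p] :
    ∃ (j : ℕ) (x₀ : Δ), 0 < j ∧ ν x₀ ≤ 1 ∧ ν (x₀ ^ p ^ j - x₀) < 1 ∧
      ∀ x, ν x ≤ 1 → ν x < 1 ∨ ∃ n : ℕ, ν (x - x₀ ^ n) < 1 := by
  let k := ν.integer ⧸ residueIdeal ν
  have hmk : ∀ x y : ν.integer, Ideal.Quotient.mk (residueIdeal ν) x = Ideal.Quotient.mk _ y ↔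
      ν ((x : Δ) - y) < 1 := fun x y => Ideal.Quotient.eq
  -- the open residue classes cover the compact valuation ring
  have hfin : Finite k := by
    obtain ⟨t, ht, hcov⟩ := hcpt.elim_nhds_subcover (fun x => {y | ν (y - x) < 1}) (fun x _ => by
      refine (isOpen_lt (hν.comp (continuous_id.sub continuous_const)) continuous_const).mem_nhds ?_
      simp)
    let g : t → k := fun x => Ideal.Quotient.mk _ (⟨x.1, ht x.1 x.2⟩ : ν.integer)
    refine Finite.of_surjective g fun q => ?_
    obtain ⟨x, rfl⟩ := Ideal.Quotient.mk_surjective q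
    have hx := hcov x.2
    simp only [Set.mem_iUnion] at hx
    obtain ⟨y, hy, hxy⟩ := hx
    refine ⟨⟨y, hy⟩, Eq.symm ((hmk _ _).2 hxy)⟩
  have hnt : Nontrivial k := by
    refine ⟨⟨0, 1, fun h => ?_⟩⟩
    have h' : Ideal.Quotient.mk (residueIdeal ν) 0 = Ideal.Quotient.mk _ 1 := by
      rw [map_zero, map_one]; exact h
    rw [hmk] at h'
    simp at h'
  have hinv : ∀ a : k, a ≠ 0 → ∃ b, a * b = 1 := by
    intro a ha
    obtain ⟨x, rfl⟩ := Ideal.Quotient.mk_surjective a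
    have hx : ¬ ν (x : Δ) < 1 := fun h => ha (by
      rw [← map_zero (Ideal.Quotient.mk (residueIdeal ν)), hmk]
      simpa using h)
    have hx1 : ν (x : Δ) = 1 := le_antisymm x.2 (not_lt.1 hx)
    have hx0 : (x : Δ) ≠ 0 := fun h => by simp [h] at hx1
    refine ⟨Ideal.Quotient.mk _ ⟨(x : Δ)⁻¹, ?_⟩, ?_⟩
    · change ν _ ≤ 1
      rw [map_inv₀, hx1, inv_one]
    · rw [← map_mul, ← map_one (Ideal.Quotient.mk (residueIdeal ν))]
      congr 1
      exact Subtype.ext (mul_inv_cancel₀ hx0)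
  let _ : DivisionRing k := DivisionRing.ofIsUnitOrEqZero (fun a => by
    by_cases ha : a = 0
    · exact Or.inr ha
    · obtain ⟨b, hb⟩ := hinv a ha
      obtain ⟨c, hc⟩ := hinv b (fun h => by rw [h, mul_zero] at hb; exact zero_ne_one hb)
      have hac : a = c := by
        calc a = a * (b * c) := by rw [hc, mul_one]
          _ = c := by rw [← mul_assoc, hb, one_mul]
      exact Or.inl ⟨⟨a, b, hb, by rw [hac, hc]⟩, rfl⟩)
  let _ : Field k := littleWedderburn k
  have hchar : CharP k p := by
    have h0 : ((p : ν.integer) : Δ) = 0 := by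
      rw [← CharP.cast_eq_zero Δ p]; simp
    have hp0 : (p : k) = 0 := by
      rw [← map_natCast (Ideal.Quotient.mk (residueIdeal ν)),
        ← map_zero (Ideal.Quotient.mk (residueIdeal ν)), hmk, h0]
      simp
    obtain ⟨q, hq⟩ := CharP.exists k
    rcases (Nat.dvd_prime Fact.out).1 ((CharP.cast_eq_zero_iff k q p).1 hp0) with h | h
    · exact absurd h (CharP.char_ne_one k q)
    · rwa [← h]
  have := Fintype.ofFinite k
  obtain ⟨j, -, hj⟩ := FiniteField.card k p
  obtain ⟨u, hu⟩ := IsCyclic.exists_generator (α := kˣ)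
  obtain ⟨x₀, hx₀⟩ := Ideal.Quotient.mk_surjective (u : k)
  refine ⟨j, x₀, j.pos, x₀.2, ?_, fun x hx => ?_⟩
  · have := FiniteField.pow_card (Ideal.Quotient.mk (residueIdeal ν) x₀)
    rw [hj] at this
    exact (hmk (x₀ ^ p ^ (j : ℕ)) x₀).1 ((map_pow _ _ _).trans this)
  · rw [or_iff_not_imp_left]
    intro hx1
    have hne : Ideal.Quotient.mk (residueIdeal ν) ⟨x, hx⟩ ≠ 0 := by
      rw [Ne, ← map_zero (Ideal.Quotient.mk (residueIdeal ν)), hmk]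
      simpa using hx1
    obtain ⟨n, hn⟩ := (mem_powers_iff_mem_zpowers).2 (hu (Units.mk0 _ hne))
    refine ⟨n, ?_⟩
    have h1 := congrArg Units.val hn
    simp only [Units.val_pow_eq_pow_val, Units.val_mk0, ← hx₀] at h1
    exact (hmk ⟨x, hx⟩ (x₀ ^ n)).1 (h1.symm.trans (map_pow _ _ _).symm)

end Residue

section Field
variable {F : Type*} [Field F] {Δ : Type*} [DivisionRing Δ] [Algebra F Δ] [FiniteDimensional F Δ]
  [Algebra.IsCentral F Δ]

/-- An element of a central division algebra whose centralizer is commutative generates a maximal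
subfield. -/
theorem natDegree_minpoly_of_comm {d : ℕ} (hd : Module.finrank F Δ = d ^ 2) (ζ : Δ)
    (hcomm : ∀ x y : Δ, Commute x ζ → Commute y ζ → Commute x y) :
    (minpoly F ζ).natDegree = d := by
  have hint : IsIntegral F ζ := Algebra.IsIntegral.isIntegral ζ
  have : Fact (Irreducible (minpoly F ζ)) := ⟨minpoly.irreducible hint⟩
  let pb := AdjoinRoot.powerBasis (minpoly.ne_zero hint)
  have hpb : minpoly F pb.gen = minpoly F ζ := by
    rw [AdjoinRoot.powerBasis_gen, AdjoinRoot.minpoly_root (minpoly.ne_zero hint),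
      (minpoly.monic hint).leadingCoeff, inv_one, map_one, mul_one]
  let ι : AdjoinRoot (minpoly F ζ) →ₐ[F] Δ := pb.lift ζ (by rw [hpb, minpoly.aeval])
  have hι : ι (AdjoinRoot.root _) = ζ := pb.lift_gen _ _
  have : FiniteDimensional F (AdjoinRoot (minpoly F ζ)) := pb.finite
  obtain ⟨h1, h2, h3, h4⟩ := centralizer_properties ι
  have hc : ∀ c : Cent ι, Commute (Cent.val ι c) ζ := fun c => by
    have := (Cent.comm ι c (AdjoinRoot.root _)).symm
    rwa [hι] at this
  have hfr : Module.finrank (AdjoinRoot (minpoly F ζ)) (Cent ι) = 1 := by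
    have hb : (⊥ : Subalgebra (AdjoinRoot (minpoly F ζ)) (Cent ι)) = ⊤ := by
      rw [← Algebra.IsCentral.center_eq_bot (AdjoinRoot (minpoly F ζ)) (Cent ι), eq_top_iff]
      intro x _
      rw [Subalgebra.mem_center_iff]
      intro y
      exact Subtype.ext (hcomm _ _ (hc y) (hc x))
    exact Subalgebra.bot_eq_top_iff_finrank_eq_one.1 hb
  rw [hfr, mul_one, hd] at h4
  have h5 := Nat.pow_left_injective (n := 2) (by norm_num) h4
  rw [← h5, pb.finrank, AdjoinRoot.powerBasis_dim]

end Field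

section Generator
variable (F : Type*) [NontriviallyNormedField F] [ProperSpace F]
  {Δ : Type*} [DivisionRing Δ] [Algebra F Δ] [FiniteDimensional F Δ]
  [TopologicalSpace Δ] [IsTopologicalRing Δ] [ContinuousSMul F Δ] [T2Space Δ]
  (p : ℕ) [Fact p.Prime] [CharP F p]

theorem algebraNormValuation_apply (x : Δ) :
    ((algebraNormValuation F p x : ℝ≥0) : ℝ) = ‖Algebra.norm F x‖ := rfl

theorem continuous_algebraNormValuation :
    Continuous (algebraNormValuation F p : Δ → ℝ≥0) :=
  (continuous_algebraNorm F).nnnorm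

theorem isCompact_algebraNormValuation_le (c : ℝ≥0) :
    IsCompact {x : Δ | algebraNormValuation F p x ≤ c} :=
  isCompact_norm_algebraNorm_le F (c : ℝ)

variable [IsUltrametricDist F]

/-- In a subalgebra `C`, there is an element of largest absolute value smaller than `1`. -/
theorem exists_uniformizer (C : Subalgebra F Δ) : ∃ ϖ ∈ C, ϖ ≠ 0 ∧ algebraNormValuation F p ϖ < 1 ∧
    ∀ x ∈ C, algebraNormValuation F p x < 1 →
      algebraNormValuation F p x ≤ algebraNormValuation F p ϖ := by
  set ν := algebraNormValuation F p (Δ := Δ) with hν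
  have hcont : Continuous ν := continuous_algebraNormValuation F p
  have hlt : IsClosed {x : Δ | ν x < 1} := by
    have h1 : {x : Δ | ν x < 1} = Algebra.norm F ⁻¹' Metric.ball (0 : F) 1 := by
      ext x
      rw [Set.mem_preimage, mem_ball_zero_iff, ← algebraNormValuation_apply F p]
      exact Iff.rfl
    rw [h1]
    exact (IsUltrametricDist.isClosed_ball 0 1).preimage (continuous_algebraNorm F)
  have hC : IsClosed (C : Set Δ) := (Subalgebra.toSubmodule C).closed_of_finiteDimensional
  have hcpt : IsCompact ({x : Δ | ν x < 1} ∩ C) :=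
    (isCompact_algebraNormValuation_le F p 1).of_isClosed_subset (hlt.inter hC)
      (fun x hx => by have h : ν x < 1 := hx.1; exact h.le)
  obtain ⟨ϖ, hϖ, hmax⟩ := hcpt.exists_isMaxOn ⟨0, by simp, C.zero_mem⟩ hcont.continuousOn
  refine ⟨ϖ, hϖ.2, ?_, hϖ.1, fun x hx hx1 => hmax ⟨hx1, hx⟩⟩
  obtain ⟨a, ha0, ha1⟩ := NormedField.exists_norm_lt_one F
  have hNa : ν (algebraMap F Δ a) < 1 := by
    rw [← NNReal.coe_lt_coe, algebraNormValuation_apply,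
      Algebra.norm_algebraMap_of_basis (Module.finBasis F Δ), norm_pow, Fintype.card_fin]
    exact pow_lt_one₀ (norm_nonneg _) ha1 Module.finrank_pos.ne'
  have h2 : ν (algebraMap F Δ a) ≤ ν ϖ := hmax ⟨hNa, C.algebraMap_mem a⟩
  rintro rfl
  rw [map_zero, le_zero_iff, ν.zero_iff, map_eq_zero] at h2
  exact (norm_pos_iff.1 ha0) h2

/-- If the powers of `ζ` represent all residue classes of `Δ`, then the centralizer of `ζ` is
commutative: its elements are polynomials in `ζ` and a uniformizer of the centralizer. -/
theorem commute_of_commute_generator {ζ : Δ}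
    (hζ : ∀ x, algebraNormValuation F p x ≤ 1 → algebraNormValuation F p x < 1 ∨
      ∃ n : ℕ, algebraNormValuation F p (x - ζ ^ n) < 1)
    {x y : Δ} (hx : Commute x ζ) (hy : Commute y ζ) : Commute x y := by
  set ν := algebraNormValuation F p (Δ := Δ) with hν
  have hcont : Continuous ν := continuous_algebraNormValuation F p
  let C : Subalgebra F Δ := Subalgebra.centralizer F {ζ}
  have hC : ∀ x, x ∈ C ↔ Commute x ζ := fun x => by
    rw [Subalgebra.mem_centralizer_iff]
    simp only [Set.mem_singleton_iff, forall_eq]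
    exact ⟨fun h => h.symm, fun h => h.symm⟩
  obtain ⟨ϖ, hϖC, hϖ0, hϖ1, hmax⟩ := exists_uniformizer F p C
  have hνϖ : 0 < ν ϖ := zero_lt_iff.2 (ν.ne_zero_iff.2 hϖ0)
  let V : Subalgebra F Δ := Algebra.adjoin F {ζ, ϖ}
  have hζV : ζ ∈ V := Algebra.subset_adjoin (by simp)
  have hϖV : ϖ ∈ V := Algebra.subset_adjoin (by simp)
  have hVC : V ≤ C := by
    refine Algebra.adjoin_le ?_
    rintro _ (rfl | rfl)
    · exact (hC _).2 (Commute.refl _)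
    · exact hϖC
  have hVcl : IsClosed (V : Set Δ) := (Subalgebra.toSubmodule V).closed_of_finiteDimensional
  -- every nonzero element of `C` is approximated by an element of `V`
  have happrox : ∀ w ∈ C, w ≠ 0 → ∃ z ∈ V, ν (w - z) < ν w := by
    intro w hw hw0
    have hνw : 0 < ν w := zero_lt_iff.2 (ν.ne_zero_iff.2 hw0)
    obtain ⟨a, ha0, ha1⟩ := NormedField.exists_norm_lt F
      (r := min 1 ((ν w : ℝ)⁻¹)) (lt_min one_pos (by positivity))
    have ha : a ≠ 0 := norm_pos_iff.1 ha0
    have haw : ν (a • w) ≤ 1 := by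
      rw [← NNReal.coe_le_coe, algebraNormValuation_apply, norm_algebraNorm_smul,
        ← algebraNormValuation_apply F p, NNReal.coe_one]
      have h1 : ‖a‖ ^ Module.finrank F Δ ≤ (ν w : ℝ)⁻¹ :=
        (pow_le_of_le_one (norm_nonneg _) (ha1.le.trans (min_le_left _ _))
          Module.finrank_pos.ne').trans (ha1.le.trans (min_le_right _ _))
      calc _ ≤ (ν w : ℝ)⁻¹ * ν w := by gcongr
        _ = 1 := inv_mul_cancel₀ (by positivity)
    have haw0 : a • w ≠ 0 := smul_ne_zero ha hw0
    obtain ⟨n, hn1, hn2⟩ := exists_nat_pow_near_of_lt_one (zero_lt_iff.2 (ν.ne_zero_iff.2 haw0))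
      haw hνϖ hϖ1
    have hϖn : ϖ ^ n ≠ 0 := pow_ne_zero n hϖ0
    set u := (ϖ ^ n)⁻¹ * (a • w) with hu
    have huw : a • w = ϖ ^ n * u := by rw [hu, mul_inv_cancel_left₀ hϖn]
    have huC : u ∈ C := by
      rw [hC] at hw hϖC ⊢
      exact ((hϖC.pow_left n).inv_left₀).mul_left (hw.smul_left a)
    rw [huw, map_mul, map_pow] at hn1 hn2
    have hνn : 0 < ν ϖ ^ n := pow_pos hνϖ n
    have hu1 : ν u ≤ 1 := by
      have : ν ϖ ^ n * ν u ≤ ν ϖ ^ n * 1 := by rwa [mul_one]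
      exact le_of_mul_le_mul_left this hνn
    have hu2 : ν ϖ < ν u := by
      rw [pow_succ] at hn1
      exact lt_of_mul_lt_mul_left hn1 hνn.le
    have hu3 : ¬ ν u < 1 := fun h => absurd (hmax u huC h) (not_le.2 hu2)
    obtain ⟨m, hm⟩ := (hζ u hu1).resolve_left hu3
    have hu4 : ν u = 1 := le_antisymm hu1 (not_lt.1 hu3)
    have hwu : w = a⁻¹ • (ϖ ^ n * u) := by rw [← huw, smul_smul, inv_mul_cancel₀ ha, one_smul]
    refine ⟨a⁻¹ • (ϖ ^ n * ζ ^ m), V.smul_mem (V.mul_mem (V.pow_mem hϖV n) (V.pow_mem hζV m)) _, ?_⟩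
    have h5 : w - a⁻¹ • (ϖ ^ n * ζ ^ m) = a⁻¹ • (ϖ ^ n * (u - ζ ^ m)) := by
      rw [hwu, ← smul_sub, mul_sub]
    rw [h5]
    rw [show ν w = ν (a⁻¹ • (ϖ ^ n * u)) from congrArg ν hwu]
    rw [Algebra.smul_def, Algebra.smul_def, map_mul, map_mul, map_mul, map_mul, map_pow, hu4]
    have ha' : 0 < ν (algebraMap F Δ a⁻¹) := zero_lt_iff.2 (ν.ne_zero_iff.2 (by
      rw [Ne, map_eq_zero]; exact inv_ne_zero ha))
    gcongr
  -- a best approximation in `V`, which exists by compactness, can only be exact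
  have hCV : C ≤ V := by
    intro x hx
    have hcl : IsClosed {y : Δ | ν (x - y) ≤ ν x} :=
      isClosed_le (hcont.comp (continuous_const.sub continuous_id)) continuous_const
    have hcpt : IsCompact ({y : Δ | ν (x - y) ≤ ν x} ∩ V) := by
      refine (isCompact_algebraNormValuation_le F p (ν x)).of_isClosed_subset (hcl.inter hVcl) ?_
      intro y hy
      have : y = x - (x - y) := by abel
      change ν y ≤ ν x
      rw [this]
      exact (ν.map_sub _ _).trans (max_le le_rfl hy.1)
    obtain ⟨y, hy, hmin⟩ := hcpt.exists_isMinOn ⟨0, by simp, V.zero_mem⟩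
      (hcont.comp (continuous_const.sub continuous_id)).continuousOn
    by_contra hxV
    have hxy : x - y ≠ 0 := fun h => hxV (by rw [sub_eq_zero.1 h]; exact hy.2)
    obtain ⟨z, hz, hlt⟩ := happrox (x - y) (C.sub_mem hx (hVC hy.2)) hxy
    have h1 : x - y - z = x - (y + z) := by abel
    rw [h1] at hlt
    exact absurd (hmin ⟨hlt.le.trans hy.1, V.add_mem hy.2 hz⟩) (not_le.2 hlt)
  have : IsMulCommutative V := Algebra.isMulCommutative_adjoin F (by
    have hcomm : ϖ * ζ = ζ * ϖ := (hC ϖ).1 hϖC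
    rintro _ (rfl | rfl) _ (rfl | rfl)
    · rfl
    · exact hcomm.symm
    · exact hcomm
    · rfl)
  exact congrArg Subtype.val
    (mul_comm' (⟨x, hCV ((hC x).2 hx)⟩ : V) ⟨y, hCV ((hC y).2 hy)⟩)

end Generator

section Unramified
variable {F : Type*} [NontriviallyNormedField F] [IsUltrametricDist F] [ProperSpace F]
  {Δ : Type*} [DivisionRing Δ] [Algebra F Δ] [FiniteDimensional F Δ] [Algebra.IsCentral F Δ]
  {κ : Type v} [Field κ] [Finite κ] [Algebra κ F] [Algebra κ Δ] [IsScalarTower κ F Δ]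

/-- A central division algebra `Δ` of degree `d` contains a root of unity `ζ` (or `ζ = 0`) that generates
a maximal subfield: the Teichmüller representative of a generator of the residue field. -/
theorem exists_maximal_constant (p : ℕ) [Fact p.Prime] [CharP F p] {d : ℕ}
    (hd : Module.finrank F Δ = d ^ 2) :
    ∃ (ζ : Δ) (Q : ℕ), 1 < Q ∧ ζ ^ Q = ζ ∧ (minpoly F ζ).natDegree = d := by
  let _ : TopologicalSpace Δ := moduleTopology F Δ
  have : IsModuleTopology F Δ := ⟨rfl⟩
  have : IsTopologicalRing Δ := IsModuleTopology.isTopologicalRing F Δ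
  have : T2Space Δ :=
    T2Space.of_injective_continuous (f := (Module.finBasis F Δ).equivFun)
      (Module.finBasis F Δ).equivFun.injective
      (IsModuleTopology.continuous_of_linearMap (Module.finBasis F Δ).equivFun.toLinearMap)
  have : CharP Δ p := charP_of_injective_algebraMap (algebraMap F Δ).injective p
  set ν := algebraNormValuation F p (Δ := Δ) with hν
  have hcont : Continuous ν := continuous_algebraNormValuation F p
  have hcpt := isCompact_algebraNormValuation_le F p (Δ := Δ) 1
  obtain ⟨j, x₀, hj, hx₀, hxQ, hgen⟩ := exists_generator_residue ν hcont hcpt p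
  obtain ⟨ζ, hζQ, hζ⟩ := exists_pow_eq_self ν hcont hcpt p hj hx₀ hxQ
  -- `ζ` generates the residue field, as `x₀` does
  refine ⟨ζ, p ^ j, Nat.one_lt_pow hj.ne' (Fact.out : p.Prime).one_lt, hζQ, ?_⟩
  refine natDegree_minpoly_of_comm hd ζ fun x y hx hy => commute_of_commute_generator F p ?_ hx hy
  have hζ1 : ν ζ ≤ 1 := by
    have : ζ = (ζ - x₀) + x₀ := by abel
    rw [this]
    exact (ν.map_add _ _).trans (max_le hζ.le hx₀)
  have hpow : ∀ n : ℕ, ν (ζ ^ n - x₀ ^ n) < 1 := by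
    intro n
    induction n with
    | zero => simp
    | succ n ih =>
      have h1 : ζ ^ (n + 1) - x₀ ^ (n + 1) = ζ ^ n * (ζ - x₀) + (ζ ^ n - x₀ ^ n) * x₀ := by
        rw [pow_succ, pow_succ, mul_sub, sub_mul]; abel
      rw [h1]
      refine (ν.map_add _ _).trans_lt (max_lt ?_ ?_)
      · rw [map_mul, map_pow]
        exact (mul_le_of_le_one_left' (pow_le_one₀ zero_le hζ1)).trans_lt hζ
      · rw [map_mul]
        exact (mul_le_of_le_one_right' hx₀).trans_lt ih
  intro x hx
  refine (hgen x hx).imp_right fun ⟨n, hn⟩ => ⟨n, ?_⟩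
  have h1 : x - ζ ^ n = (x - x₀ ^ n) - (ζ ^ n - x₀ ^ n) := by abel
  rw [h1]
  exact (ν.map_sub _ _).trans_lt (max_lt hn (hpow n))

/-- A central division algebra of degree `d` over a local field of positive characteristic
contains the constant field extension of degree `d`. -/
theorem exists_constant_subfield (p : ℕ) [Fact p.Prime] [CharP F p] {d : ℕ}
    (hκ : ∀ x : F, IsAlgebraic κ x → x ∈ Set.range (algebraMap κ F))
    (hd : Module.finrank F Δ = d ^ 2) :
    ∃ (k₂ : Type v) (_ : Field k₂) (_ : Finite k₂) (_ : Algebra κ k₂) (_ : k₂ →ₐ[κ] Δ),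
      Module.finrank κ k₂ = d := by
  obtain ⟨ζ, Q, hQ, hζ, hdeg⟩ := exists_maximal_constant p hd
  have hint : IsIntegral κ ζ := isIntegral_of_pow_eq_self hQ hζ
  rw [minpoly_map_of_algClosed hκ hint, Polynomial.natDegree_map] at hdeg
  have : Fact (Irreducible (minpoly κ ζ)) := ⟨minpoly.irreducible hint⟩
  let pb := AdjoinRoot.powerBasis (minpoly.ne_zero hint)
  have hpb : minpoly κ pb.gen = minpoly κ ζ := by
    rw [AdjoinRoot.powerBasis_gen, AdjoinRoot.minpoly_root (minpoly.ne_zero hint),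
      (minpoly.monic hint).leadingCoeff, inv_one, map_one, mul_one]
  have : FiniteDimensional κ (AdjoinRoot (minpoly κ ζ)) := pb.finite
  exact ⟨AdjoinRoot (minpoly κ ζ), inferInstance, Module.finite_of_finite κ, inferInstance,
    pb.lift ζ (by rw [hpb, minpoly.aeval]), by rw [pb.finrank, AdjoinRoot.powerBasis_dim, hdeg]⟩

end Unramified

/-! ### Function fields of one variable -/

section OneVariable
variable {k F : Type*} [Field k] [Field F] [Algebra k F]

/-- A finitely generated extension `F / k` of transcendence degree at most one. -/
class IsFunctionField (k F : Type*) [Field k] [Field F] [Algebra k F] : Prop where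
  essFiniteType : Algebra.EssFiniteType k F
  trdeg_le_one : Algebra.trdeg k F ≤ 1

open scoped IntermediateField.algebraAdjoinAdjoin in
/-- A transcendental element is a transcendence basis, over which `F` is algebraic and finitely
generated. -/
theorem IsFunctionField.finiteDimensional_adjoin [IsFunctionField k F] {t : F}
    (ht : Transcendental k t) : FiniteDimensional (IntermediateField.adjoin k {t}) F := by
  have := IsFunctionField.essFiniteType (k := k) (F := F)
  have hx : AlgebraicIndependent k (fun _ : Unit => t) :=
    algebraicIndependent_unique_type_iff.2 ht
  have hb : IsTranscendenceBasis k (fun _ : Unit => t) := by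
    refine hx.isTranscendenceBasis_of_lift_trdeg_le_of_finite ?_
    simpa using IsFunctionField.trdeg_le_one (k := k) (F := F)
  have h1 := hb.isAlgebraic
  rw [Set.range_const] at h1
  have h2 : Algebra.IsAlgebraic (IntermediateField.adjoin k {t}) F :=
    Algebra.IsAlgebraic.extendScalars
      (FaithfulSMul.algebraMap_injective (Algebra.adjoin k {t}) (IntermediateField.adjoin k {t}))
  have h3 : Algebra.EssFiniteType (IntermediateField.adjoin k {t}) F :=
    Algebra.EssFiniteType.of_comp k _ _
  obtain ⟨s, hs⟩ := IntermediateField.fg_top (IntermediateField.adjoin k {t}) F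
  have h4 := IntermediateField.finiteDimensional_adjoin
    (K := IntermediateField.adjoin k {t}) (L := F) (S := (s : Set F))
    (fun x _ => Algebra.IsIntegral.isIntegral x)
  rw [hs] at h4
  exact Module.Finite.equiv (IntermediateField.topEquiv (F := IntermediateField.adjoin k {t})
    (E := F)).toLinearEquiv

theorem isFunctionField_of_finiteDimensional_ratFunc [Algebra (RatFunc k) F]
    [IsScalarTower k (RatFunc k) F] [FiniteDimensional (RatFunc k) F] : IsFunctionField k F where
  essFiniteType := by
    have : Algebra.EssFiniteType (Polynomial k) (RatFunc k) :=
      .of_isLocalization _ (nonZeroDivisors _)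
    have : Algebra.EssFiniteType k (RatFunc k) := .comp _ (Polynomial k) _
    exact .comp _ (RatFunc k) _
  trdeg_le_one := by
    have h1 : Algebra.trdeg k (RatFunc k) = 1 := by
      have h := trdeg_add_eq k (Polynomial k) (A := RatFunc k)
      have : Algebra.IsAlgebraic (Polynomial k) (RatFunc k) :=
        IsLocalization.isAlgebraic _ (nonZeroDivisors (Polynomial k))
      rw [trdeg_eq_zero (R := Polynomial k), add_zero, Polynomial.trdeg_of_isDomain] at h
      exact h.symm
    have h := lift_trdeg_add_eq k (RatFunc k) F
    rw [trdeg_eq_zero (R := RatFunc k), h1] at h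
    simpa using h.ge

theorem isFunctionField_of_finiteDimensional (L : Type*) [Field L] [Algebra k L] [Algebra F L]
    [IsScalarTower k F L] [FiniteDimensional F L] [IsFunctionField k F] : IsFunctionField k L where
  essFiniteType := by
    have := IsFunctionField.essFiniteType (k := k) (F := F)
    exact .comp _ F _
  trdeg_le_one := by
    have h := lift_trdeg_add_eq k F L
    rw [trdeg_eq_zero (R := F), Cardinal.lift_zero, add_zero] at h
    have h1 := Cardinal.lift_le_one_iff.2 (IsFunctionField.trdeg_le_one (k := k) (F := F))
    rw [h] at h1
    exact Cardinal.lift_le_one_iff.1 h1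

end OneVariable

/-! ### The valuation ring of a place -/

section FiniteQuotients

/-- A valuation ring all of whose proper quotients by principal ideals are finite is discrete. -/
theorem isDiscreteValuationRing_of_finite_quotient {O : Type*} [CommRing O] [IsDomain O]
    [ValuationRing O] (h : ∀ t : O, t ≠ 0 → Finite (O ⧸ Ideal.span {t})) (hO : ¬ IsField O) :
    IsDiscreteValuationRing O := by
  have : IsNoetherianRing O := by
    refine (isNoetherianRing_iff_ideal_fg O).2 fun I => ?_
    rcases eq_or_ne I ⊥ with rfl | hI
    · exact Submodule.fg_bot
    obtain ⟨t, htI, ht⟩ := Submodule.exists_mem_ne_zero_of_ne_bot hI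
    have := h t ht
    refine Submodule.fg_of_fg_map_of_fg_inf_ker (Ideal.span {t}).mkQ ?_ ?_
    · exact ⟨(Set.toFinite (Submodule.map (Ideal.span {t}).mkQ I : Set _)).toFinset, by simp⟩
    · rw [Submodule.ker_mkQ, inf_eq_right.2 ((Ideal.span_singleton_le_iff_mem I).2 htI)]
      exact ⟨{t}, by simp⟩
  have : IsPrincipalIdealRing O := inferInstance
  exact { not_a_field' := fun h => hO (IsLocalRing.isField_iff_maximalIdeal_eq.2 h) }

theorem finite_residueField_of_finite_quotient {O : Type*} [CommRing O]
    [IsLocalRing O] (h : ∀ t : O, t ≠ 0 → Finite (O ⧸ Ideal.span {t})) (hO : ¬ IsField O) :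
    Finite (IsLocalRing.ResidueField O) := by
  have hm : IsLocalRing.maximalIdeal O ≠ ⊥ := fun h =>
    hO (IsLocalRing.isField_iff_maximalIdeal_eq.2 h)
  obtain ⟨t, htI, ht⟩ := Submodule.exists_mem_ne_zero_of_ne_bot hm
  have := h t ht
  exact Finite.of_surjective _
    (Ideal.Quotient.factor_surjective ((Ideal.span_singleton_le_iff_mem _).2 htI))

end FiniteQuotients

namespace Place
variable {k F : Type*} [Field k] [Field F] [Algebra k F] (w : Place k F)

instance : IsScalarTower k w.ring F := .of_algebraMap_eq fun _ => rfl

theorem not_isField : ¬ IsField w.ring := by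
  intro h
  refine w.ne_top (top_unique fun x _ => ?_)
  rcases w.ring.mem_or_inv_mem x with hx | hx
  · exact hx
  rcases eq_or_ne x 0 with rfl | hx0
  · exact w.ring.zero_mem
  obtain ⟨y, hy⟩ := h.mul_inv_cancel (a := ⟨x⁻¹, hx⟩)
    (fun h => inv_ne_zero hx0 (congrArg Subtype.val h))
  have h1 : x⁻¹ * (y : F) = 1 := congrArg Subtype.val hy
  have h2 : x = y := by
    rw [eq_comm, eq_inv_of_mul_eq_one_right h1, inv_inv]
  exact h2 ▸ y.2

theorem mem_of_isIntegral {x : F} (hx : IsIntegral k x) : x ∈ w.ring := by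
  have h1 : IsIntegral w.ring x := hx.tower_top
  obtain ⟨y, hy⟩ := (IsIntegrallyClosed.isIntegral_iff).1 h1
  rw [← hy]
  exact y.2

theorem transcendental_of_not_isUnit {t : w.ring} (ht0 : t ≠ 0) (ht : ¬ IsUnit t) :
    Transcendental k (t : F) := by
  intro h
  have h0 : (t : F) ≠ 0 := fun h => ht0 (Subtype.ext h)
  have h1 : (t : F)⁻¹ ∈ w.ring := w.mem_of_isIntegral h.inv.isIntegral
  exact ht (IsUnit.of_mul_eq_one ⟨_, h1⟩ (Subtype.ext (mul_inv_cancel₀ h0)))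

/-- If `∑ pᵢ(t) xᵢ = 0`, where the `xᵢ` are linearly independent modulo `t`, then all the
coefficients of the polynomials `pᵢ` vanish. -/
theorem coeff_eq_zero_of_sum_aeval_mul {t : w.ring} (ht0 : t ≠ 0) {ι : Type*} [Fintype ι]
    {x : ι → w.ring}
    (hx : LinearIndependent k fun i => Ideal.Quotient.mk (Ideal.span {t}) (x i)) (n : ℕ) :
    ∀ p : ι → Polynomial k, ∑ i, Polynomial.aeval t (p i) * x i = 0 → ∀ i, (p i).coeff n = 0 := by
  have key : ∀ p : ι → Polynomial k, ∑ i, Polynomial.aeval t (p i) * x i = 0 →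
      (∀ i, (p i).coeff 0 = 0) ∧ ∑ i, Polynomial.aeval t (p i).divX * x i = 0 := by
    intro p hp
    have h1 : ∀ i, Polynomial.aeval t (p i) =
        Polynomial.aeval t (p i).divX * t + algebraMap k w.ring ((p i).coeff 0) := by
      intro i
      conv_lhs => rw [← Polynomial.divX_mul_X_add (p i)]
      simp
    have h0 : ∀ i, (p i).coeff 0 = 0 := by
      refine Fintype.linearIndependent_iff.1 hx _ ?_
      have h2 := congrArg (Ideal.Quotient.mk (Ideal.span {t})) hp
      rw [map_sum, map_zero] at h2
      rw [← h2]
      refine Finset.sum_congr rfl fun i _ => ?_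
      have ht : Ideal.Quotient.mk (Ideal.span {t}) t = 0 :=
        Ideal.Quotient.eq_zero_iff_mem.2 (Ideal.mem_span_singleton_self t)
      rw [h1, map_mul, map_add, map_mul, ht, mul_zero, zero_add, Algebra.smul_def]
      rfl
    refine ⟨h0, ?_⟩
    have h2 : t * ∑ i, Polynomial.aeval t (p i).divX * x i = 0 := by
      rw [← hp, Finset.mul_sum]
      refine Finset.sum_congr rfl fun i _ => ?_
      rw [h1, h0, map_zero, add_zero]
      ring
    exact (mul_eq_zero.1 h2).resolve_left ht0
  induction n with
  | zero => exact fun p hp => (key p hp).1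
  | succ n ih =>
    intro p hp i
    rw [← Polynomial.coeff_divX]
    exact ih _ (key p hp).2 i

variable [IsFunctionField k F] [Finite k]

open scoped IntermediateField.algebraAdjoinAdjoin in
/-- The quotient `O_w / t` has dimension at most `[F : k(t)]`, since elements that are linearly
independent modulo `t` are linearly independent over `k(t)`. -/
theorem finite_quotient (t : w.ring) (ht0 : t ≠ 0) : Finite (w.ring ⧸ Ideal.span {t}) := by
  by_cases ht : IsUnit t
  · rw [Ideal.span_singleton_eq_top.2 ht]
    infer_instance
  have htr := w.transcendental_of_not_isUnit ht0 ht
  have := IsFunctionField.finiteDimensional_adjoin htr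
  have hrank : Module.rank k (w.ring ⧸ Ideal.span {t}) ≤
      Module.finrank (IntermediateField.adjoin k {(t : F)}) F := by
    refine rank_le fun s hs => ?_
    choose x hx using fun i : s => Ideal.Quotient.mk_surjective (i : w.ring ⧸ Ideal.span {t})
    have hx' : LinearIndependent k fun i => Ideal.Quotient.mk (Ideal.span {t}) (x i) := by
      simpa only [hx] using hs
    have hli : LinearIndependent (Algebra.adjoin k {(t : F)}) fun i => (x i : F) := by
      rw [Fintype.linearIndependent_iff]
      intro g hg
      have hp : ∀ i, ∃ p : Polynomial k, Polynomial.aeval (t : F) p = g i := by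
        intro i
        exact (Algebra.adjoin_singleton_eq_range_aeval k (t : F)).le (g i).2
      choose p hp using hp
      have hsum : ∑ i, Polynomial.aeval t (p i) * x i = 0 := by
        apply Subtype.ext
        rw [ZeroMemClass.coe_zero, ← hg, AddSubmonoidClass.coe_finsetSum]
        refine Finset.sum_congr rfl fun i _ => ?_
        rw [Subalgebra.smul_def, ← hp, smul_eq_mul]
        exact congrArg (· * (x i : F)) (Polynomial.aeval_algebraMap_apply F t (p i)).symm
      have h0 := fun n => w.coeff_eq_zero_of_sum_aeval_mul ht0 hx' n p hsum
      intro i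
      apply Subtype.ext
      rw [← hp i, Polynomial.ext (fun n => h0 n i) (q := 0), map_zero]
      rfl
    have hli' := (LinearIndependent.iff_fractionRing (Algebra.adjoin k {(t : F)})
      (IntermediateField.adjoin k {(t : F)})).1 hli
    simpa using hli'.fintype_card_le_finrank
  have : Module.Finite k (w.ring ⧸ Ideal.span {t}) :=
    Module.rank_lt_aleph0_iff.1 (hrank.trans_lt (Cardinal.natCast_lt_aleph0))
  exact Module.finite_of_finite k

instance : IsDiscreteValuationRing w.ring :=
  isDiscreteValuationRing_of_finite_quotient w.finite_quotient w.not_isField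

instance : Finite w.residueField :=
  finite_residueField_of_finite_quotient w.finite_quotient w.not_isField

theorem one_lt_norm : 1 < w.norm := Finite.one_lt_card

theorem norm_eq_pow : w.norm = Nat.card k ^ w.degree := Module.natCard_eq_pow_finrank

end Place

/-! ### Completions -/

section ValuedField
variable {E Γ₀ : Type*} [Field E] [LinearOrderedCommGroupWithZero Γ₀] [Valued E Γ₀]

theorem isOpen_setOf_valuation_lt {t : E} : IsOpen {x : E | Valued.v x < Valued.v t} := by
  have := Valued.isOpen_ball E (Valued.v.restrict t)
  simpa only [Valuation.restrict_lt_iff] using this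

theorem not_isNontrivial_of_isField :
    IsField (Valued.integer E) → ¬ (Valued.v : Valuation E Γ₀).IsNontrivial := by
  intro h hn
  exact (Valuation.isNontrivial_iff_not_a_field _).1 hn (IsLocalRing.isField_iff_maximalIdeal_eq.1 h)

variable (hfin : ∀ t : Valued.integer E, t ≠ 0 → Finite (Valued.integer E ⧸ Ideal.span {t}))
  [hn : (Valued.v : Valuation E Γ₀).IsNontrivial]

include hfin

theorem isDiscreteValuationRing_integer : IsDiscreteValuationRing (Valued.integer E) := by
  have : ValuationRing (Valued.integer E) :=
    ValuationRing.of_integers _ (Valuation.integer.integers (Valued.v : Valuation E Γ₀))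
  exact isDiscreteValuationRing_of_finite_quotient hfin fun h => not_isNontrivial_of_isField h hn

/-- Finiteness of the quotients of the valuation ring makes it noetherian, so that by Krull's
intersection theorem the value group is archimedean. -/
theorem exists_rankOne : Nonempty (Valued.v : Valuation E Γ₀).RankOne := by
  have := isDiscreteValuationRing_integer hfin
  rw [Valuation.nonempty_rankOne_iff_mulArchimedean]
  refine ⟨fun x y hy => ?_⟩
  obtain ⟨a, rfl⟩ := MonoidWithZeroHom.ValueGroup₀.restrict₀_surjective
    (.ofClass (Valued.v : Valuation E Γ₀)) x
  obtain ⟨b, rfl⟩ := MonoidWithZeroHom.ValueGroup₀.restrict₀_surjective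
    (.ofClass (Valued.v : Valuation E Γ₀)) y
  rw [← map_one (MonoidWithZeroHom.ValueGroup₀.restrict₀ _), ← Valuation.restrict_def,
    ← Valuation.restrict_def, Valuation.restrict_lt_iff, map_one] at hy
  have hb0 : b ≠ 0 := by
    rintro rfl
    rw [map_zero] at hy
    exact not_lt_zero hy
  rcases le_or_gt (Valued.v a) 1 with ha | ha
  · refine ⟨0, ?_⟩
    rw [pow_zero, ← map_one (MonoidWithZeroHom.ValueGroup₀.restrict₀ _), ← Valuation.restrict_def,
      ← Valuation.restrict_def, Valuation.restrict_le_iff, map_one]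
    exact ha
  have ha0 : a ≠ 0 := by
    rintro rfl
    rw [map_zero] at ha
    exact not_lt_zero ha
  let a' : Valued.integer E := ⟨a⁻¹, by
    rw [Valuation.mem_integer_iff, map_inv₀]; exact inv_le_one_of_one_le₀ ha.le⟩
  let b' : Valued.integer E := ⟨b⁻¹, by
    rw [Valuation.mem_integer_iff, map_inv₀]; exact inv_le_one_of_one_le₀ hy.le⟩
  have hb' : ¬ IsUnit b' := by
    rw [Valuation.Integer.not_isUnit_iff_valuation_lt_one]
    change Valued.v b⁻¹ < 1
    rw [map_inv₀]
    exact inv_lt_one_of_one_lt₀ hy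
  -- Krull: the inverse of `a` is not infinitely divisible by the inverse of `b`
  have hinf := Ideal.iInf_pow_eq_bot_of_isLocalRing (Ideal.span {b'})
    (fun h => hb' (Ideal.span_singleton_eq_top.1 h))
  have ha' : a' ∉ ⨅ n : ℕ, Ideal.span {b'} ^ n := by
    rw [hinf, Ideal.mem_bot]
    exact fun h => inv_ne_zero ha0 (congrArg Subtype.val h)
  simp only [Ideal.mem_iInf, not_forall, Ideal.span_singleton_pow, Ideal.mem_span_singleton] at ha'
  obtain ⟨n, hn⟩ := ha'
  refine ⟨n, ?_⟩
  rw [← map_pow, ← Valuation.restrict_def, ← Valuation.restrict_def, Valuation.restrict_le_iff]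
  by_contra hlt
  rw [not_le] at hlt
  refine hn ((Valuation.integer.integers (Valued.v : Valuation E Γ₀)).dvd_of_le ?_)
  change Valued.v a⁻¹ ≤ Valued.v (b⁻¹ ^ n)
  rw [inv_pow, map_inv₀, map_inv₀]
  exact inv_anti₀ (zero_lt_iff.2 ((Valuation.ne_zero_iff _).2 (pow_ne_zero n hb0))) hlt.le

omit hn in
theorem properSpace [(Valued.v : Valuation E Γ₀).RankOne] [CompleteSpace E] :
    letI := Valued.toNormedField E Γ₀
    ProperSpace E := by
  rw [Valued.integer.properSpace_iff_completeSpace_and_isDiscreteValuationRing_integer_and_finite_residueField]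
  exact ⟨inferInstance, isDiscreteValuationRing_integer hfin,
    finite_residueField_of_finite_quotient hfin
      fun h => not_isNontrivial_of_isField h inferInstance⟩

end ValuedField

namespace Place
variable {k F : Type*} [Field k] [Field F] [Algebra k F] (w : Place k F)

theorem valuation_algebraMap_completion (x : F) :
    Valued.v (algebraMap F w.completion x) = w.ring.valuation x :=
  Valued.valuedCompletion_apply (WithVal.toVal w.ring.valuation x)

theorem exists_valuation_sub_lt (y : w.completion) {t : w.completion} (ht : t ≠ 0) :
    ∃ x : F, Valued.v (y - algebraMap F w.completion x) < Valued.v t := by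
  have h1 : IsOpen {z : w.completion | Valued.v (y - z) < Valued.v t} :=
    (isOpen_setOf_valuation_lt (E := w.completion) (t := t)).preimage
      (continuous_const.sub continuous_id)
  obtain ⟨x, hx⟩ := UniformSpace.Completion.denseRange_coe.exists_mem_open h1
    ⟨y, by
      simp only [Set.mem_ofPred_eq, sub_self, map_zero]
      exact zero_lt_iff.2 ((Valuation.ne_zero_iff _).2 ht)⟩
  exact ⟨x.ofVal, hx⟩

theorem exists_valuation_eq (y : w.completion) :
    ∃ x : F, Valued.v y = w.ring.valuation x := by
  obtain ⟨r, hr⟩ := Valued.exists_coe_eq_v y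
  exact ⟨r.ofVal, hr⟩

/-- The embedding of the valuation ring of a place into its completion. -/
noncomputable def toInteger : w.ring →+* Valued.integer w.completion :=
  ((algebraMap F w.completion).comp w.ring.subtype).codRestrict _ fun x => by
    rw [Valuation.mem_integer_iff]
    exact (w.valuation_algebraMap_completion x).trans_le (w.ring.valuation_le_one x)

theorem exists_toInteger_sub_lt (y : Valued.integer w.completion) {t : w.completion} (ht : t ≠ 0)
    (ht1 : Valued.v t ≤ 1) :
    ∃ x : w.ring, Valued.v ((y : w.completion) - (w.toInteger x : w.completion)) < Valued.v t := by
  obtain ⟨x, hx⟩ := w.exists_valuation_sub_lt (y : w.completion) ht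
  have hx1 : x ∈ w.ring := by
    rw [← ValuationSubring.valuation_le_one_iff, ← valuation_algebraMap_completion]
    have : algebraMap F w.completion x = y - (y - algebraMap F w.completion x) := by abel
    rw [this]
    exact (Valuation.map_sub _ _ _).trans (max_le y.2 (hx.le.trans ht1))
  exact ⟨⟨x, hx1⟩, hx⟩

instance : (Valued.v : Valuation w.completion w.ring.ValueGroup).IsNontrivial := by
  have h : w.ring.valuation.IsNontrivial :=
    not_not.1 fun h => w.ne_top ((ValuationSubring.eq_top_iff _).2 h)
  obtain ⟨x, hx0, hx1⟩ := h.exists_val_nontrivial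
  exact ⟨⟨algebraMap F w.completion x, by rwa [valuation_algebraMap_completion],
    by rwa [valuation_algebraMap_completion]⟩⟩

theorem natCard_residueField_integer :
    Nat.card (IsLocalRing.ResidueField (Valued.integer w.completion)) = w.norm := by
  have hlt : ∀ y : Valued.integer w.completion, Valued.v (y : w.completion) < 1 →
      IsLocalRing.residue _ y = 0 := by
    intro y hy
    rw [IsLocalRing.residue_eq_zero_iff, IsLocalRing.mem_maximalIdeal, mem_nonunits_iff,
      Valuation.Integer.not_isUnit_iff_valuation_lt_one]
    exact hy
  have hloc : IsLocalHom w.toInteger := by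
    refine ⟨fun x hx => ?_⟩
    by_contra h
    have h1 : w.ring.valuation x < 1 := (ValuationSubring.valuation_lt_one_iff _ _).1
      ((IsLocalRing.mem_maximalIdeal _).2 h)
    refine (Valuation.Integer.not_isUnit_iff_valuation_lt_one (x := w.toInteger x)).2 ?_ hx
    exact (w.valuation_algebraMap_completion x).trans_lt h1
  refine (Nat.card_congr (Equiv.ofBijective (IsLocalRing.ResidueField.map w.toInteger)
    ⟨RingHom.injective _, fun y => ?_⟩)).symm
  obtain ⟨y, rfl⟩ := IsLocalRing.residue_surjective y
  obtain ⟨x, hx⟩ := w.exists_toInteger_sub_lt y one_ne_zero (map_one _).le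
  refine ⟨IsLocalRing.residue _ x, ?_⟩
  rw [IsLocalRing.ResidueField.map_residue, eq_comm, ← sub_eq_zero, ← map_sub]
  rw [map_one] at hx
  exact hlt _ hx

variable [IsFunctionField k F] [Finite k]

/-- Up to a unit, `t` lies in `F`, and `O_w` is dense in its completion: the quotient is an image of
`O_w / t`. -/
theorem finite_quotient_integer (t : Valued.integer w.completion) (ht : t ≠ 0) :
    Finite (Valued.integer w.completion ⧸ Ideal.span {t}) := by
  obtain ⟨r, hr⟩ := w.exists_valuation_eq t
  have hr1 : r ∈ w.ring := by
    rw [← ValuationSubring.valuation_le_one_iff, ← hr]; exact t.2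
  have ht0 : (t : w.completion) ≠ 0 := fun h => ht (Subtype.ext h)
  have hr0 : r ≠ 0 := by
    rintro rfl
    rw [map_zero, Valuation.zero_iff] at hr
    exact ht0 hr
  have hdvd : ∀ y : Valued.integer w.completion,
      Valued.v (y : w.completion) ≤ Valued.v (t : w.completion) → y ∈ Ideal.span {t} := by
    intro y hy
    rw [Ideal.mem_span_singleton]
    exact (Valuation.integer.integers (Valued.v : Valuation w.completion _)).dvd_of_le hy
  have := w.finite_quotient ⟨r, hr1⟩ (fun h => hr0 (congrArg Subtype.val h))
  let f : w.ring ⧸ Ideal.span {(⟨r, hr1⟩ : w.ring)} →+*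
      Valued.integer w.completion ⧸ Ideal.span {t} :=
    Ideal.Quotient.lift _ ((Ideal.Quotient.mk _).comp w.toInteger) (by
      intro a ha
      obtain ⟨c, rfl⟩ := Ideal.mem_span_singleton'.1 ha
      rw [map_mul, RingHom.comp_apply, RingHom.comp_apply]
      refine Ideal.mul_mem_left ⊥ _ ?_
      rw [Ideal.mem_bot, Ideal.Quotient.eq_zero_iff_mem]
      refine hdvd _ ?_
      rw [hr]
      exact (w.valuation_algebraMap_completion r).le)
  refine Finite.of_surjective f ?_
  intro y
  obtain ⟨y, rfl⟩ := Ideal.Quotient.mk_surjective y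
  obtain ⟨x, hx⟩ := w.exists_toInteger_sub_lt y ht0 t.2
  refine ⟨Ideal.Quotient.mk _ x, ?_⟩
  rw [Ideal.Quotient.lift_mk, RingHom.comp_apply, eq_comm, Ideal.Quotient.eq]
  exact hdvd _ hx.le

end Place

/-! ### The constants of a completion -/

theorem pow_natCard {k : Type*} [Field k] [Finite k] (x : k) : x ^ Nat.card k = x := by
  let _ := Fintype.ofFinite k
  rw [Nat.card_eq_fintype_card, FiniteField.pow_card]

section Constants
variable {E : Type*} [NontriviallyNormedField E]

theorem norm_le_one_of_pow_eq_self {Q : ℕ} (hQ : 1 < Q) {y : E} (hy : y ^ Q = y) : ‖y‖ ≤ 1 := by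
  by_contra h
  rw [not_le] at h
  have h1 : ‖y‖ ^ 1 < ‖y‖ ^ Q := pow_lt_pow_right₀ h hQ
  rw [pow_one, ← norm_pow, hy] at h1
  exact lt_irrefl _ h1

theorem eq_zero_of_pow_eq_self {Q : ℕ} (hQ : 1 < Q) {y : E} (hy : y ^ Q = y) (h : ‖y‖ < 1) :
    y = 0 := by
  by_contra h0
  have h1 : ‖y‖ ^ Q < ‖y‖ ^ 1 := pow_lt_pow_right_of_lt_one₀ (norm_pos_iff.2 h0) h hQ
  rw [pow_one, ← norm_pow, hy] at h1
  exact lt_irrefl _ h1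

/-- If `x ↦ x ^ Q` is the identity on the residue field, it is the identity on the elements that
are algebraic over a finite field. -/
theorem pow_eq_self_of_isAlgebraic {κ : Type*} [Field κ] [Finite κ] [Algebra κ E] {Q : ℕ}
    (hres : ∀ x : E, ‖x‖ ≤ 1 → ‖x ^ Q - x‖ < 1) {x : E} (hx : IsAlgebraic κ x) : x ^ Q = x := by
  have := IntermediateField.adjoin.finiteDimensional hx.isIntegral
  have : Finite (IntermediateField.adjoin κ {x}) := Module.finite_of_finite κ
  have hM : 1 < Nat.card (IntermediateField.adjoin κ {x}) := Finite.one_lt_card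
  have hpow : ∀ z ∈ IntermediateField.adjoin κ {x},
      z ^ Nat.card (IntermediateField.adjoin κ {x}) = z := by
    intro z hz
    have h := congrArg Subtype.val
      (pow_natCard (⟨z, hz⟩ : IntermediateField.adjoin κ {x}))
    exact h
  have hxm := IntermediateField.mem_adjoin_simple_self κ x
  refine sub_eq_zero.1 (eq_zero_of_pow_eq_self hM (hpow _ (sub_mem (pow_mem hxm Q) hxm)) ?_)
  exact hres x (norm_le_one_of_pow_eq_self hM (hpow x hxm))

end Constants

namespace Place
variable {k F : Type*} [Field k] [Field F] [Algebra k F] (w : Place k F)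
  [IsFunctionField k F] [Finite k]

theorem exists_norm_eq_prime_pow :
    ∃ (p j : ℕ), p.Prime ∧ CharP w.completion p ∧ 0 < j ∧ w.norm = p ^ j := by
  obtain ⟨p, hp⟩ := CharP.exists k
  have : CharP w.residueField p :=
    charP_of_injective_algebraMap (algebraMap k w.residueField).injective p
  have : CharP F p := charP_of_injective_algebraMap (algebraMap k F).injective p
  have : CharP w.completion p :=
    charP_of_injective_algebraMap (algebraMap F w.completion).injective p
  let _ := Fintype.ofFinite w.residueField
  obtain ⟨n, hpp, hn⟩ := FiniteField.card w.residueField p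
  exact ⟨p, n, hpp, this, n.pos, by rw [Place.norm, Nat.card_eq_fintype_card, hn]⟩

/-- The field of constants of the completion at `w`: its elements are the roots of
`X ^ N(w) - X`. -/
noncomputable def const : Subfield w.completion where
  carrier := {x | x ^ w.norm = x}
  mul_mem' {x y} (hx : x ^ _ = x) (hy : y ^ _ = y) := by
    rw [Set.mem_ofPred_eq, mul_pow, hx, hy]
  one_mem' := one_pow _
  add_mem' {x y} (hx : x ^ _ = x) (hy : y ^ _ = y) := by
    obtain ⟨p, j, hp, hchar, -, hj⟩ := w.exists_norm_eq_prime_pow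
    have : Fact p.Prime := ⟨hp⟩
    rw [Set.mem_ofPred_eq, hj, add_pow_char_pow, ← hj, hx, hy]
  zero_mem' := zero_pow (zero_lt_one.trans w.one_lt_norm).ne'
  neg_mem' {x} (hx : x ^ _ = x) := by
    obtain ⟨p, j, hp, hchar, -, hj⟩ := w.exists_norm_eq_prime_pow
    have : Fact p.Prime := ⟨hp⟩
    have h := sub_pow_char_pow (R := w.completion) (p := p) (n := j) 0 x
    rw [← hj, hx, zero_pow (zero_lt_one.trans w.one_lt_norm).ne', zero_sub] at h
    exact h
  inv_mem' x (hx : x ^ _ = x) := by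
    rw [Set.mem_ofPred_eq, inv_pow, hx]

theorem nonempty_rankOne :
    Nonempty (Valued.v : Valuation w.completion w.ring.ValueGroup).RankOne :=
  exists_rankOne w.finite_quotient_integer

section RankOne
variable [hR : (Valued.v : Valuation w.completion w.ring.ValueGroup).RankOne]

attribute [local instance] Valued.toNontriviallyNormedField

omit [IsFunctionField k F] [Finite k] in
theorem norm_residue_lt_one [Finite w.residueField] {x : w.completion} (hx : ‖x‖ ≤ 1) :
    ‖x ^ w.norm - x‖ < 1 := by
  rw [Valued.toNormedField.norm_le_one_iff] at hx
  rw [Valued.toNormedField.norm_lt_one_iff]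
  have hfin : Finite (IsLocalRing.ResidueField (Valued.integer w.completion)) := by
    refine Nat.finite_of_card_ne_zero ?_
    rw [natCard_residueField_integer]
    exact Nat.card_pos.ne'
  let x' : Valued.integer w.completion := ⟨x, hx⟩
  have h1 : IsLocalRing.residue _ (x' ^ w.norm - x') = 0 := by
    rw [map_sub, map_pow, ← natCard_residueField_integer, pow_natCard, sub_self]
  rw [IsLocalRing.residue_eq_zero_iff, IsLocalRing.mem_maximalIdeal, mem_nonunits_iff,
    Valuation.Integer.not_isUnit_iff_valuation_lt_one] at h1
  exact h1

theorem properSpace_completion : ProperSpace w.completion :=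
  properSpace w.finite_quotient_integer

theorem exists_mem_const {x : w.completion} (hx : ‖x‖ ≤ 1) : ∃ y ∈ w.const, ‖y - x‖ < 1 := by
  obtain ⟨p, j, hp, hchar, hj0, hj⟩ := w.exists_norm_eq_prime_pow
  have : Fact p.Prime := ⟨hp⟩
  have := w.properSpace_completion
  have hx1 := w.norm_residue_lt_one hx
  rw [hj] at hx1
  obtain ⟨y, hy, hyx⟩ := exists_pow_eq_self (NormedField.valuation (K := w.completion))
    continuous_nnnorm
    (by
      have := isCompact_closedBall (0 : w.completion) 1
      convert this using 1
      ext z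
      rw [mem_closedBall_zero_iff]
      exact Iff.rfl) p hj0 hx hx1
  rw [← hj] at hy
  exact ⟨y, hy, hyx⟩

end RankOne

/-- Reduction identifies the constants with the residue field, by Teichmüller representatives. -/
theorem natCard_const : Nat.card w.const = w.norm := by
  obtain ⟨hR⟩ := w.nonempty_rankOne
  let _ := Valued.toNontriviallyNormedField w.completion w.ring.ValueGroup
  let f : w.const →+* Valued.integer w.completion := w.const.subtype.codRestrict _ fun x => by
    rw [Valuation.mem_integer_iff, ← Valued.toNormedField.norm_le_one_iff]
    exact norm_le_one_of_pow_eq_self w.one_lt_norm x.2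
  rw [← natCard_residueField_integer]
  refine Nat.card_congr (Equiv.ofBijective ((IsLocalRing.residue _).comp f)
    ⟨RingHom.injective _, fun y => ?_⟩)
  obtain ⟨y, rfl⟩ := IsLocalRing.residue_surjective y
  obtain ⟨x, hx, hxy⟩ := w.exists_mem_const (Valued.toNormedField.norm_le_one_iff.2 y.2)
  refine ⟨⟨x, hx⟩, ?_⟩
  rw [RingHom.comp_apply, ← sub_eq_zero, ← map_sub, IsLocalRing.residue_eq_zero_iff,
    IsLocalRing.mem_maximalIdeal, mem_nonunits_iff,
    Valuation.Integer.not_isUnit_iff_valuation_lt_one]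
  exact Valued.toNormedField.norm_lt_one_iff.1 hxy

instance : Finite w.const := Nat.finite_of_card_ne_zero (by
  rw [natCard_const]; exact (zero_lt_one.trans w.one_lt_norm).ne')

/-- The map `x ↦ x ^ N(w)` preserves residue classes, and distinct elements of a finite field have
distinct residue classes. -/
theorem mem_const_of_isAlgebraic {κ : Type*} [Field κ] [Finite κ] [Algebra κ w.completion]
    {x : w.completion} (hx : IsAlgebraic κ x) : x ∈ w.const := by
  obtain ⟨hR⟩ := w.nonempty_rankOne
  let _ := Valued.toNontriviallyNormedField w.completion w.ring.ValueGroup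
  exact pow_eq_self_of_isAlgebraic (fun x hx => w.norm_residue_lt_one hx) hx

section Division
variable {Δ : Type*} [DivisionRing Δ] [Algebra w.completion Δ]
    [FiniteDimensional w.completion Δ] [Algebra.IsCentral w.completion Δ]
    {κ : Type v} [Field κ] [Finite κ] [Algebra κ w.completion] [Algebra κ Δ]
    [IsScalarTower κ w.completion Δ]
    (hκ : ∀ x : w.completion, IsAlgebraic κ x → x ∈ Set.range (algebraMap κ w.completion))

include hκ

section RankOne
variable [hR : (Valued.v : Valuation w.completion w.ring.ValueGroup).RankOne]

attribute [local instance] Valued.toNontriviallyNormedField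

theorem exists_constant_subfield_of_rankOne {d : ℕ} (hd : Module.finrank w.completion Δ = d ^ 2) :
    ∃ (k₂ : Type v) (_ : Field k₂) (_ : Finite k₂) (_ : Algebra κ k₂)
      (_ : k₂ →ₐ[κ] Δ), Module.finrank κ k₂ = d := by
  have := w.properSpace_completion
  obtain ⟨p, j, hp, hchar, hj0, hj⟩ := w.exists_norm_eq_prime_pow
  have : Fact p.Prime := ⟨hp⟩
  exact exists_constant_subfield (F := w.completion) p hκ hd

end RankOne

/-- A central division algebra of degree `d` over the completion contains the constant field
extension of degree `d`. -/
theorem exists_constant_subfield_completion {d : ℕ}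
    (hd : Module.finrank w.completion Δ = d ^ 2) :
    ∃ (k₂ : Type v) (_ : Field k₂) (_ : Finite k₂) (_ : Algebra κ k₂)
      (_ : k₂ →ₐ[κ] Δ), Module.finrank κ k₂ = d := by
  obtain ⟨hR⟩ := w.nonempty_rankOne
  exact w.exists_constant_subfield_of_rankOne hκ hd

end Division

end Place

/-! ### Extensions of places -/

/-- An extension generated by constants has the same degree as the extension of constant fields. -/
theorem finrank_eq_of_adjoin_constants {κ F E : Type*} [Field κ] [Finite κ] [Field F] [Field E]
    [Algebra κ F] [Algebra κ E] [Algebra F E] [IsScalarTower κ F E]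
    (hκ : ∀ x : F, IsAlgebraic κ x → x ∈ Set.range (algebraMap κ F))
    {k₁ : Type*} [Field k₁] [Finite k₁] [Algebra κ k₁] (φ : k₁ →ₐ[κ] E)
    (hφ : Algebra.adjoin F (Set.range φ) = ⊤) :
    FiniteDimensional F E ∧ Module.finrank F E = Module.finrank κ k₁ := by
  have : Module.Finite κ k₁ := Module.Finite.of_finite
  obtain ⟨y, hy⟩ := Field.exists_primitive_element κ k₁
  have hyint : IsIntegral κ y := IsIntegral.of_finite κ y
  have hint : IsIntegral κ (φ y) := hyint.map φ
  have hintF : IsIntegral F (φ y) := hint.tower_top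
  have htop : IntermediateField.adjoin F {φ y} = ⊤ := by
    rw [← IntermediateField.toSubalgebra_inj, IntermediateField.top_toSubalgebra, eq_top_iff, ← hφ]
    refine Algebra.adjoin_le ?_
    rintro _ ⟨z, rfl⟩
    have hz : z ∈ IntermediateField.adjoin κ {y} := by rw [hy]; trivial
    have hz' : z ∈ Algebra.adjoin κ {y} := by
      rwa [← IntermediateField.adjoin_simple_toSubalgebra_of_isAlgebraic hyint.isAlgebraic]
    rw [Algebra.adjoin_singleton_eq_range_aeval] at hz'
    obtain ⟨p, rfl⟩ := hz'
    change φ (Polynomial.aeval y p) ∈ IntermediateField.adjoin F {φ y}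
    rw [← Polynomial.aeval_algHom_apply, ← Polynomial.aeval_map_algebraMap F]
    exact Polynomial.aeval_mem_adjoin_singleton F _ |> fun h =>
      IntermediateField.algebra_adjoin_le_adjoin F _ h
  have hfd := IntermediateField.adjoin.finiteDimensional hintF
  have hfr := IntermediateField.adjoin.finrank hintF
  rw [htop] at hfd hfr
  rw [IntermediateField.finrank_top', minpoly_map_of_algClosed hκ hint, Polynomial.natDegree_map,
    minpoly.algHom_eq φ φ.toRingHom.injective, ← IntermediateField.adjoin.finrank hyint, hy,
    IntermediateField.finrank_top'] at hfr
  exact ⟨Module.Finite.equiv (IntermediateField.topEquiv (F := F) (E := E)).toLinearEquiv, hfr⟩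

theorem valuation_le_iff_div_mem {F : Type*} [Field F] (R : ValuationSubring F) {a b : F}
    (hb : b ≠ 0) : R.valuation a ≤ R.valuation b ↔ a / b ∈ R := by
  rw [← R.valuation_le_one_iff, map_div₀, div_le_one₀]
  exact zero_lt_iff.2 ((Valuation.ne_zero_iff _).2 hb)

namespace Place
variable {k K L : Type*} [Field k] [Field K] [Field L] [Algebra k K] [Algebra k L] [Algebra K L]
  (v : Place k K) (w : Place k L)

variable {v w} in
theorem valuation_le_iff_of_comap_eq (h : w.ring.comap (algebraMap K L) = v.ring) (x y : K) :
    w.ring.valuation (algebraMap K L x) ≤ w.ring.valuation (algebraMap K L y) ↔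
      v.ring.valuation x ≤ v.ring.valuation y := by
  rcases eq_or_ne y 0 with rfl | hy
  · simp
  have hy' : algebraMap K L y ≠ 0 := by simpa using hy
  rw [valuation_le_iff_div_mem _ hy', valuation_le_iff_div_mem _ hy, ← map_div₀, ← h]
  rfl

variable {v w} in
theorem valuation_lt_iff_of_comap_eq (h : w.ring.comap (algebraMap K L) = v.ring) (x y : K) :
    w.ring.valuation (algebraMap K L x) < w.ring.valuation (algebraMap K L y) ↔
      v.ring.valuation x < v.ring.valuation y := by
  rw [← not_le, ← not_le, valuation_le_iff_of_comap_eq h]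

variable [IsFunctionField k L] [Finite k]

variable {v w} in
/-- The values of `K` are cofinal in those of `L`, by Krull's intersection theorem in the noetherian
ring `O_w`. This makes `K → L` continuous. -/
theorem exists_valuation_le (h : w.ring.comap (algebraMap K L) = v.ring) {b : L} (hb : b ≠ 0) :
    ∃ t : K, t ≠ 0 ∧ w.ring.valuation (algebraMap K L t) ≤ w.ring.valuation b := by
  by_cases hbw : b ∈ w.ring
  swap
  · refine ⟨1, one_ne_zero, ?_⟩
    rw [map_one, map_one]
    exact le_of_not_ge fun h => hbw ((ValuationSubring.valuation_le_one_iff _ _).1 h)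
  have hv : v.ring.valuation.IsNontrivial :=
    not_not.1 fun h => v.ne_top ((ValuationSubring.eq_top_iff _).2 h)
  obtain ⟨t, ht0, ht1⟩ := (v.ring.valuation.isNontrivial_iff_exists_lt_one).1 hv
  have hlt : w.ring.valuation (algebraMap K L t) < 1 := by
    have := (valuation_lt_iff_of_comap_eq h t 1).2 (by rwa [map_one])
    rwa [map_one, map_one] at this
  let t' : w.ring := ⟨algebraMap K L t, (ValuationSubring.valuation_le_one_iff _ _).1 hlt.le⟩
  have ht' : ¬ IsUnit t' := (ValuationSubring.valuation_lt_one_iff _ _).2 hlt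
  have hinf := Ideal.iInf_pow_eq_bot_of_isLocalRing (Ideal.span {t'})
    (fun h => ht' (Ideal.span_singleton_eq_top.1 h))
  have hb' : (⟨b, hbw⟩ : w.ring) ∉ ⨅ n : ℕ, Ideal.span {t'} ^ n := by
    rw [hinf, Ideal.mem_bot]
    exact fun h => hb (congrArg Subtype.val h)
  simp only [Ideal.mem_iInf, not_forall, Ideal.span_singleton_pow, Ideal.mem_span_singleton] at hb'
  obtain ⟨n, hn⟩ := hb'
  refine ⟨t ^ n, pow_ne_zero n (by simpa using ht0), ?_⟩
  by_contra hlt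
  rw [not_le] at hlt
  refine hn ?_
  obtain ⟨a, ha⟩ := (w.ring.valuation_le_iff b (algebraMap K L (t ^ n))).1 hlt.le
  exact ⟨a, Subtype.ext (by
    change b = algebraMap K L t ^ n * a
    rw [← ha, map_pow, mul_comm])⟩

variable {v w} in
theorem continuous_withVal_map (h : w.ring.comap (algebraMap K L) = v.ring) :
    Continuous (WithVal.map v.ring.valuation w.ring.valuation (algebraMap K L)) := by
  refine continuous_of_continuousAt_zero _ ?_
  rw [ContinuousAt, map_zero, (Valued.hasBasis_nhds_zero _ _).tendsto_right_iff]
  intro γ _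
  obtain ⟨b, hb⟩ := MonoidWithZeroHom.ValueGroup₀.restrict₀_surjective
    (.ofClass (Valued.v : Valuation (WithVal w.ring.valuation) w.ring.ValueGroup)) γ
  have hb0 : b ≠ 0 := by
    rintro rfl
    rw [map_zero] at hb
    exact γ.ne_zero hb.symm
  obtain ⟨t, ht0, ht⟩ := exists_valuation_le h (b := b.ofVal) (by simpa using hb0)
  have hopen := (isOpen_setOf_valuation_lt (E := WithVal v.ring.valuation)
    (t := WithVal.toVal _ t)).mem_nhds (x := 0) (by
      rw [Set.mem_ofPred_eq, map_zero]
      exact zero_lt_iff.2 ((Valuation.ne_zero_iff _).2 (by simpa using ht0)))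
  filter_upwards [hopen] with x hx
  rw [← hb, ← Valuation.restrict_def, Valuation.restrict_lt_iff]
  exact ((valuation_lt_iff_of_comap_eq h x.ofVal t).2 hx).trans_le ht

variable {v w} in
/-- The embedding of completions `K_v → L_w` for a place `w` above `v`. -/
noncomputable def completionMap (h : w.ring.comap (algebraMap K L) = v.ring) :
    v.completion →+* w.completion :=
  UniformSpace.Completion.mapRingHom _ (continuous_withVal_map h)

variable {v w} in
theorem continuous_completionMap (h : w.ring.comap (algebraMap K L) = v.ring) :
    Continuous (completionMap h) :=
  UniformSpace.Completion.continuous_map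

variable {v w} in
theorem completionMap_algebraMap (h : w.ring.comap (algebraMap K L) = v.ring) (x : K) :
    completionMap h (algebraMap K v.completion x) =
      algebraMap L w.completion (algebraMap K L x) :=
  UniformSpace.Completion.mapRingHom_coe (continuous_withVal_map h) (WithVal.toVal _ x)

end Place

/-- A finite-dimensional subalgebra is closed, hence equal to the whole algebra if it is dense. -/
theorem adjoin_eq_top_of_dense {E M : Type*} [NontriviallyNormedField E] [CompleteSpace E]
    [CommRing M] [TopologicalSpace M] [IsTopologicalRing M] [T2Space M] [Algebra E M]
    [ContinuousSMul E M] {S : Set M} (hS : S.Finite) (hint : ∀ x ∈ S, IsIntegral E x)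
    (hd : Dense (Algebra.adjoin E S : Set M)) : Algebra.adjoin E S = ⊤ := by
  have h1 : (Subalgebra.toSubmodule (Algebra.adjoin E S)).FG := fg_adjoin_of_finite hS hint
  have : FiniteDimensional E (Subalgebra.toSubmodule (Algebra.adjoin E S)) :=
    Module.Finite.iff_fg.2 h1
  have hcl : IsClosed (Algebra.adjoin E S : Set M) :=
    (Subalgebra.toSubmodule (Algebra.adjoin E S)).closed_of_finiteDimensional
  refine SetLike.coe_injective ?_
  rw [← hcl.closure_eq, hd.closure_eq]
  rfl

namespace Place
variable {k K L : Type*} [Field k] [Field K] [Field L] [Algebra k K] [Algebra k L] [Algebra K L]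
  {v : Place k K} {w : Place k L} [IsFunctionField k K] [IsFunctionField k L] [Finite k]
  (h : w.ring.comap (algebraMap K L) = v.ring)
  {l : Type*} [Field l] [Finite l] [Algebra k l] (φ : l →ₐ[k] L)
  (hφ : Algebra.adjoin K (Set.range φ) = ⊤)

section RankOne
variable [hR : (Valued.v : Valuation v.completion v.ring.ValueGroup).RankOne]

attribute [local instance] Valued.toNontriviallyNormedField

omit [IsFunctionField k K] in
include hφ in
theorem adjoin_const_eq_top_of_rankOne :
    letI : Algebra v.completion w.completion := (completionMap h).toAlgebra
    Algebra.adjoin v.completion (w.const : Set w.completion) = ⊤ := by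
  let _ : Algebra v.completion w.completion := (completionMap h).toAlgebra
  have : ContinuousSMul v.completion w.completion :=
    ⟨((continuous_completionMap h).comp continuous_fst).mul continuous_snd⟩
  refine adjoin_eq_top_of_dense (E := v.completion) (show Finite w.const from inferInstance)
    (fun x hx => isIntegral_of_pow_eq_self w.one_lt_norm hx) ?_
  have hL : ∀ x : L, algebraMap L w.completion x ∈
      Algebra.adjoin v.completion (w.const : Set w.completion) := by
    intro x
    have hx : x ∈ Algebra.adjoin K (Set.range φ) := by rw [hφ]; trivial
    induction hx using Algebra.adjoin_induction with
    | mem x hx =>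
      obtain ⟨z, rfl⟩ := hx
      refine Algebra.subset_adjoin ?_
      let _ : Algebra l w.completion := ((algebraMap L w.completion).comp φ.toRingHom).toAlgebra
      exact w.mem_const_of_isAlgebraic (isAlgebraic_algebraMap (R := l) z)
    | algebraMap x =>
      rw [← completionMap_algebraMap h]
      exact Subalgebra.algebraMap_mem _ _
    | add x y _ _ hx hy => rw [map_add]; exact add_mem hx hy
    | mul x y _ _ hx hy => rw [map_mul]; exact mul_mem hx hy
  refine Dense.mono ?_ (UniformSpace.Completion.denseRange_coe (α := WithVal w.ring.valuation))
  rintro _ ⟨x, rfl⟩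
  exact hL x.ofVal

end RankOne

include hφ in
/-- The completion `L_w` is generated by constants over `K_v`. -/
theorem adjoin_const_eq_top :
    letI : Algebra v.completion w.completion := (completionMap h).toAlgebra
    Algebra.adjoin v.completion (w.const : Set w.completion) = ⊤ := by
  obtain ⟨hR⟩ := v.nonempty_rankOne
  exact adjoin_const_eq_top_of_rankOne h φ hφ

include hφ in
/-- The extension `L_w / K_v` is unramified of degree `e`, where `N(w) = N(v) ^ e`; the index of a
central simple algebra drops by the factor `gcd (e, index)` under base change. -/
theorem index_completion_mul_gcd {e : ℕ} (he : w.norm = v.norm ^ e)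
    {A : Type*} [Ring A] [Algebra v.completion A] [Algebra.IsCentral v.completion A]
    [IsSimpleRing A] [FiniteDimensional v.completion A] :
    letI : Algebra v.completion w.completion := (completionMap h).toAlgebra
    index w.completion (w.completion ⊗[v.completion] A) * Nat.gcd e (index v.completion A) =
      index v.completion A := by
  let _ : Algebra v.completion w.completion := (completionMap h).toAlgebra
  have hmap : ∀ x : v.const, completionMap h x ∈ w.const := by
    intro x
    let _ : Algebra v.const w.completion := ((completionMap h).comp v.const.subtype).toAlgebra
    exact w.mem_const_of_isAlgebraic (isAlgebraic_algebraMap (R := v.const) x)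
  let _ : Algebra v.const w.const :=
    (((completionMap h).comp v.const.subtype).codRestrict w.const hmap).toAlgebra
  have hκ : ∀ x : v.completion, IsAlgebraic v.const x →
      x ∈ Set.range (algebraMap v.const v.completion) :=
    fun x hx => ⟨⟨x, v.mem_const_of_isAlgebraic hx⟩, rfl⟩
  let φ₁ : w.const →ₐ[v.const] w.completion :=
    { w.const.subtype with commutes' := fun _ => rfl }
  have hr : Set.range φ₁ = w.const := Subtype.range_coe
  obtain ⟨hfd, hfr⟩ := finrank_eq_of_adjoin_constants (F := v.completion) hκ φ₁
    (by rw [hr]; exact adjoin_const_eq_top h φ hφ)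
  have hcard : Module.finrank v.const w.const = e := by
    have h1 := Module.natCard_eq_pow_finrank (K := v.const) (V := w.const)
    rw [natCard_const, natCard_const, he] at h1
    exact (Nat.pow_right_injective v.one_lt_norm h1).symm
  have hE := index_baseChange_mul_gcd (E := w.completion) (A := A) hκ φ₁ hfr.symm
    (fun Δ _ _ _ _ _ _ d hd => v.exists_constant_subfield_completion hκ hd)
  rwa [hfr, hcard] at hE

end Place

/-- Transitivity of the base change of not necessarily commutative algebras. -/
noncomputable def baseChangeTrans (R S A B : Type*) [CommRing R] [CommRing S] [CommRing A] [Ring B]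
    [Algebra R S] [Algebra R A] [Algebra S A] [IsScalarTower R S A] [Algebra R B] :
    A ⊗[S] (S ⊗[R] B) ≃ₐ[A] A ⊗[R] B :=
  AlgEquiv.symm <| AlgEquiv.ofLinearEquiv
    (TensorProduct.AlgebraTensorModule.cancelBaseChange R S A A B).symm
    (by simp [Algebra.TensorProduct.one_def]) <|
      LinearMap.map_mul_of_map_mul_tmul (fun _ _ _ _ ↦ by simp)

theorem index_baseChange_baseChange {R S A B : Type*} [Field R] [Field S] [Field A] [Ring B]
    [Algebra R S] [Algebra R A] [Algebra S A] [IsScalarTower R S A] [Algebra R B]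
    [Algebra.IsCentral R B] [IsSimpleRing B] [FiniteDimensional R B] :
    index A (A ⊗[S] (S ⊗[R] B)) = index A (A ⊗[R] B) := by
  have := isSimpleRing_baseChange (F := R) (A := B) A
  have := isCentral_baseChange (F := R) (A := B) A
  have := isSimpleRing_baseChange (F := R) (A := B) S
  have := isCentral_baseChange (F := R) (A := B) S
  have := isSimpleRing_baseChange (F := S) (A := S ⊗[R] B) A
  have := isCentral_baseChange (F := S) (A := S ⊗[R] B) A
  exact index_congr (baseChangeTrans R S A B)

namespace Place
variable {k K L : Type*} [Field k] [Field K] [Field L] [Algebra k K] [Algebra k L] [Algebra K L]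
  {v : Place k K} {w : Place k L} [IsFunctionField k K] [IsFunctionField k L] [Finite k]
  (h : w.ring.comap (algebraMap K L) = v.ring)
  {l : Type*} [Field l] [Finite l] [Algebra k l] (φ : l →ₐ[k] L)
  (hφ : Algebra.adjoin K (Set.range φ) = ⊤)
  {D : Type*} [Ring D] [Algebra K D] [Algebra.IsCentral K D] [IsSimpleRing D]
  [FiniteDimensional K D] [FiniteDimensional K L]

include h hφ in
/-- The local index of the centralizer of `L` in `D`: the centralizer is Brauer equivalent to `L ⊗ D`,
whose completion at `w` is the base change of `D_v` to the unramified extension `L_w` of degree `e`. -/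
theorem localIndex_cent_mul_gcd (ι : L →ₐ[K] D) {e : ℕ} (he : w.norm = v.norm ^ e) :
    w.localIndex (Cent ι) * Nat.gcd e (v.localIndex D) = v.localIndex D := by
  let _ : Algebra v.completion w.completion := (completionMap h).toAlgebra
  let _ : Algebra K w.completion := ((algebraMap L w.completion).comp (algebraMap K L)).toAlgebra
  have h1 : @IsScalarTower K L w.completion _ Algebra.toSMul Algebra.toSMul :=
    .of_algebraMap_eq fun _ => rfl
  have h2 : @IsScalarTower K v.completion w.completion Algebra.toSMul _ Algebra.toSMul :=
    .of_algebraMap_eq fun x => (completionMap_algebraMap h x).symm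
  have := isSimpleRing_baseChange (F := K) (A := D) v.completion
  have := isCentral_baseChange (F := K) (A := D) v.completion
  have h3 := index_completion_mul_gcd h φ hφ he (A := v.completion ⊗[K] D)
  rw [index_baseChange_baseChange] at h3
  rw [localIndex, index_baseChange_cent, index_baseChange_baseChange]
  exact h3

include h hφ in
/-- The local capacity of the centralizer of `L` in `D`, from the local index and the dimension. -/
theorem localCapacity_cent (ι : L →ₐ[K] D) {e : ℕ} (he : w.norm = v.norm ^ e) :
    Module.finrank K L * w.localCapacity (Cent ι) =
      v.localCapacity D * Nat.gcd e (v.localIndex D) := by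
  obtain ⟨h1, h2, h3, h4⟩ := centralizer_properties ι
  have := isSimpleRing_baseChange (F := K) (A := D) v.completion
  have := isCentral_baseChange (F := K) (A := D) v.completion
  have := isSimpleRing_baseChange (F := L) (A := Cent ι) w.completion
  have := isCentral_baseChange (F := L) (A := Cent ι) w.completion
  have h5 : (v.localCapacity D * v.localIndex D) ^ 2 = Module.finrank K D := by
    rw [← Module.finrank_baseChange (R := v.completion)]
    exact sq_capacity_mul_index _ _
  have h6 : (w.localCapacity (Cent ι) * w.localIndex (Cent ι)) ^ 2 = Module.finrank L (Cent ι) := by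
    rw [← Module.finrank_baseChange (R := w.completion)]
    exact sq_capacity_mul_index _ _
  have h7 := localIndex_cent_mul_gcd h φ hφ ι he
  rw [← h5, ← h6, ← mul_pow, Nat.pow_left_inj two_ne_zero] at h4
  have hpos : 0 < w.localIndex (Cent ι) := index_pos w.completion (w.completion ⊗[L] Cent ι)
  refine Nat.eq_of_mul_eq_mul_right hpos ?_
  rw [mul_assoc, h4, mul_assoc, mul_comm (Nat.gcd _ _), h7]

end Place

/-! ### Places above a given place and prime ideals -/

namespace Place
variable {k K L : Type*} [Field k] [Field K] [Field L] [Algebra k K] [Algebra k L] [Algebra K L]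
  (v : Place k K)

theorem isIntegral_of_isIntegral [IsScalarTower k K L] {x : L} (hx : IsIntegral k x) : IsIntegral v.ring x := by
  have : IsScalarTower k v.ring L := .of_algebraMap_eq fun a => by
    rw [IsScalarTower.algebraMap_apply k K L]
    rfl
  exact hx.tower_top

section
variable {v}

theorem mem_of_mem_integralClosure {w : Place k L} (h : w.ring.comap (algebraMap K L) = v.ring)
    {x : L} (hx : x ∈ integralClosure v.ring L) : x ∈ w.ring := by
  obtain ⟨p, hp, hpx⟩ := hx
  have hle : ∀ a : v.ring, algebraMap K L a ∈ w.ring := fun a => h.ge a.2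
  let j : v.ring →+* w.ring :=
    ((algebraMap K L).comp (algebraMap v.ring K)).codRestrict w.ring.toSubring hle
  have h1 : IsIntegral w.ring x := by
    refine ⟨p.map j, hp.map j, ?_⟩
    rw [Polynomial.eval₂_map]
    exact hpx
  obtain ⟨y, rfl⟩ := IsIntegrallyClosed.isIntegral_iff.1 h1
  exact y.2

/-- The inclusion of the integral closure of `O_v` in the valuation ring of a place above `v`. -/
def integralClosureInclusion {w : Place k L} (h : w.ring.comap (algebraMap K L) = v.ring) :
    integralClosure v.ring L →+* w.ring :=
  (integralClosure v.ring L).val.toRingHom.codRestrict w.ring.toSubring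
    fun x => mem_of_mem_integralClosure h x.2

/-- The prime ideal of the integral closure of `O_v` defined by a place above `v`. -/
def center {w : Place k L} (h : w.ring.comap (algebraMap K L) = v.ring) :
    Ideal (integralClosure v.ring L) :=
  (IsLocalRing.maximalIdeal w.ring).comap (integralClosureInclusion h)

theorem center_isPrime {w : Place k L} (h : w.ring.comap (algebraMap K L) = v.ring) :
    (center h).IsPrime := Ideal.IsPrime.comap _

theorem mem_center_iff {w : Place k L} (h : w.ring.comap (algebraMap K L) = v.ring)
    (x : integralClosure v.ring L) : x ∈ center h ↔ w.ring.valuation (x : L) < 1 :=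
  w.ring.valuation_lt_one_iff _

theorem center_liesOver {w : Place k L} (h : w.ring.comap (algebraMap K L) = v.ring) :
    (center h).LiesOver (IsLocalRing.maximalIdeal v.ring) := by
  refine ⟨Ideal.ext fun x => ?_⟩
  rw [Ideal.mem_comap, mem_center_iff, v.ring.valuation_lt_one_iff x]
  have := valuation_lt_iff_of_comap_eq h (x : K) 1
  rw [map_one, map_one, map_one] at this
  exact this.symm

end

theorem maximalIdeal_ne_bot : IsLocalRing.maximalIdeal v.ring ≠ ⊥ := fun h =>
  v.not_isField (IsLocalRing.isField_iff_maximalIdeal_eq.2 h)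

omit [Algebra k L] in
instance : Module.IsTorsionFree v.ring (integralClosure v.ring L) :=
  Module.isTorsionFree_iff_algebraMap_injective.2 fun _ _ h => Subtype.ext
    ((algebraMap K L).injective (congrArg Subtype.val h))

omit [Algebra k L] in
theorem ne_bot_of_liesOver (P : Ideal (integralClosure v.ring L))
    [P.LiesOver (IsLocalRing.maximalIdeal v.ring)] : P ≠ ⊥ :=
  Ideal.ne_bot_of_liesOver_of_ne_bot v.maximalIdeal_ne_bot P

section Dedekind
variable [IsFunctionField k K] [Finite k] [FiniteDimensional K L] [Algebra.IsSeparable K L]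

instance : IsDedekindDomain (integralClosure v.ring L) := integralClosure.isDedekindDomain v.ring K L

instance : IsFractionRing (integralClosure v.ring L) L :=
  IsIntegralClosure.isFractionRing_of_finite_extension v.ring K L _

instance : Module.Finite v.ring (integralClosure v.ring L) :=
  IsIntegralClosure.finite v.ring K L _

omit [Algebra k L] in
theorem isLocalization_valuationSubringAtPrime
    (P : IsDedekindDomain.HeightOneSpectrum (integralClosure v.ring L)) :
    IsLocalization.AtPrime (P.valuationSubringAtPrime L) P.asIdeal :=
  inferInstanceAs (IsLocalization P.asIdeal.primeCompl _)

variable {v} in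
/-- The valuation ring of a place above `v` is the localization of the integral closure of `O_v` at
the center of the place. -/
theorem valuationSubringAtPrime_center {w : Place k L}
    (h : w.ring.comap (algebraMap K L) = v.ring) :
    letI := center_liesOver h
    IsDedekindDomain.HeightOneSpectrum.valuationSubringAtPrime L
      ⟨center h, center_isPrime h, v.ne_bot_of_liesOver (center h)⟩ = w.ring := by
  refine ValuationSubring.eq_of_le_of_ne_top _ ?_ w.ne_top
  rintro x ⟨a, b, hb, rfl⟩
  have ha : (a : L) ∈ w.ring := mem_of_mem_integralClosure h a.2
  have hb : (b : L)⁻¹ ∈ w.ring := by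
    rw [← w.ring.valuation_le_one_iff, map_inv₀]
    exact inv_le_one_of_one_le₀ (not_lt.1 fun hlt => hb ((mem_center_iff h b).2 hlt))
  exact w.ring.mul_mem _ _ ha hb

variable {v} in
theorem norm_eq_cardQuot_center {w : Place k L}
    (h : w.ring.comap (algebraMap K L) = v.ring) :
    w.norm = (center h).cardQuot := by
  have := center_liesOver h
  have := center_isPrime h
  have hmax : (center h).IsMaximal := (center_isPrime h).isMaximal (v.ne_bot_of_liesOver _)
  let P : IsDedekindDomain.HeightOneSpectrum (integralClosure v.ring L) :=
    ⟨center h, center_isPrime h, v.ne_bot_of_liesOver (center h)⟩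
  have := v.isLocalization_valuationSubringAtPrime P
  have h1 : w.norm = Nat.card (IsLocalRing.ResidueField (P.valuationSubringAtPrime L)) := by
    rw [valuationSubringAtPrime_center h]
    rfl
  rw [h1]
  exact (Nat.card_congr (IsLocalization.AtPrime.equivQuotMaximalIdeal P.asIdeal
    (P.valuationSubringAtPrime L)).toEquiv).symm

variable (L) in
/-- The places above `v` correspond to the prime ideals above the maximal ideal of `O_v`. -/
def aboveToPrimesOver (w : v.Above L) :
    (IsLocalRing.maximalIdeal v.ring).primesOver (integralClosure v.ring L) :=
  ⟨center w.2, center_isPrime w.2, center_liesOver w.2⟩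

variable (L) in
theorem bijective_aboveToPrimesOver [IsScalarTower k K L] :
    Function.Bijective (v.aboveToPrimesOver L) := by
  constructor
  · rintro ⟨w, hw⟩ ⟨w', hw'⟩ heq
    have h1 : center hw = center hw' := congrArg Subtype.val heq
    apply Subtype.ext
    have h2 : w.ring = w'.ring := by
      rw [← valuationSubringAtPrime_center hw, ← valuationSubringAtPrime_center hw']
      congr!
    change w = w'
    cases w
    cases w'
    congr
  · rintro ⟨P, hP, hPv⟩
    have hbot := v.ne_bot_of_liesOver P
    let P' : IsDedekindDomain.HeightOneSpectrum (integralClosure v.ring L) := ⟨P, hP, hbot⟩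
    have := v.isLocalization_valuationSubringAtPrime P'
    have hB : ∀ x : integralClosure v.ring L, (x : L) ∈ P'.valuationSubringAtPrime L := fun x =>
      ((algebraMap _ (P'.valuationSubringAtPrime L)) x).2
    have hlt : ∀ x ∈ P, (P'.valuationSubringAtPrime L).valuation (x : L) < 1 := fun x hx =>
      ((P'.valuationSubringAtPrime L).valuation_lt_one_iff
        (algebraMap _ (P'.valuationSubringAtPrime L) x)).1
        ((IsLocalization.AtPrime.to_map_mem_maximal_iff (P'.valuationSubringAtPrime L) P'.asIdeal x).2 hx)
    obtain ⟨b, hb, hb0⟩ := Submodule.exists_mem_ne_zero_of_ne_bot hbot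
    let w : Place k L :=
      { ring := P'.valuationSubringAtPrime L
        algebraMap_mem := fun a => hB
          ⟨algebraMap k L a, v.isIntegral_of_isIntegral isIntegral_algebraMap⟩
        ne_top := fun htop => by
          have h1 := hlt b hb
          have h2 : (b : L)⁻¹ ∈ P'.valuationSubringAtPrime L := htop ▸ ValuationSubring.mem_top _
          rw [← (P'.valuationSubringAtPrime L).valuation_le_one_iff, map_inv₀] at h2
          have h3 : (P'.valuationSubringAtPrime L).valuation (b : L) ≠ 0 :=
            (Valuation.ne_zero_iff _).2 fun h => hb0 (Subtype.ext h)
          exact absurd ((inv_le_one₀ (zero_lt_iff.2 h3)).1 h2) h1.not_ge }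
    obtain ⟨t, htm, ht0⟩ := Submodule.exists_mem_ne_zero_of_ne_bot v.maximalIdeal_ne_bot
    have htP : algebraMap v.ring (integralClosure v.ring L) t ∈ P :=
      (Ideal.mem_of_liesOver P (IsLocalRing.maximalIdeal v.ring) t).1 htm
    have hw : w.ring.comap (algebraMap K L) = v.ring := by
      refine (ValuationSubring.eq_of_le_of_ne_top _ (fun x hx => ?_) fun htop => ?_).symm
      · exact hB (algebraMap v.ring (integralClosure v.ring L) ⟨x, hx⟩)
      · have h2 : (t : K)⁻¹ ∈ w.ring.comap (algebraMap K L) := htop ▸ ValuationSubring.mem_top _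
        have h3 : (algebraMap K L t)⁻¹ ∈ w.ring := by
          rw [← map_inv₀]
          exact h2
        rw [← w.ring.valuation_le_one_iff, map_inv₀] at h3
        have h4 : w.ring.valuation (algebraMap K L t) ≠ 0 :=
          (Valuation.ne_zero_iff _).2 (by simpa using ht0)
        exact absurd ((inv_le_one₀ (zero_lt_iff.2 h4)).1 h3) (hlt _ htP).not_ge
    refine ⟨⟨w, hw⟩, Subtype.ext (Ideal.ext fun x => ?_)⟩
    change x ∈ center hw ↔ x ∈ P
    rw [mem_center_iff]
    refine ⟨fun h => ?_, hlt x⟩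
    exact (IsLocalization.AtPrime.to_map_mem_maximal_iff (P'.valuationSubringAtPrime L) P'.asIdeal x).1
      (((P'.valuationSubringAtPrime L).valuation_lt_one_iff
        (algebraMap _ (P'.valuationSubringAtPrime L) x)).2 h)

end Dedekind

end Place

/-! ### Places in constant field extensions -/

/-- An extension generated by constants is separable. -/
theorem isSeparable_of_adjoin_constants {κ F E : Type*} [Field κ] [Finite κ] [Field F] [Field E]
    [Algebra κ F] [Algebra κ E] [Algebra F E] [IsScalarTower κ F E]
    {k₁ : Type*} [Field k₁] [Finite k₁] [Algebra κ k₁] (φ : k₁ →ₐ[κ] E)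
    (hφ : Algebra.adjoin F (Set.range φ) = ⊤) : Algebra.IsSeparable F E := by
  have h1 : IntermediateField.adjoin F (Set.range φ) = ⊤ := by
    rw [← IntermediateField.toSubalgebra_inj, IntermediateField.top_toSubalgebra, eq_top_iff, ← hφ]
    exact IntermediateField.algebra_adjoin_le_adjoin F _
  have h2 : Algebra.IsSeparable F (IntermediateField.adjoin F (Set.range φ)) := by
    rw [IntermediateField.isSeparable_adjoin_iff_isSeparable]
    rintro _ ⟨x, rfl⟩
    have : Module.Finite κ k₁ := Module.Finite.of_finite
    have h3 : IsSeparable κ (φ x) := by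
      rw [IsSeparable, minpoly.algHom_eq φ φ.toRingHom.injective]
      exact Algebra.IsSeparable.isSeparable κ x
    exact h3.tower_top F
  rw [h1] at h2
  exact Algebra.IsSeparable.of_algHom F _ (IntermediateField.topEquiv (F := F) (E := E)).symm.toAlgHom

/-- The norm of `η - a` in a finite extension, in terms of the minimal polynomial of `η`. -/
theorem norm_sub_algebraMap {F E : Type*} [Field F] [Field E] [Algebra F E] [FiniteDimensional F E]
    (η : E) (a : F) : ∃ m n : ℕ, 0 < n ∧ Algebra.norm F (η - algebraMap F E a) =
      ((-1) ^ m * (minpoly F η).eval a) ^ n := by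
  set y := η - algebraMap F E a with hy
  have hint : IsIntegral F y := Algebra.IsIntegral.isIntegral y
  refine ⟨(IntermediateField.adjoin.powerBasis hint).dim, _,
    Module.finrank_pos (R := IntermediateField.adjoin F {y}) (M := E),
    (Algebra.norm_eq_norm_adjoin F y).trans ?_⟩
  congr 1
  have h1 := Algebra.PowerBasis.norm_gen_eq_coeff_zero_minpoly
    (IntermediateField.adjoin.powerBasis hint)
  rw [IntermediateField.adjoin.powerBasis_gen, IntermediateField.minpoly_gen] at h1
  refine h1.trans ?_
  congr 1
  rw [hy, minpoly.sub_algebraMap, Polynomial.coeff_zero_eq_eval_zero]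
  simp

/-- If the degree of `l` divides that of `κ`, then the minimal polynomials of elements of `l` have all
their roots in `κ`. -/
theorem card_rootSet_minpoly {k κ l : Type*} [Field k] [Finite k] [Field κ] [Finite κ] [Field l]
    [Finite l] [Algebra k κ] [Algebra k l] (h : Module.finrank k l ∣ Module.finrank k κ) (y : l) :
    Fintype.card ((minpoly k y).rootSet κ) = (minpoly k y).natDegree := by
  have : Module.Finite k l := Module.Finite.of_finite
  have : Module.Finite k κ := Module.Finite.of_finite
  obtain ⟨j⟩ := FiniteField.nonempty_algHom_of_finrank_dvd h
  have h1 : ((minpoly k y).map (algebraMap k κ)).Splits := by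
    have := (Normal.splits (F := k) (K := l) inferInstance y).map j.toRingHom
    rw [Polynomial.map_map] at this
    convert this
    exact j.comp_algebraMap.symm
  exact Polynomial.card_rootSet_eq_natDegree (Algebra.IsSeparable.isSeparable k y) h1

/-- The order of a finite field is a power of the order of each of its subfields. -/
theorem exists_natCard_eq_pow {l E : Type*} [Field l] [Field E] [Finite E] (j : l →+* E) :
    ∃ n, Nat.card E = Nat.card l ^ n := by
  let _ : Algebra l E := j.toAlgebra
  exact ⟨_, Module.natCard_eq_pow_finrank (K := l)⟩

namespace Place
variable {k K L : Type*} [Field k] [Field K] [Field L] [Algebra k K] [Algebra k L] [Algebra K L]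
  [IsScalarTower k K L] [IsFunctionField k K] [Finite k] (v : Place k K)
  [FiniteDimensional K L] [Algebra.IsSeparable K L]
  (hconst : ∀ x : K, IsAlgebraic k x → x ∈ Set.range (algebraMap k K))

include hconst in
omit [IsFunctionField k K] [Finite k] [Algebra.IsSeparable K L] in
/-- A root `ρ` in the residue field of `v` of the minimal polynomial of a constant `η` gives a prime
ideal above `v` that contains `η - a`, where `a` lifts `ρ`. -/
theorem exists_primesOver_of_mem_rootSet (η : integralClosure v.ring L)
    (hη : IsIntegral k (η : L)) (a : v.ring)
    (ha : Polynomial.aeval (IsLocalRing.residue v.ring a) (minpoly k (η : L)) = 0) :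
    ∃ P : (IsLocalRing.maximalIdeal v.ring).primesOver (integralClosure v.ring L),
      η - algebraMap v.ring _ a ∈ P.1 := by
  set y := η - algebraMap v.ring (integralClosure v.ring L) a with hy
  have hyL : (y : L) = (η : L) - algebraMap K L a := rfl
  have hunit : ¬ IsUnit y := by
    intro hu
    obtain ⟨z, hz⟩ := hu.exists_right_inv
    obtain ⟨m, n, hn, hN⟩ := norm_sub_algebraMap (η : L) (a : K)
    obtain ⟨b, hb⟩ := IsIntegrallyClosed.isIntegral_iff.1
      (Algebra.isIntegral_norm (R := v.ring) K (L := L) (x := (z : L)) z.2)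
    have hg : (minpoly K (η : L)).eval (a : K) = (Polynomial.aeval a (minpoly k (η : L)) : v.ring) := by
      rw [minpoly_map_of_algClosed hconst hη, Polynomial.eval_map_algebraMap]
      exact Polynomial.aeval_algebraMap_apply K a _
    rw [← hyL, hg] at hN
    have h1 : ((-1) ^ m * Polynomial.aeval a (minpoly k (η : L))) ^ n * b = 1 := by
      apply Subtype.ext
      have h2 : Algebra.norm K (y : L) * Algebra.norm K (z : L) = 1 := by
        rw [← map_mul, ← MulMemClass.coe_mul, hz]
        exact map_one _
      rw [hN, ← hb] at h2
      exact h2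
    have h2 : IsLocalRing.residue v.ring (Polynomial.aeval a (minpoly k (η : L))) = 0 := by
      rw [← ha]
      exact (Polynomial.aeval_algHom_apply
        (IsScalarTower.toAlgHom k v.ring v.residueField) a _).symm
    have h3 := congrArg (IsLocalRing.residue v.ring) h1
    rw [map_mul, map_pow, map_mul, h2, mul_zero, zero_pow hn.ne', zero_mul, map_one] at h3
    exact zero_ne_one h3
  obtain ⟨P, hP, hyP⟩ := exists_max_ideal_of_mem_nonunits hunit
  have hmax : (P.under v.ring).IsMaximal := Ideal.isMaximal_comap_of_isIntegral_of_isMaximal P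
  exact ⟨⟨P, hP.isPrime, ⟨(IsLocalRing.eq_maximalIdeal hmax).symm⟩⟩, hyP⟩

variable {l : Type*} [Field l] [Finite l] [Algebra k l] (φ : l →ₐ[k] L)

/-- The constants in the integral closure of the valuation ring of a place. -/
def constToIntegralClosure : l →+* integralClosure v.ring L :=
  φ.toRingHom.codRestrict (integralClosure v.ring L).toSubring fun x =>
    v.isIntegral_of_isIntegral ((Algebra.IsIntegral.isIntegral (R := k) x).map φ)

include hconst φ in
/-- A generator `η` of the constants of degree `gcd(s, deg v)` in `L` has that many conjugates in the
residue field of `v`, each of which gives a prime above `v`. -/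
theorem gcd_le_card_primesOver :
    Nat.gcd (Module.finrank k l) v.degree ≤
      Nat.card ((IsLocalRing.maximalIdeal v.ring).primesOver (integralClosure v.ring L)) := by
  have : Module.Finite k l := Module.Finite.of_finite
  have hpos : 0 < Nat.gcd (Module.finrank k l) v.degree :=
    Nat.gcd_pos_of_pos_left _ Module.finrank_pos
  obtain ⟨l', _, _, _, hl'⟩ := exists_extension_finrank_eq k hpos
  have : Module.Finite k l' := Module.Finite.of_finite
  obtain ⟨j⟩ := FiniteField.nonempty_algHom_of_finrank_dvd (F := k) (K := l') (L := l)
    (by rw [hl']; exact Nat.gcd_dvd_left _ _)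
  obtain ⟨y, hy⟩ := Field.exists_primitive_element k l'
  have hyint : IsIntegral k y := Algebra.IsIntegral.isIntegral y
  have hcard : Fintype.card ((minpoly k y).rootSet v.residueField) = (minpoly k y).natDegree :=
    card_rootSet_minpoly (by rw [hl']; exact Nat.gcd_dvd_right _ _) y
  rw [← IntermediateField.adjoin.finrank hyint, hy, IntermediateField.finrank_top', hl'] at hcard
  let η := v.constToIntegralClosure φ (j y)
  have hη : (η : L) = (φ.comp j) y := rfl
  have hmin : minpoly k (η : L) = minpoly k y := by
    rw [hη, minpoly.algHom_eq _ (φ.comp j).toRingHom.injective]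
  have hηint : IsIntegral k (η : L) := by rw [hη]; exact hyint.map _
  choose a ha using fun ρ : (minpoly k y).rootSet v.residueField =>
    IsLocalRing.residue_surjective (R := v.ring) ρ.1
  have h1 : ∀ ρ, Polynomial.aeval (IsLocalRing.residue v.ring (a ρ)) (minpoly k (η : L)) = 0 := by
    intro ρ
    rw [ha, hmin]
    exact (Polynomial.mem_rootSet.1 ρ.2).2
  choose P hP using fun ρ => v.exists_primesOver_of_mem_rootSet hconst η hηint (a ρ) (h1 ρ)
  rw [← hcard, ← Nat.card_eq_fintype_card]
  have := (IsDedekindDomain.primesOver_finite (IsLocalRing.maximalIdeal v.ring)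
    (integralClosure v.ring L)).to_subtype
  refine Nat.card_le_card_of_injective P fun ρ ρ' h => Subtype.ext ?_
  have h2 := (P ρ').1.sub_mem (h ▸ hP ρ) (hP ρ')
  rw [sub_sub_sub_cancel_left, ← map_sub] at h2
  have := (P ρ').2.2
  have h3 := (Ideal.mem_of_liesOver (P ρ').1 (IsLocalRing.maximalIdeal v.ring) _).2 h2
  rw [← ha, ← ha]
  exact (Ideal.Quotient.eq.2 h3).symm

include φ in
/-- The residue field at `P` contains the constants of `L`, so that `s` divides `deg v * f_P`. -/
theorem div_gcd_dvd_inertiaDeg (P : Ideal (integralClosure v.ring L)) [P.IsMaximal]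
    [P.LiesOver (IsLocalRing.maximalIdeal v.ring)] :
    Module.finrank k l / Nat.gcd (Module.finrank k l) v.degree ∣ P.inertiaDeg v.ring := by
  have : Module.Finite k l := Module.Finite.of_finite
  have h1 : v.norm ^ P.inertiaDeg v.ring = Nat.card (integralClosure v.ring L ⧸ P) :=
    Ideal.cardQuot_pow_inertiaDeg (IsLocalRing.maximalIdeal v.ring) P
  have hpos : 0 < P.inertiaDeg v.ring := Ideal.inertiaDeg_pos _ _
  have : Finite (integralClosure v.ring L ⧸ P) := by
    refine Nat.finite_of_card_ne_zero ?_
    rw [← h1]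
    exact (pow_pos (zero_lt_one.trans v.one_lt_norm) _).ne'
  let _ : Field (integralClosure v.ring L ⧸ P) := Ideal.Quotient.field P
  obtain ⟨n, hn⟩ :=
    exists_natCard_eq_pow ((Ideal.Quotient.mk P).comp (v.constToIntegralClosure φ))
  rw [hn, v.norm_eq_pow, ← pow_mul, Module.natCard_eq_pow_finrank (K := k) (V := l),
    ← pow_mul] at h1
  have h2 := Nat.pow_right_injective (Finite.one_lt_card (α := k)) h1
  have hg : 0 < Nat.gcd (Module.finrank k l) v.degree :=
    Nat.gcd_pos_of_pos_left v.degree (Module.finrank_pos (R := k) (M := l))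
  obtain ⟨s', d', hcop, hs', hd'⟩ := Nat.exists_coprime (Module.finrank k l) v.degree
  set g := Nat.gcd (Module.finrank k l) v.degree
  rw [hs', hd', mul_right_comm, mul_right_comm s'] at h2
  rw [hs', Nat.mul_div_cancel _ hg]
  exact hcop.dvd_of_dvd_mul_left ⟨_, Nat.eq_of_mul_eq_mul_right hg h2⟩

include hconst φ in
/-- The bounds for the number of primes and for their inertia degrees are sharp, by the fundamental
identity `∑ e_P f_P = s`. -/
theorem card_primesOver_and_inertiaDeg (hs : Module.finrank K L = Module.finrank k l) :
    Nat.card ((IsLocalRing.maximalIdeal v.ring).primesOver (integralClosure v.ring L)) =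
        Nat.gcd (Module.finrank k l) v.degree ∧
      ∀ P : (IsLocalRing.maximalIdeal v.ring).primesOver (integralClosure v.ring L),
        P.1.inertiaDeg v.ring = Module.finrank k l / Nat.gcd (Module.finrank k l) v.degree := by
  have : Module.Finite k l := Module.Finite.of_finite
  have hg : 0 < Nat.gcd (Module.finrank k l) v.degree :=
    Nat.gcd_pos_of_pos_left v.degree (Module.finrank_pos (R := k) (M := l))
  set S := (IsLocalRing.maximalIdeal v.ring).primesOver (integralClosure v.ring L)
  have hfin : S.Finite := IsDedekindDomain.primesOver_finite _ _
  let _ : Fintype S := hfin.fintype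
  have hsum : ∑ P : S, P.1.ramificationIdx v.ring * P.1.inertiaDeg v.ring =
      Module.finrank k l := by
    rw [Ideal.sum_ramification_inertia_eq_finrank, ← hs]
    exact (IsFractionRing.finrank_eq v.ring K (integralClosure v.ring L) L).symm
  have hle := v.gcd_le_card_primesOver (L := L) hconst φ
  set g := Nat.gcd (Module.finrank k l) v.degree
  set e := Module.finrank k l / g
  have hge : g * e = Module.finrank k l := Nat.mul_div_cancel' (Nat.gcd_dvd_left _ _)
  have he : 0 < e := Nat.pos_of_mul_pos_left (hge ▸ Module.finrank_pos)
  -- each prime contributes at least `e` to `∑ e_P f_P = g e`, and there are at least `g` of them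
  have hbound : ∀ P : S, e ≤ P.1.ramificationIdx v.ring * P.1.inertiaDeg v.ring ∧
      (P.1.ramificationIdx v.ring * P.1.inertiaDeg v.ring = e → P.1.inertiaDeg v.ring = e) := by
    intro P
    have := P.2.1
    have := P.2.2
    have : P.1.IsMaximal := P.2.1.isMaximal (v.ne_bot_of_liesOver _)
    have h1 := Nat.le_of_dvd (Ideal.inertiaDeg_pos P.1 v.ring) (v.div_gcd_dvd_inertiaDeg φ P.1)
    have h2 := Nat.le_mul_of_pos_left (P.1.inertiaDeg v.ring) (Ideal.ramificationIdx_pos P.1 v.ring)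
    exact ⟨h1.trans h2, fun h => le_antisymm (h2.trans h.le) h1⟩
  have hcard : Nat.card S * e ≤ g * e := by
    rw [hge, ← hsum, Nat.card_eq_fintype_card, ← smul_eq_mul, ← Finset.card_univ,
      ← Finset.sum_const]
    exact Finset.sum_le_sum fun P _ => (hbound P).1
  have hS : Nat.card S = g := le_antisymm (Nat.le_of_mul_le_mul_right hcard he) hle
  refine ⟨hS, fun P => (hbound P).2 ?_⟩
  have h3 : ∑ _P : S, e = ∑ P : S, P.1.ramificationIdx v.ring * P.1.inertiaDeg v.ring := by
    rw [hsum, Finset.sum_const, Finset.card_univ, ← Nat.card_eq_fintype_card, hS, smul_eq_mul, hge]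
  exact ((Finset.sum_eq_sum_iff_of_le fun P _ => (hbound P).1).1 h3 P (Finset.mem_univ _)).symm

include hconst in
/-- In a constant field extension of degree `s`, there are `gcd(s, deg v)` places above `v`. -/
theorem natCard_above (hφ : Algebra.adjoin K (Set.range φ) = ⊤) :
    Nat.card (v.Above L) = Nat.gcd (Module.finrank k l) v.degree := by
  have hs := (finrank_eq_of_adjoin_constants hconst φ hφ).2
  rw [← (v.card_primesOver_and_inertiaDeg hconst φ hs).1]
  exact Nat.card_eq_of_bijective _ (v.bijective_aboveToPrimesOver L)

include hconst in
/-- In a constant field extension of degree `s`, the residue degree of a place above `v` is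
`s / gcd(s, deg v)`. -/
theorem norm_above (hφ : Algebra.adjoin K (Set.range φ) = ⊤) (w : v.Above L) :
    w.1.norm = v.norm ^ (Module.finrank k l / Nat.gcd (Module.finrank k l) v.degree) := by
  have hs := (finrank_eq_of_adjoin_constants hconst φ hφ).2
  have := center_liesOver w.2
  have hmax : (center w.2).IsMaximal := (center_isPrime w.2).isMaximal (v.ne_bot_of_liesOver _)
  rw [norm_eq_cardQuot_center w.2, ← Ideal.cardQuot_pow_inertiaDeg
    (IsLocalRing.maximalIdeal v.ring) (center w.2)]
  exact congrArg (v.norm ^ ·)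
    ((v.card_primesOver_and_inertiaDeg hconst φ hs).2 (v.aboveToPrimesOver L w))

end Place

/-! ### The constant field extension -/

theorem csaDegree_pos (K D : Type*) [Field K] [Ring D] [Nontrivial D] [Algebra K D]
    [FiniteDimensional K D] : 0 < csaDegree K D :=
  Nat.sqrt_pos.2 Module.finrank_pos

theorem constDegree_pos (k K D : Type*) [Field k] [Field K] [Algebra k K] [Ring D] [Nontrivial D]
    [Algebra K D] [FiniteDimensional K D] : 0 < constDegree k K D := by
  refine Nat.lt_of_lt_of_le Nat.one_pos (le_csSup ⟨csaDegree K D, fun s hs => ?_⟩ ?_)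
  · exact Nat.le_of_dvd (csaDegree_pos K D) hs.1
  · exact ⟨one_dvd _, fun v => by simp⟩

/-- The solutions of `x ^ Q = x` are the image of a field with `Q` elements. -/
theorem range_eq_setOf_pow_eq {l E : Type*} [Field l] [Finite l] [Field E] (φ : l →+* E) :
    Set.range φ = {x | x ^ Nat.card l = x} := by
  have hcard : 1 < Nat.card l := Finite.one_lt_card
  have h0 : (Polynomial.X ^ Nat.card l - Polynomial.X : Polynomial E) ≠ 0 :=
    FiniteField.X_pow_card_sub_X_ne_zero E hcard
  have hset : {x : E | x ^ Nat.card l = x} =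
      (Polynomial.X ^ Nat.card l - Polynomial.X : Polynomial E).rootSet E := by
    ext x
    simp [Polynomial.mem_rootSet, h0, sub_eq_zero]
  rw [hset]
  refine Set.eq_of_subset_of_ncard_le ?_ ?_ (Polynomial.rootSet_finite _ _)
  · rw [← hset]
    rintro _ ⟨x, rfl⟩
    rw [Set.mem_ofPred_eq, ← map_pow, pow_natCard]
  · rw [← Set.image_univ, Set.ncard_image_of_injective _ φ.injective, Set.ncard_univ]
    refine (Polynomial.ncard_rootSet_le _ _).trans ?_
    rw [FiniteField.X_pow_card_sub_X_natDegree_eq E hcard]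

/-- The constant field extension of degree `s` is generated by a finite field of degree `s`. -/
theorem exists_constExt_generated (k K : Type*) [Field k] [Finite k] [Field K] [Algebra k K] {s : ℕ}
    (hs : 0 < s) : ∃ (l : Type) (_ : Field l) (_ : Finite l) (_ : Algebra k l)
      (φ : l →ₐ[k] constExt k K s),
      Module.finrank k l = s ∧ Algebra.adjoin K (Set.range φ) = ⊤ := by
  obtain ⟨l, _, _, _, hl⟩ := exists_extension_finrank_eq k hs
  have : Module.Finite k l := Module.Finite.of_finite
  let φ : l →ₐ[k] AlgebraicClosure K := IsAlgClosed.lift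
  have hcard : Nat.card l = Nat.card k ^ s := by rw [Module.natCard_eq_pow_finrank (K := k), hl]
  have hrange := range_eq_setOf_pow_eq φ.toRingHom
  rw [hcard] at hrange
  have hmem : ∀ x, φ x ∈ constExt k K s := fun x =>
    IntermediateField.subset_adjoin K _ (hrange ▸ Set.mem_range_self x)
  let φ' : l →ₐ[k] constExt k K s :=
    { toRingHom := φ.toRingHom.codRestrict (constExt k K s).toSubring hmem
      commutes' := fun a => Subtype.ext (φ.commutes a) }
  refine ⟨l, inferInstance, inferInstance, inferInstance, φ', hl, ?_⟩
  refine Subalgebra.map_injective (f := (constExt k K s).val) Subtype.val_injective ?_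
  rw [AlgHom.map_adjoin, ← Set.range_comp, Algebra.map_top, IntermediateField.range_val,
    IntermediateField.adjoin_toSubalgebra_of_isAlgebraic fun x _ => Algebra.IsAlgebraic.isAlgebraic x,
    ← hrange]
  rfl

/-! ### Local data of the centralizer -/

section LocalData
variable {k K D : Type*} [Field k] [Finite k] [Field K] [Algebra k K] [IsFunctionField k K]
  (hconst : ∀ x : K, IsAlgebraic k x → x ∈ Set.range (algebraMap k K))
  [Ring D] [Algebra K D] [Algebra.IsCentral K D] [IsSimpleRing D] [FiniteDimensional K D]
  {s : ℕ} (hs : 0 < s) (ι : constExt k K s →ₐ[K] D) (v : Place k K)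

include hconst hs in
theorem Place.natCard_above_constExt : Nat.card (v.Above (constExt k K s)) = ell v s := by
  obtain ⟨l, _, _, _, φ, hl, hφ⟩ := exists_constExt_generated k K hs
  have := (finrank_eq_of_adjoin_constants hconst φ hφ).1
  have := isSeparable_of_adjoin_constants φ hφ
  rw [v.natCard_above hconst φ hφ, hl, ell]

include hconst hs in
/-- The norm, local index and local capacity of the centralizer of `L_s` at a place above `v`. -/
theorem Place.local_data_constExt (w : v.Above (constExt k K s)) :
    w.1.norm = v.norm ^ (s / ell v s) ∧
      w.1.localIndex (Cent ι) * tee D v s = v.localIndex D ∧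
      s * w.1.localCapacity (Cent ι) = v.localCapacity D * tee D v s := by
  obtain ⟨l, _, _, _, φ, hl, hφ⟩ := exists_constExt_generated k K hs
  obtain ⟨hfin, hrank⟩ := finrank_eq_of_adjoin_constants hconst φ hφ
  have := isSeparable_of_adjoin_constants φ hφ
  have : IsFunctionField k (constExt k K s) :=
    isFunctionField_of_finiteDimensional (F := K) (constExt k K s)
  have he := v.norm_above hconst φ hφ w
  rw [hl] at he
  have h1 := Place.localCapacity_cent w.2 φ hφ ι he
  rw [hrank, hl] at h1
  exact ⟨he, Place.localIndex_cent_mul_gcd w.2 φ hφ ι he, h1⟩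

omit [Finite k] [IsFunctionField k K] [Algebra.IsCentral K D] [IsSimpleRing D]
  [FiniteDimensional K D] in
include hs in
theorem tee_pos : 0 < tee D v s :=
  Nat.gcd_pos_of_pos_left _ (Nat.div_pos (Nat.le_of_dvd hs (Nat.gcd_dvd_left _ _))
    (Nat.gcd_pos_of_pos_left _ hs))

omit [Finite k] [IsFunctionField k K] [Algebra.IsCentral K D] [IsSimpleRing D]
  [FiniteDimensional K D] in
theorem ell_mul_tee_mul_ratio : ell v s * tee D v s * ratio D v s = s :=
  Nat.mul_div_cancel' ((Nat.mul_dvd_mul_left _ (Nat.gcd_dvd_left _ _)).trans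
    (Nat.mul_div_cancel' (Nat.gcd_dvd_left _ _)).dvd)

omit [Finite k] [IsFunctionField k K] [Algebra.IsCentral K D] [IsSimpleRing D]
  [FiniteDimensional K D] in
include hs in
theorem ratio_pos : 0 < ratio D v s :=
  Nat.pos_of_mul_pos_left (lt_of_lt_of_eq hs (ell_mul_tee_mul_ratio v (D := D)).symm)

end LocalData

/-! ### Coefficients of a product of power series in monomials -/

section Coefficients
variable {R σ : Type*} [CommRing R]

theorem hasSubst_monomial {m : σ →₀ ℕ} (hm : m ≠ 0) :
    PowerSeries.HasSubst (MvPowerSeries.monomial m (1 : R)) := by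
  classical
  refine PowerSeries.HasSubst.of_constantCoeff_zero ?_
  rw [← MvPowerSeries.coeff_zero_eq_constantCoeff_apply, MvPowerSeries.coeff_monomial_ne hm.symm]

theorem coeff_subst_monomial [DecidableEq σ] {m : σ →₀ ℕ} (hm : m ≠ 0) (f : PowerSeries R)
    (e : σ →₀ ℕ) : MvPowerSeries.coeff e (f.subst (MvPowerSeries.monomial m (1 : R))) =
      ∑ᶠ d : ℕ, if e = d • m then PowerSeries.coeff d f else 0 := by
  rw [PowerSeries.coeff_subst (hasSubst_monomial hm)]
  refine finsum_congr fun d => ?_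
  rw [MvPowerSeries.monomial_pow, MvPowerSeries.coeff_monomial, one_pow, smul_eq_mul, mul_ite,
    mul_one, mul_zero]

theorem nsmul_right_injective_of_ne_zero {m : σ →₀ ℕ} (hm : m ≠ 0) :
    Function.Injective fun d : ℕ => d • m := by
  obtain ⟨x, hx⟩ := Finsupp.ne_iff.1 hm
  intro d d' h
  exact Nat.eq_of_mul_eq_mul_right (Nat.pos_of_ne_zero hx) (DFunLike.congr_fun h x)

theorem coeff_nsmul_subst_monomial {m : σ →₀ ℕ} (hm : m ≠ 0) (f : PowerSeries R) (d : ℕ) :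
    MvPowerSeries.coeff (d • m) (f.subst (MvPowerSeries.monomial m (1 : R))) =
      PowerSeries.coeff d f := by
  classical
  rw [coeff_subst_monomial hm, finsum_eq_single _ d, if_pos rfl]
  exact fun d' h => if_neg fun h' => h (nsmul_right_injective_of_ne_zero hm h').symm

theorem coeff_subst_monomial_eq_zero {m : σ →₀ ℕ} (hm : m ≠ 0) (f : PowerSeries R) {e : σ →₀ ℕ}
    (he : ∀ d : ℕ, e ≠ d • m) :
    MvPowerSeries.coeff e (f.subst (MvPowerSeries.monomial m (1 : R))) = 0 := by
  classical
  rw [coeff_subst_monomial hm]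
  exact finsum_eq_zero_of_forall_eq_zero fun d => if_neg (he d)

/-- A coefficient of a product of power series evaluated at monomials is a sum over the ways of
writing the exponent as a combination of the exponents of these monomials. -/
theorem coeff_prod_subst_monomial {I : Type*} [Fintype I] {m : I → σ →₀ ℕ} (hm : ∀ x, m x ≠ 0)
    (f : PowerSeries R) (n : σ →₀ ℕ) :
    MvPowerSeries.coeff n (∏ x, f.subst (MvPowerSeries.monomial (m x) (1 : R))) =
      ∑ᶠ g ∈ {g : I → ℕ | ∑ x, g x • m x = n}, ∏ x, PowerSeries.coeff (g x) f := by
  classical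
  let E : (I → ℕ) → I →₀ σ →₀ ℕ := fun g => Finsupp.equivFunOnFinite.symm fun x => g x • m x
  have hE : Function.Injective E := fun g g' h => funext fun x =>
    nsmul_right_injective_of_ne_zero (hm x) (DFunLike.congr_fun h x)
  have hmem : ∀ g : I → ℕ, E g ∈ Finset.univ.finsuppAntidiag n ↔ ∑ x, g x • m x = n := fun g => by
    simp [E]
  have hfin : {g : I → ℕ | ∑ x, g x • m x = n}.Finite := by
    refine Set.Finite.of_finite_image (f := E)
      ((Finset.univ.finsuppAntidiag n).finite_toSet.subset ?_) hE.injOn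
    rintro _ ⟨g, hg, rfl⟩
    exact (hmem g).2 hg
  rw [MvPowerSeries.coeff_prod, finsum_mem_eq_finite_toFinset_sum _ hfin, eq_comm]
  refine Finset.sum_of_injOn E hE.injOn ?_ ?_ ?_
  · intro g hg
    exact (hmem g).2 (hfin.mem_toFinset.1 hg)
  · intro e he hne
    by_contra hprod
    have h1 : ∀ x, ∃ d : ℕ, e x = d • m x := by
      intro x
      by_contra hx
      push Not at hx
      exact hprod (Finset.prod_eq_zero (Finset.mem_univ x)
        (coeff_subst_monomial_eq_zero (hm x) f hx))
    choose g hg using h1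
    have h2 : E g = e := Finsupp.ext fun x => (hg x).symm
    exact hne ⟨g, hfin.mem_toFinset.2 ((hmem g).1 (h2 ▸ he)), h2⟩
  · intro g _
    exact Finset.prod_congr rfl fun x _ => (coeff_nsmul_subst_monomial (hm x) f _).symm

end Coefficients

/-- The coefficient of `X ^ a Y ^ b` in `∏ F(X_w Y_i)` is the sum of `∏ a_{g w i j}` over the families
`g` with marginal sums `a` and `b`. -/
theorem coeff_genG_X_X_one (Q : ℚ) {l r t : ℕ} (a : Fin l → ℕ) (b : Fin r → ℕ) :
    MvPowerSeries.coeff (Finsupp.equivFunOnFinite.symm (Sum.elim a b))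
        (genG Q (fun w => MvPowerSeries.X (Sum.inl w)) (fun i => MvPowerSeries.X (Sum.inr i))
          (fun _ : Fin t => 1)) =
      ∑ᶠ g ∈ {g : Fin l → Fin r → Fin t → ℕ | (∀ w, ∑ i, ∑ j, g w i j = a w) ∧
          ∀ i, ∑ w, ∑ j, g w i j = b i}, ∏ w, ∏ i, ∏ j, coeffA Q (g w i j) := by
  classical
  let m : Fin l × Fin r × Fin t → (Fin l ⊕ Fin r) →₀ ℕ := fun x =>
    Finsupp.single (Sum.inl x.1) 1 + Finsupp.single (Sum.inr x.2.1) 1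
  have hm : ∀ x, m x ≠ 0 := fun x h => by
    have := DFunLike.congr_fun h (Sum.inl x.1)
    simp [m] at this
  have h1 : genG Q (fun w => MvPowerSeries.X (Sum.inl w)) (fun i => MvPowerSeries.X (Sum.inr i))
      (fun _ : Fin t => 1) = ∏ x, (seriesF Q).subst (MvPowerSeries.monomial (m x) (1 : ℚ)) := by
    simp only [genG, Fintype.prod_prod_type]
    refine Finset.prod_congr rfl fun w _ => Finset.prod_congr rfl fun i _ =>
      Finset.prod_congr rfl fun j _ => ?_
    rw [mul_one, MvPowerSeries.X, MvPowerSeries.X, MvPowerSeries.monomial_mul_monomial, one_mul]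
  rw [h1, coeff_prod_subst_monomial hm]
  have hmem : ∀ g : Fin l × Fin r × Fin t → ℕ,
      ∑ x, g x • m x = Finsupp.equivFunOnFinite.symm (Sum.elim a b) ↔
        (∀ w, ∑ i, ∑ j, g (w, i, j) = a w) ∧ ∀ i, ∑ w, ∑ j, g (w, i, j) = b i := by
    intro g
    rw [Finsupp.ext_iff, Sum.forall]
    refine and_congr (forall_congr' fun w => ?_) (forall_congr' fun i => ?_)
    · simp [m, Finsupp.finsetSum_apply, Finsupp.single_apply, Fintype.sum_prod_type,
        Finset.sum_ite_irrel]
    · simp [m, Finsupp.finsetSum_apply, Finsupp.single_apply, Fintype.sum_prod_type,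
        Finset.sum_ite_irrel]
  refine finsum_mem_eq_of_bijOn (fun g w i j => g (w, i, j)) ⟨fun g hg => (hmem g).1 hg, ?_, ?_⟩ ?_
  · exact fun g _ g' _ h => funext fun x => congrFun (congrFun (congrFun h x.1) x.2.1) x.2.2
  · exact fun g hg => ⟨fun x => g x.1 x.2.1 x.2.2, (hmem _).2 hg, rfl⟩
  · intro g _
    simp [Fintype.prod_prod_type, seriesF]

/-- The local factor in terms of the coefficients `coeffA`. -/
theorem localFactor_eq {k F : Type*} [Field k] [Field F] [Algebra k F] (w : Place k F) (B : Type*)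
    [Ring B] [Algebra F B] {J : Type*} [Fintype J] (h : J → ℕ) :
    localFactor w B h = (∏ i ∈ Finset.Icc 1 (w.localCapacity B),
      (((w.norm : ℚ) ^ w.localIndex B) ^ i - 1)) *
        ∏ a, coeffA ((w.norm : ℚ) ^ w.localIndex B) (h a) := by
  simp only [localFactor, coeffA, div_eq_mul_inv, pow_mul, Finset.prod_inv_distrib]

/-- If the local data are the same at all places above `v`, then `Θ_v` is, up to a factor, a sum of
products of coefficients `coeffA` over families with given marginal sums. The hypotheses `ha` and `hb`
translate the conditions that define `Ω_v`. -/
theorem Theta_eq {k K L D : Type*} [Field k] [Field K] [Field L] [Algebra k K] [Algebra k L]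
    [Algebra K L] [Ring D] [Algebra K D] (ι : L →ₐ[K] D) (v : Place k K) (s : ℕ) {r l c : ℕ}
    (f : Fin r → ℕ) (e : v.Above L ≃ Fin l) {Q : ℚ}
    (hQ : ∀ w : v.Above L, (w.1.norm : ℚ) ^ w.1.localIndex (Cent ι) = Q)
    (hc : ∀ w : v.Above L, w.1.localCapacity (Cent ι) = c) {a : Fin l → ℕ} {b : Fin r → ℕ}
    (ha : ∀ (w : Fin l) (n : ℕ), ell v s * (ratio D v s * n) = v.localCapacity D ↔ n = a w)
    (hb : ∀ (i : Fin r) (n : ℕ), ratio D v s * n = f i ↔ n = b i) :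
    Theta ι v s f = (∏ k ∈ Finset.Icc 1 c, (Q ^ k - 1)) ^ l *
      ∑ᶠ g ∈ {g : Fin l → Fin r → Fin (tee D v s) → ℕ | (∀ w, ∑ i, ∑ j, g w i j = a w) ∧
        ∀ i, ∑ w, ∑ j, g w i j = b i}, ∏ w, ∏ i, ∏ j, coeffA Q (g w i j) := by
  have : Fintype (v.Above L) := Fintype.ofEquiv _ e.symm
  rw [Theta, mul_finsum_mem]
  refine (finsum_mem_eq_of_bijOn (fun g w => g (e w)) ⟨fun g hg => ?_, ?_, fun g hg => ?_⟩
    fun g _ => ?_).symm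
  · refine ⟨fun w => ?_, fun i => ?_⟩
    · rw [← Finset.mul_sum, ha (e w)]
      exact hg.1 (e w)
    · rw [finsum_eq_sum_of_fintype, ← Finset.mul_sum, hb i, ← hg.2 i]
      exact e.sum_comp fun w => ∑ j, g w i j
  · exact fun g _ g' _ h => funext fun w => by simpa using congrFun h (e.symm w)
  · refine ⟨fun w => g (e.symm w), ⟨fun w => ?_, fun i => ?_⟩, funext fun w => by simp⟩
    · rw [← ha w, Finset.mul_sum]
      exact hg.1 (e.symm w)
    · have h1 := hg.2 i
      rw [finsum_eq_sum_of_fintype, ← Finset.mul_sum, hb i] at h1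
      rw [← h1]
      exact e.symm.sum_comp fun w => ∑ j, g w i j
  · rw [finprod_eq_prod_of_fintype]
    have h1 : ∀ w : v.Above L, localFactor w.1 (Cent ι)
        (fun ij : Fin r × Fin (tee D v s) => g (e w) ij.1 ij.2) =
        (∏ k ∈ Finset.Icc 1 c, (Q ^ k - 1)) * ∏ i, ∏ j, coeffA Q (g (e w) i j) := by
      intro w
      rw [localFactor_eq, hQ, hc, Fintype.prod_prod_type]
    rw [Finset.prod_congr rfl fun w _ => h1 w, Finset.prod_mul_distrib, Finset.prod_const,
      Finset.card_univ, Fintype.card_congr e, Fintype.card_fin,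
      e.prod_comp fun w => ∏ i, ∏ j, coeffA Q (g w i j)]

end ClassNumber

theorem proposition4p8
    {Fq K D : Type*} [Field Fq] [Finite Fq]
    [Field K] [Algebra Fq K] [Algebra (RatFunc Fq) K] [IsScalarTower Fq (RatFunc Fq) K]
    [FunctionField Fq K]
    (hconst : ∀ x : K, IsAlgebraic Fq x → x ∈ Set.range (algebraMap Fq K))
    [Ring D] [Algebra K D] [Algebra.IsCentral K D] [IsSimpleRing D] [FiniteDimensional K D]
    (infty : ClassNumber.Place Fq K) (hdef : infty.IsDefinite D)
    (s : ℕ) (hs : s ∣ ClassNumber.constDegree Fq K D)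
    (ι : ClassNumber.constExt Fq K s →ₐ[K] D)
    (v : ClassNumber.Place Fq K) (hv : v ≠ infty)
    {r : ℕ} (f : Fin r → ℕ) (hf : ∀ i, 0 < f i) (hfsum : ∑ i, f i = v.localCapacity D)
    (hΩ : (ClassNumber.Omega (ClassNumber.constExt Fq K s) D v s f).Nonempty) :
    MvPowerSeries.coeff
        (Finsupp.equivFunOnFinite.symm
          (Sum.elim (fun _ : Fin (ClassNumber.ell v s) => ClassNumber.mS D v s)
            (ClassNumber.fS D v s f)))
        (ClassNumber.genG
          ((v.norm : ℚ) ^ (ClassNumber.dPrime D v s * (s / ClassNumber.ell v s)))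
          (fun w => MvPowerSeries.X (Sum.inl w)) (fun i => MvPowerSeries.X (Sum.inr i))
          (fun _ : Fin (ClassNumber.tee D v s) => 1)) =
      (∏ k ∈ Finset.Icc 1 (ClassNumber.mS D v s),
          (((v.norm : ℚ) ^ (ClassNumber.dPrime D v s * (s / ClassNumber.ell v s))) ^ k - 1)) ^
        (-(ClassNumber.ell v s : ℤ)) * ClassNumber.Theta ι v s f := by
  open ClassNumber in
  have : FiniteDimensional (RatFunc Fq) K := ‹FunctionField Fq K›
  have : IsFunctionField Fq K := isFunctionField_of_finiteDimensional_ratFunc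
  have hs0 : 0 < s := Nat.pos_of_dvd_of_pos hs (constDegree_pos Fq K D)
  have hell : 0 < ell v s := Nat.gcd_pos_of_pos_left _ hs0
  have htee : 0 < tee D v s := tee_pos hs0 v
  have hratio : 0 < ratio D v s := ratio_pos hs0 v
  have hcard := Place.natCard_above_constExt hconst hs0 v
  have hfin : Finite (v.Above (constExt Fq K s)) :=
    Nat.finite_of_card_ne_zero (hcard.trans_ne hell.ne')
  let e : v.Above (constExt Fq K s) ≃ Fin (ell v s) := Finite.equivFinOfCardEq hcard
  have hdata := Place.local_data_constExt hconst hs0 ι v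
  have hd : ∀ w : v.Above (constExt Fq K s), w.1.localIndex (Cent ι) = dPrime D v s := fun w => by
    rw [dPrime, ← (hdata w).2.1, Nat.mul_div_cancel _ htee]
  have hm : ∀ w : v.Above (constExt Fq K s), w.1.localCapacity (Cent ι) = mS D v s := fun w => by
    rw [mS, ← (hdata w).2.2, Nat.mul_div_cancel_left _ hs0]
  -- `s = ℓ t (s / (ℓ t))` and `s m_w = m_v t` give `m_v = ℓ (s / (ℓ t)) m_w`
  have hcap : v.localCapacity D = ell v s * (ratio D v s * mS D v s) := by
    refine Nat.eq_of_mul_eq_mul_right htee ?_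
    let w := e.symm ⟨0, hell⟩
    rw [← (hdata w).2.2, hm w]
    nth_rw 1 [← ell_mul_tee_mul_ratio v (D := D) (s := s)]
    ring
  have hQ : ∀ w : v.Above (constExt Fq K s), (w.1.norm : ℚ) ^ w.1.localIndex (Cent ι) =
      (v.norm : ℚ) ^ (dPrime D v s * (s / ell v s)) := fun w => by
    rw [(hdata w).1, hd w, Nat.cast_pow, ← pow_mul, mul_comm]
  obtain ⟨g₀, hg₀⟩ := hΩ
  -- divisibility of the `f_i` comes from any member of `Ω_v`
  have hfdvd : ∀ i, ratio D v s * fS D v s f i = f i := fun i => by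
    refine Nat.mul_div_cancel' ?_
    have := Fintype.ofFinite (v.Above (constExt Fq K s))
    rw [← hg₀.2 i, finsum_eq_sum_of_fintype, ← Finset.mul_sum]
    exact dvd_mul_right _ _
  have hpos : 0 < dPrime D v s * (s / ell v s) := by
    have := isSimpleRing_baseChange (F := K) (A := D) v.completion
    have := isCentral_baseChange (F := K) (A := D) v.completion
    have hv0 : 0 < v.localIndex D := index_pos v.completion (v.completion ⊗[K] D)
    refine Nat.mul_pos (Nat.div_pos (Nat.le_of_dvd hv0 (Nat.gcd_dvd_right _ _)) htee)
      (Nat.div_pos (Nat.le_of_dvd hs0 (Nat.gcd_dvd_left _ _)) hell)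
  -- so that the factors `Q ^ k - 1` do not vanish
  have hQ1 : (1 : ℚ) < (v.norm : ℚ) ^ (dPrime D v s * (s / ell v s)) :=
    one_lt_pow₀ (by exact_mod_cast v.one_lt_norm) hpos.ne'
  rw [coeff_genG_X_X_one, Theta_eq ι v s f e hQ hm (a := fun _ => mS D v s) (b := fS D v s f)
    (fun _ n => ?_) (fun i n => ?_), zpow_neg, zpow_natCast, inv_mul_cancel_left₀]
  · refine pow_ne_zero _ (Finset.prod_ne_zero_iff.2 fun k hk => sub_ne_zero.2 ?_)
    exact (one_lt_pow₀ hQ1 (Nat.one_le_iff_ne_zero.1 (Finset.mem_Icc.1 hk).1)).ne'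
  · rw [hcap]
    exact ⟨fun h => Nat.eq_of_mul_eq_mul_left hratio (Nat.eq_of_mul_eq_mul_left hell h),
      fun h => by rw [h]⟩
  · rw [← hfdvd i]
    exact ⟨fun h => Nat.eq_of_mul_eq_mul_left hratio h, fun h => by rw [h]⟩
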